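/- **Setting.** There are $n\ge 1$ validators and a delay bound $\Delta\ge 1$; slot $t$ consists of the rounds $4\Delta t,\dots,4\Delta(t+1)-1$. The proposers $v_p^t$ of the slots are independent and uniformly distributed among the validators, and $v_p^t$ is unknown to the adversary before round $4\Delta t$. A (randomized, adaptive) adversary decides, depending on the whole history, which validators to corrupt and which honest validators are awake, which messages corrupted validators send, and when messages are delivered. Signatures cannot be forged, and ($\mathsf{GST}=0$) every block or vote sent or held by an honest awake validator at round $r$ is held by every honest validator awake at a round $\ge r+\Delta$; likewise proposals, which are gossiped in the first $\Delta$ rounds of their slot, reach every honest validator awake at a round $\ge r+\Delta$. A block of slot $t$ is valid only if it is authored by $v_p^t$ and slots strictly increase along its chain after genesis; honest validators ignore invalid blocks and messages from future slots. A validator that wakes up puts what it receives into its buffer and becomes *active* at the next round of the form $4\Delta t+3\Delta$ (validators awake since round $0$ are active since round $0$), until it is put to sleep or corrupted. **Protocol.** Each validator $v_i$ has a view $\mathcal V_i$ (initially genesis), a buffer $\mathcal B_i$ (initially empty) of received blocks and votes, a canonical chain $\mathsf{ch}_i$ and an available chain $\mathsf{chAva}_i$ (initially genesis). Write $A\prec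 B$ if $A$ is a (not necessarily strict) prefix of $B$. Let $\mathsf{FC}$ be a fork choice. In slot $t$, active validators do the following. * Round $4\Delta t$: the proposer merges its buffer into its view, creates a block $B$ of slot $t$ extending $\mathsf{FC}(\mathcal V_i,t)$, sets $\mathsf{ch}_i\gets B$, and sends a proposal with $B$ and the view $\mathcal V_i\cup\{B\}$. Active validators receiving the proposal of slot $t$ in rounds $[4\Delta t,4\Delta t+\Delta]$ merge the proposed view into their view. * Round $4\Delta t+\Delta$: set $\mathsf{ch}_i\gets \mathsf{FC}(\mathcal V_i,t)$ and send a head vote of slot $t$ for it. * Round $4\Delta t+2\Delta$: let $B_{\rm fast}$ be the highest $B\prec \mathsf{ch}_i$ such that $\mathcal B_i$ contains head votes of slot $t$ for descendants of $B$ by at least $\frac23 n$ validators (genesis if there is none), and let $\mathsf{ch}_i^{\lceil\kappa}$ be the prefix of $\mathsf{ch}_i$ of blocks of slots $\le t-\kappa$. Unless both are prefixes of $\mathsf{chAva}_i$, set $\mathsf{chAva}_i$ to the higher of them. Then send an FFG vote from the latest justified checkpoint of $\mathcal V_i$ to $(B,t)$, with $B$ the higher of the latest justified block and $\mathsf{chAva}_i$.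 * Round $4\Delta t+3\Delta$: merge the buffer into the view. A checkpoint is a pair of a block and a slot. It is justified in a view if it is $(\text{genesis},0)$ or is reached from it by a chain of supermajority links, i.e. pairs $(C,C')$ of checkpoints with $C.t<C'.t$, $C.B\prec C'.B$, $C.B.t\le C.t$, $C'.B.t\le C'.t$, and FFG votes for $C\to C'$ by at least $\frac23n$ validators in the view; it is finalized if moreover there is a supermajority link from it to a checkpoint of the next slot. The latest justified checkpoint is the justified one of highest slot. $\mathrm{RLMD\text{-}GHOST}(\mathcal V,t)$ (expiration period $\eta\ge1$) removes the head votes of all validators with two different head votes for a same slot in $\mathcal V$, then all head votes not from slots in $[t-\eta,t)$, then all but the latest head votes of each validator, and runs GHOST from genesis (move to the child with the most validators voting for its descendants, until a leaf). $\mathrm{HFC}(\mathcal V,t)$ does the same after removing from $\mathcal V$ the blocks that conflict with the latest justified block of $\mathcal V$. Ties are broken by arbitrary deterministic rules. **Compliance.** Let $H_t$ and $A_t$ be the sets of active and of corrupted validators at round $4\Delta t+\Delta$. An execution is $\eta$-compliant if for every slot $t\ge1$ $$|H_{t-1}|>\Bigl|A_t\cup\Bigl(\bigcup_{\max(0,t-\eta)\le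 s\le t-2}H_s\setminus H_{t-1}\Bigr)\Bigr| ,$$ and fewer than $n/3$ validators ever cast two different head votes for one slot. An *honest proposal* of slot $t$ is the block proposed by $v_p^t$ if $v_p^t$ is active at round $4\Delta t$ and not corrupted by round $4\Delta t+\Delta$. A block $B$ is *fast confirmed* by an active $v_i$ at slot $t$ if $B\prec\mathsf{ch}_i$ and $\mathcal B_i$ has head votes of slot $t$ by $\ge\frac23n$ validators for descendants of $B$ at round $4\Delta t+2\Delta$. **Theorem (Execution equivalence).** Fix $n,\Delta,\eta\ge 1$ and the tie-breaking rules. For every time horizon $T=T(\kappa)$ polynomial in $\kappa$, each of the following holds except with probability negligible in $\kappa$, uniformly over all adversaries: if the execution with $\mathsf{FC}=\mathrm{HFC}$ and $\mathsf{GST}=0$ is $\eta$-compliant, then, in the rounds up to $T$, 1. its outputs (sent messages, canonical chain, available chain and finalized chain of every validator in every round, and the sets of corrupted, awake and active validators) are exactly those of the execution with $\mathsf{FC}=\mathrm{RLMD\text{-}GHOST}$, the same adversarial strategy and the same randomness; 2. ($\eta$-reorg-resilience) every honest proposal of a slot $t$ is in the canonical chain of all active validators at all rounds $\ge4\Delta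 t+\Delta$; 3. ($\eta$-dynamic availability) the available chains of any two honest validators at any two rounds are comparable; and for some $T_{\rm conf}=O(\kappa)$ not depending on $T$ or the adversary, for all rounds $r$ and $r'\ge r+T_{\rm conf}$, the available chain at round $r'$ of every active validator contains an honest proposal made at a round $>r$; 4. (reorg resilience of fast confirmations) a block fast confirmed by an honest validator at a slot $t$ is in the canonical chain of all active validators at all rounds $\ge 4\Delta(t+1)+\Delta$; 5. (liveness of fast confirmations) an honest proposal of a slot $t$ with $|H_t|\ge\frac23n$ is fast confirmed by all validators active at round $4\Delta t+2\Delta$. Here, in statements about the canonical (resp. available) chain of an active validator at a round $r$, the validator is also required to have been active at the latest round $\le r$ of the form $4\Delta s+\Delta$ (resp. $4\Delta s+2\Delta$), i.e. to have taken part in the latest update of that chain. -/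

import Mathlib

namespace SSF

noncomputable section

open scoped Classical

universe u

/-! ### Blocks, checkpoints, votes, views, messages -/

/-- A block together with its whole ancestry, so that a block is identified with the chain of which
it is the head. A non-genesis block has a body, a slot and an author (a validator in `Fin n`). -/
inductive Block (n : ℕ) (Body : Type u) : Type u where
  | genesis : Block n Body
  | mk (parent : Block n Body) (body : Body) (slot : ℕ) (author : Fin n) : Block n Body

namespace Block

variable {n : ℕ} {Body : Type u}

/-- The slot of a block; genesis belongs to slot `0`. -/
def slot : Block n Body → ℕ
  | genesis => 0
  | mk _ _ s _ => s

/-- The height `|B|` of a block. -/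
def height : Block n Body → ℕ
  | genesis => 0
  | mk p _ _ _ => p.height + 1

/-- The blocks of the chain with head `B`, from `B` down to genesis. -/
def chain : Block n Body → List (Block n Body)
  | genesis => [genesis]
  | mk p b s a => mk p b s a :: p.chain

/-- `A.Prefix B`: the chain with head `A` is a (not necessarily strict) prefix of the chain with
head `B`, written `A ≺ B` in the literature. -/
def Prefix (A B : Block n Body) : Prop := A ∈ B.chain

/-- `c.IsChildOf b`: the parent of `c` is `b`. -/
def IsChildOf (c b : Block n Body) : Prop := ∃ body s a, c = mk b body s a

/-- Validity of a block (and of its ancestors) for the sequence `prop` of slot proposers: a block of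
slot `s` is authored by the proposer of slot `s`, and slots strictly increase along a chain (the
children of genesis may have any slot, as genesis is not the block of any proposer). -/
def Valid (prop : ℕ → Fin n) : Block n Body → Prop
  | genesis => True
  | mk p _ s a => p.Valid prop ∧ a = prop s ∧ (p = genesis ∨ p.slot < s)

/-- The highest block of the chain of `B` that satisfies `P`, or genesis if there is none. -/
def highest (P : Block n Body → Prop) : Block n Body → Block n Body
  | genesis => genesis
  | mk p b s a => if P (mk p b s a) then mk p b s a else p.highest P

/-- The `κ`-deep prefix at slot `t` of the chain of `B`: its blocks from slots at most `t - κ`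
(and genesis). -/
def deepPrefix (κ t : ℕ) (B : Block n Body) : Block n Body :=
  B.highest (fun A => A.slot + κ ≤ t)

end Block

/-- A checkpoint: a block and a slot. -/
structure Checkpoint (n : ℕ) (Body : Type u) : Type u where
  block : Block n Body
  slot : ℕ

/-- The objects that a view contains: blocks, head votes and FFG votes. -/
inductive Item (n : ℕ) (Body : Type u) : Type u where
  | block (B : Block n Body) : Item n Body
  | headVote (B : Block n Body) (t : ℕ) (v : Fin n) : Item n Body
  | ffgVote (source target : Checkpoint n Body) (v : Fin n) : Item n Body

/-- Views (and buffers) are finite sets of blocks and votes. -/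
abbrev View (n : ℕ) (Body : Type u) : Type u := Finset (Item n Body)

/-- Network messages: a block, a vote, or a proposal carrying a block, a proposed view, a slot and
its sender. -/
inductive Message (n : ℕ) (Body : Type u) : Type u where
  | item (x : Item n Body) : Message n Body
  | proposal (B : Block n Body) (V : View n Body) (t : ℕ) (v : Fin n) : Message n Body

section Basic

variable {n : ℕ} {Body : Type u}

/-- An item together with the blocks that it contains. -/
def Item.parts : Item n Body → View n Body
  | .block B => {.block B}
  | .headVote B t v => {.headVote B t v, .block B}
  | .ffgVote C D v => {.ffgVote C D v, .block C.block, .block D.block}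

/-- What an honest validator accepts during slot `t`: the blocks contained in the item are valid and
nothing in it belongs to a slot after `t`. -/
def Item.Acceptable (prop : ℕ → Fin n) (t : ℕ) : Item n Body → Prop
  | .block B => B.Valid prop ∧ B.slot ≤ t
  | .headVote B s _ => B.Valid prop ∧ B.slot ≤ t ∧ s ≤ t
  | .ffgVote C D _ => (C.block.Valid prop ∧ C.block.slot ≤ t ∧ C.slot ≤ t) ∧
      (D.block.Valid prop ∧ D.block.slot ≤ t ∧ D.slot ≤ t)

/-- The signed objects that come with a block: the block itself and its non-genesis ancestors. -/
def Block.signed (B : Block n Body) : Set (Message n Body) :=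
  {m | ∃ A : Block n Body, A.Prefix B ∧ A ≠ .genesis ∧ m = .item (.block A)}

/-- The signed objects contained in an item. -/
def Item.signed : Item n Body → Set (Message n Body)
  | .block B => B.signed
  | .headVote B t v => {.item (.headVote B t v)} ∪ B.signed
  | .ffgVote C D v => {.item (.ffgVote C D v)} ∪ C.block.signed ∪ D.block.signed

/-- The signed objects contained in a message. -/
def Message.signed : Message n Body → Set (Message n Body)
  | .item x => x.signed
  | .proposal B V t v => {.proposal B V t v} ∪ B.signed ∪ ⋃ x ∈ V, x.signed

/-- The signer of a signed object (genesis is not signed). -/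
def Message.signer : Message n Body → Option (Fin n)
  | .item (.block .genesis) => none
  | .item (.block (.mk _ _ _ a)) => some a
  | .item (.headVote _ _ v) => some v
  | .item (.ffgVote _ _ v) => some v
  | .proposal _ _ _ v => some v

end Basic

/-- A deterministic rule for breaking ties: it picks an element of every nonempty finite set. -/
structure TieBreak (α : Type u) : Type u where
  pick : Finset α → α
  pick_mem : ∀ s : Finset α, s.Nonempty → pick s ∈ s

/-! ### GHOST, RLMD-GHOST, justification and the justification-respecting fork choice -/

section ForkChoice

variable {n : ℕ} {Body : Type u}

/-- The block tree of a view: the blocks of the view and their ancestors. -/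
def tree (V : View n Body) : Finset (Block n Body) :=
  V.biUnion (fun x => match x with
    | .block B => B.chain.toFinset
    | _ => ∅)

/-- The children of `b` in the block tree of `V`. -/
def children (V : View n Body) (b : Block n Body) : Finset (Block n Body) :=
  (tree V).filter (fun c => c.IsChildOf b)

/-- The weight of `c`: the number of validators with a head vote in `V` for a descendant of `c`. -/
def weight (V : View n Body) (c : Block n Body) : ℕ :=
  (Finset.univ.filter (fun v : Fin n =>
    ∃ (B : Block n Body) (s : ℕ), c.Prefix B ∧ Item.headVote B s v ∈ V)).card

/-- The children of `b` of maximal weight. -/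
def heaviestChildren (V : View n Body) (b : Block n Body) : Finset (Block n Body) :=
  (children V b).filter (fun c => ∀ d ∈ children V b, weight V d ≤ weight V c)

/-- One step of GHOST: move to a heaviest child, or stay if there is no child. -/
def ghostStep (tb : TieBreak (Block n Body)) (V : View n Body) (b : Block n Body) : Block n Body :=
  if (children V b).Nonempty then tb.pick (heaviestChildren V b) else b

/-- GHOST: starting at genesis, move to a heaviest child until a leaf is reached. Every step that
does not stay raises the height, so that the maximal height in the tree is a sufficient number
of steps. -/
def ghost (tb : TieBreak (Block n Body)) (V : View n Body) : Block n Body :=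
  (ghostStep tb V)^[(tree V).sup Block.height] .genesis

/-- Validator `v` equivocates in the set `S`: it has two different head votes for one slot. -/
def Equivocates (S : Set (Item n Body)) (v : Fin n) : Prop :=
  ∃ (t : ℕ) (B C : Block n Body), B ≠ C ∧ Item.headVote B t v ∈ S ∧ Item.headVote C t v ∈ S

/-- Keep only the head votes for which `keep block slot validator` holds, and everything else. -/
def filterHeadVotes (keep : Block n Body → ℕ → Fin n → Prop) (V : View n Body) : View n Body :=
  V.filter (fun x => match x with
    | .headVote B s v => keep B s v
    | _ => True)

/-- Remove the head votes of the validators that equivocate in the view. -/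
def filEq (V : View n Body) : View n Body :=
  filterHeadVotes (fun _ _ v => ¬ Equivocates {x | x ∈ V} v) V

/-- Keep only the head votes from the expiry period `[t - η, t)` of slot `t`. -/
def filExp (η t : ℕ) (V : View n Body) : View n Body :=
  filterHeadVotes (fun _ s _ => t ≤ s + η ∧ s < t) V

/-- Remove all but the latest head votes of every validator. -/
def filLmd (V : View n Body) : View n Body :=
  filterHeadVotes
    (fun _ s v => ∀ (C : Block n Body) (s' : ℕ), Item.headVote C s' v ∈ V → s' ≤ s) V

/-- The RLMD-GHOST fork choice with expiration period `η`. -/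
def rlmdGhost (tb : TieBreak (Block n Body)) (η : ℕ) (V : View n Body) (t : ℕ) : Block n Body :=
  ghost tb (filLmd (filExp η t (filEq V)))

/-- The genesis checkpoint. -/
def genesisCheckpoint : Checkpoint n Body := ⟨.genesis, 0⟩

/-- There is a supermajority link in `V` between two checkpoints: at least `2n/3` validators cast
the FFG vote from `C` to `D`, which has to be well-formed. -/
def SupermajorityLink (V : View n Body) (C D : Checkpoint n Body) : Prop :=
  C.block.slot ≤ C.slot ∧ D.block.slot ≤ D.slot ∧ C.slot < D.slot ∧ C.block.Prefix D.block ∧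
  2 * n ≤ 3 * (Finset.univ.filter (fun v : Fin n => Item.ffgVote C D v ∈ V)).card

/-- A checkpoint is justified in `V` if a chain of supermajority links in `V` leads to it from
the genesis checkpoint. -/
inductive Justified (V : View n Body) : Checkpoint n Body → Prop where
  | genesis : Justified V genesisCheckpoint
  | link (C D : Checkpoint n Body) :
      Justified V C → SupermajorityLink V C D → Justified V D

/-- The finite set of checkpoints justified in `V` (each is genesis or the target of a vote). -/
def justifiedCheckpoints (V : View n Body) : Finset (Checkpoint n Body) :=
  (insert genesisCheckpoint (V.biUnion (fun x => match x with
    | .ffgVote _ D _ => {D}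
    | _ => ∅))).filter (Justified V)

/-- The latest justified checkpoint of `V`: the justified checkpoint of highest slot. -/
def latestJustified (tc : TieBreak (Checkpoint n Body)) (V : View n Body) : Checkpoint n Body :=
  tc.pick ((justifiedCheckpoints V).filter
    (fun C => ∀ D ∈ justifiedCheckpoints V, D.slot ≤ C.slot))

/-- A checkpoint is finalized in `V` if it is justified and there is a supermajority link from it
to a checkpoint of the next slot. -/
def Finalized (V : View n Body) (C : Checkpoint n Body) : Prop :=
  Justified V C ∧ ∃ D, SupermajorityLink V C D ∧ D.slot = C.slot + 1

/-- The finalized chain according to `V`: genesis, the finalized blocks and their ancestors. -/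
def finalizedChain (V : View n Body) : Set (Block n Body) :=
  {B | B = .genesis ∨ ∃ C, Finalized V C ∧ B.Prefix C.block}

/-- Remove the blocks that conflict with the latest justified block. -/
def filFFG (tc : TieBreak (Checkpoint n Body)) (V : View n Body) : View n Body :=
  V.filter (fun x => match x with
    | .block B =>
        (latestJustified tc V).block.Prefix B ∨ B.Prefix (latestJustified tc V).block
    | _ => True)

/-- The justification-respecting fork choice HFC. -/
def hfc (tb : TieBreak (Block n Body)) (tc : TieBreak (Checkpoint n Body)) (η : ℕ)
    (V : View n Body) (t : ℕ) : Block n Body :=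
  rlmdGhost tb η (filFFG tc V) t

end ForkChoice

/-! ### The protocol -/

/-- The parameters of the protocol: the delay bound `Δ` (a slot has `4 * Δ` rounds), the
confirmation depth `κ`, the fork choice, and the tie-breaking of latest justified checkpoints. -/
structure Protocol (n : ℕ) (Body : Type u) : Type u where
  Δ : ℕ
  κ : ℕ
  forkChoice : View n Body → ℕ → Block n Body
  tieCheckpoint : TieBreak (Checkpoint n Body)

/-- The local state of a validator: view, buffer, canonical chain and confirmed (available) chain. -/
structure LocalState (n : ℕ) (Body : Type u) : Type u where
  view : View n Body
  buffer : View n Body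
  chain : Block n Body
  available : Block n Body

/-- The global configuration of a round: corrupted validators, awake validators and active
validators (the latter two are honest), and for every validator its local state at the end of the
round and the messages delivered to it and sent by it in the round. -/
structure Config (n : ℕ) (Body : Type u) : Type u where
  corrupted : Finset (Fin n)
  awake : Finset (Fin n)
  active : Finset (Fin n)
  state : Fin n → LocalState n Body
  delivered : Fin n → Finset (Message n Body)
  sent : Fin n → Finset (Message n Body)

/-- The adversary (with the environment). In each round it chooses, as functions of the complete
history (latest round first), which further validators it corrupts and which honest validators are
awake; then, knowing the proposer of the current slot as well, it chooses the messages delivered to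
each validator, which may be its own messages, and the bodies of new blocks. It does not
know the proposers of slots that have not begun. -/
structure Adversary (n : ℕ) (Body : Type u) : Type u where
  corrupt : List (Config n Body) → Finset (Fin n)
  awake : List (Config n Body) → Finset (Fin n)
  deliver : List (Config n Body) → Fin n → Fin n → Finset (Message n Body)
  body : List (Config n Body) → Fin n → Body

section Execution

variable {n : ℕ} {Body : Type u}

/-- A proposal is acceptable in slot `t` if it comes from the proposer of its slot, which has begun,
and its block is acceptable. -/
def AcceptableProposal (prop : ℕ → Fin n) (t : ℕ) (B : Block n Body) (s : ℕ) (v : Fin n) : Prop :=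
  v = prop s ∧ s ≤ t ∧ (Item.block B).Acceptable prop t

/-- What a message adds to the buffer of a validator that receives it in slot `t`. -/
def toBuffer (prop : ℕ → Fin n) (t : ℕ) : Message n Body → View n Body
  | .item x => if x.Acceptable prop t then x.parts else ∅
  | .proposal B _ s v => if AcceptableProposal prop t B s v then {.block B} else ∅

/-- What a message adds to the view of an active validator that receives it in round `r`: the
proposed view, if the message is a proposal for slot `s` and `r` is in `[4Δs, 4Δs + Δ]`. -/
def toView (Δ : ℕ) (prop : ℕ → Fin n) (r : ℕ) : Message n Body → View n Body
  | .item _ => ∅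
  | .proposal B V s v =>
      if AcceptableProposal prop (r / (4 * Δ)) B s v ∧ 4 * Δ * s ≤ r ∧ r ≤ 4 * Δ * s + Δ
      then (V.filter (Item.Acceptable prop (r / (4 * Δ)))).biUnion Item.parts else ∅

/-- Processing the messages `M` received in round `r`. -/
def receive (Δ : ℕ) (prop : ℕ → Fin n) (r : ℕ) (isActive : Prop) (M : Finset (Message n Body))
    (L : LocalState n Body) : LocalState n Body :=
  { L with
    buffer := L.buffer ∪ M.biUnion (toBuffer prop (r / (4 * Δ)))
    view := if isActive then L.view ∪ M.biUnion (toView Δ prop r) else L.view }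

/-- Merging the buffer into the view. -/
def merge (L : LocalState n Body) : LocalState n Body :=
  { L with view := L.view ∪ L.buffer, buffer := ∅ }

/-- `B` is backed by a fast confirmation quorum: the buffer contains head votes from slot `t` for
descendants of `B` from at least `2n/3` distinct validators. -/
def FastQuorum (buffer : View n Body) (t : ℕ) (B : Block n Body) : Prop :=
  2 * n ≤ 3 * (Finset.univ.filter (fun v : Fin n =>
    ∃ B' : Block n Body, B.Prefix B' ∧ Item.headVote B' t v ∈ buffer)).card

/-- The highest block of the canonical chain with a fast confirmation quorum, or genesis. -/
def fastBlock (L : LocalState n Body) (t : ℕ) : Block n Body :=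
  L.chain.highest (FastQuorum L.buffer t)

/-- The confirmed chain after the confirmation step of slot `t`. -/
def updatedAvailable (κ t : ℕ) (L : LocalState n Body) : Block n Body :=
  if (fastBlock L t).Prefix L.available ∧ (L.chain.deepPrefix κ t).Prefix L.available then
    L.available
  else if (L.chain.deepPrefix κ t).height < (fastBlock L t).height then fastBlock L t
  else L.chain.deepPrefix κ t

/-- The block of the target checkpoint: the higher of the latest justified block `J` and the
confirmed block `A`. -/
def targetBlock (J A : Block n Body) : Block n Body :=
  if J.height < A.height then A else J

/-- The actions of an active validator `i` in round `r` after processing the received messages: its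
new state and the messages that it sends. -/
def act (P : Protocol n Body) (prop : ℕ → Fin n) (r : ℕ) (body : Body) (i : Fin n)
    (L : LocalState n Body) : LocalState n Body × Finset (Message n Body) :=
  let t := r / (4 * P.Δ)
  if r = 4 * P.Δ * t then
    if i = prop t then
      let L₁ := merge L
      let B : Block n Body := .mk (P.forkChoice L₁.view t) body t i
      ({ L₁ with chain := B }, {.proposal B (insert (.block B) L₁.view) t i})
    else (L, ∅)
  else if r = 4 * P.Δ * t + P.Δ then
    let B := P.forkChoice L.view t
    ({ L with chain := B }, {.item (.headVote B t i)})
  else if r = 4 * P.Δ * t + 2 * P.Δ then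
    let A := updatedAvailable P.κ t L
    let J := latestJustified P.tieCheckpoint L.view
    ({ L with available := A }, {.item (.ffgVote J ⟨targetBlock J.block A, t⟩ i)})
  else if r = 4 * P.Δ * t + 3 * P.Δ then (merge L, ∅)
  else (L, ∅)

/-- The configuration before the first round: validators that are awake from the first round on are
active from the first round on. -/
def initialConfig : Config n Body where
  corrupted := ∅
  awake := Finset.univ
  active := Finset.univ
  state := fun _ => ⟨{.block .genesis}, ∅, .genesis, .genesis⟩
  delivered := fun _ => ∅
  sent := fun _ => ∅

/-- The configuration of round `r`, given the history `h` of the earlier rounds. An honest validator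
that wakes up only fills its buffer until the next merge round `4Δt + 3Δ`, at which it merges its
buffer into its view and becomes active; it stays active until it is put to sleep or corrupted.
The states of asleep and of corrupted validators are left unchanged. -/
def nextConfig (P : Protocol n Body) (σ : Adversary n Body) (prop : ℕ → Fin n) (r : ℕ)
    (h : List (Config n Body)) : Config n Body :=
  let t := r / (4 * P.Δ)
  let prev := h.headD initialConfig
  let corrupted := prev.corrupted ∪ σ.corrupt h
  let awake := σ.awake h \ corrupted
  let active := awake.filter (fun i => i ∈ prev.active ∨ r = 4 * P.Δ * t + 3 * P.Δ)
  let delivered := fun i => if i ∈ awake then σ.deliver h (prop t) i else ∅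
  let received := fun i =>
    if i ∈ awake then receive P.Δ prop r (i ∈ prev.active) (delivered i) (prev.state i)
    else prev.state i
  let acted := fun i =>
    if i ∈ active then act P prop r (σ.body h i) i (received i) else (received i, ∅)
  { corrupted := corrupted
    awake := awake
    active := active
    state := fun i => (acted i).1
    delivered := delivered
    sent := fun i => (acted i).2 }

/-- The configurations of the rounds before round `r`, latest first. -/
def history (P : Protocol n Body) (σ : Adversary n Body) (prop : ℕ → Fin n) :
    ℕ → List (Config n Body)
  | 0 => []
  | r + 1 => nextConfig P σ prop r (history P σ prop r) :: history P σ prop r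

/-- The execution of protocol `P` with adversary `σ` and proposers `prop`: the configuration of
every round. -/
def run (P : Protocol n Body) (σ : Adversary n Body) (prop : ℕ → Fin n) (r : ℕ) : Config n Body :=
  nextConfig P σ prop r (history P σ prop r)

end Execution

/-! ### Compliant executions -/

section Compliance

variable {n : ℕ} {Body : Type u}

/-- The blocks and votes held by a validator. -/
def LocalState.held (L : LocalState n Body) : View n Body := L.view ∪ L.buffer

/-- Signatures cannot be forged: every signed object in a delivered message is signed by a
corrupted validator or was sent before by its signer. -/
def Unforgeable (E : ℕ → Config n Body) : Prop :=
  ∀ (r : ℕ) (i : Fin n), ∀ m ∈ (E r).delivered i, ∀ c ∈ m.signed, ∀ v : Fin n,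
    c.signer = some v → v ∈ (E r).corrupted ∨
      ∃ r' < r, ∃ m' ∈ (E r').sent v, c ∈ m'.signed

/-- Gossip with delay at most `Δ` after `GST`. Every block or vote sent or held by an honest awake
validator at round `r` is held by every honest validator that is awake at a round at least `Δ` rounds
after `r` and `GST`. The same holds for the reception of a proposal of slot `s` that is sent by an
honest validator, or received by an honest awake one during the first `Δ` rounds of slot `s`. -/
def Synchronous (Δ GST : ℕ) (E : ℕ → Config n Body) : Prop :=
  (∀ (r : ℕ) (i : Fin n) (x : Item n Body),
    (Message.item x ∈ (E r).sent i ∨ (i ∈ (E r).awake ∧ x ∈ ((E r).state i).held)) →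
    ∀ r', max r GST + Δ ≤ r' → ∀ j ∈ (E r').awake, x ∈ ((E r').state j).held) ∧
  (∀ (r : ℕ) (i : Fin n) (B : Block n Body) (V : View n Body) (s : ℕ) (v : Fin n),
    (Message.proposal B V s v ∈ (E r).sent i ∨
      (Message.proposal B V s v ∈ (E r).delivered i ∧ 4 * Δ * s ≤ r ∧ r < 4 * Δ * s + Δ)) →
    ∀ r', max r GST + Δ ≤ r' → ∀ j ∈ (E r').awake,
      ∃ q ≤ r', 4 * Δ * s ≤ q ∧ Message.proposal B V s v ∈ (E q).delivered j)

/-- `H_t`: the validators active at round `4Δt + Δ`. -/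
def activeAt (Δ : ℕ) (E : ℕ → Config n Body) (t : ℕ) : Finset (Fin n) :=
  (E (4 * Δ * t + Δ)).active

/-- `A_t`: the validators corrupted at round `4Δt + Δ`. -/
def corruptedAt (Δ : ℕ) (E : ℕ → Config n Body) (t : ℕ) : Finset (Fin n) :=
  (E (4 * Δ * t + Δ)).corrupted

/-- `H_{t-τ, t-2}`: the validators in `H_s` for some slot `s ≥ 0` with `t - τ ≤ s ≤ t - 2`. -/
def recentlyActive (Δ τ : ℕ) (E : ℕ → Config n Body) (t : ℕ) : Finset (Fin n) :=
  Finset.univ.filter (fun v => ∃ s, t ≤ s + τ ∧ s + 2 ≤ t ∧ v ∈ activeAt Δ E s)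

/-- `τ`-sleepiness at every slot `t` after `GST`:
`|H_{t-1}| > |A_t ∪ (H_{t-τ, t-2} \ H_{t-1})|`. -/
def Sleepy (Δ τ GST : ℕ) (E : ℕ → Config n Body) : Prop :=
  ∀ t, GST < 4 * Δ * t →
    (corruptedAt Δ E t ∪ (recentlyActive Δ τ E t \ activeAt Δ E (t - 1))).card <
      (activeAt Δ E (t - 1)).card

/-- The blocks and votes that are ever held by validators while they are honest. -/
def everHeld (E : ℕ → Config n Body) : Set (Item n Body) :=
  {x | ∃ (r : ℕ) (i : Fin n), x ∈ ((E r).state i).held}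

/-- Fewer than `n/3` validators are ever slashable for equivocation with head votes. -/
def FewEquivocators (E : ℕ → Config n Body) : Prop :=
  3 * (Finset.univ.filter (fun v : Fin n => Equivocates (everHeld E) v)).card < n

/-- `τ`-compliant executions, in the model with global stabilization time `GST` and with fewer than
`n/3` validators that ever equivocate with head votes. -/
structure Compliant (Δ τ GST : ℕ) (E : ℕ → Config n Body) : Prop where
  unforgeable : Unforgeable E
  synchronous : Synchronous Δ GST E
  sleepy : Sleepy Δ τ GST E
  fewEquivocators : FewEquivocators E

end Compliance

/-! ### Outputs and properties of executions, up to a time horizon `T` -/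

section Properties

variable {n : ℕ} {Body : Type u}

/-- What the protocol outputs for a validator at a round: the messages that it sends, and its
canonical, available and finalized chains. -/
structure Output (n : ℕ) (Body : Type u) : Type u where
  sent : Finset (Message n Body)
  canonical : Block n Body
  available : Block n Body
  finalized : Set (Block n Body)

/-- The output of validator `i` in a configuration. -/
def output (c : Config n Body) (i : Fin n) : Output n Body :=
  ⟨c.sent i, (c.state i).chain, (c.state i).available, finalizedChain (c.state i).view⟩

/-- Two executions have the same outputs, for the same honest, awake and active validators. -/
def SameOutputs (T : ℕ) (E F : ℕ → Config n Body) : Prop :=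
  ∀ r ≤ T, (E r).corrupted = (F r).corrupted ∧ (E r).awake = (F r).awake ∧
    (E r).active = (F r).active ∧ ∀ i, output (E r) i = output (F r) i

/-- `B` is an honest proposal from slot `t`: the proposer of slot `t` was active at round `4Δt`,
proposed `B`, and is not corrupted by the voting round `4Δt + Δ`. -/
def HonestProposal (Δ : ℕ) (prop : ℕ → Fin n) (E : ℕ → Config n Body) (t : ℕ)
    (B : Block n Body) : Prop :=
  prop t ∈ (E (4 * Δ * t)).active ∧
  (∃ V, Message.proposal B V t (prop t) ∈ (E (4 * Δ * t)).sent (prop t)) ∧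
  prop t ∉ (E (4 * Δ * t + Δ)).corrupted

/-- Validator `i` is active at round `r` and was active at the latest round of the form
`4Δs + d` up to `r` (`d = Δ`: it took part in the latest voting round; `d = 2Δ`: it took part in the
latest confirmation round). -/
def ActiveSince (Δ d : ℕ) (E : ℕ → Config n Body) (r : ℕ) (i : Fin n) : Prop :=
  i ∈ (E r).active ∧
  ∃ s, 4 * Δ * s + d ≤ r ∧ r < 4 * Δ * (s + 1) + d ∧ i ∈ (E (4 * Δ * s + d)).active

/-- `B` is in the canonical chain of all active validators from round `q` on. -/
def CanonicalFrom (Δ T : ℕ) (E : ℕ → Config n Body) (q : ℕ) (B : Block n Body) : Prop :=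
  ∀ r, q ≤ r → r ≤ T → ∀ i, ActiveSince Δ Δ E r i → B.Prefix ((E r).state i).chain

/-- Reorg resilience. -/
def ReorgResilient (Δ T : ℕ) (prop : ℕ → Fin n) (E : ℕ → Config n Body) : Prop :=
  ∀ t B, HonestProposal Δ prop E t B → CanonicalFrom Δ T E (4 * Δ * t + Δ) B

/-- Safety of the available chain. -/
def Safe (T : ℕ) (E : ℕ → Config n Body) : Prop :=
  ∀ r ≤ T, ∀ r' ≤ T, ∀ i ∉ (E r).corrupted, ∀ j ∉ (E r').corrupted,
    ((E r).state i).available.Prefix ((E r').state j).available ∨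
    ((E r').state j).available.Prefix ((E r).state i).available

/-- Liveness of the available chain with confirmation time `Tconf`. -/
def Live (Δ Tconf T : ℕ) (prop : ℕ → Fin n) (E : ℕ → Config n Body) : Prop :=
  ∀ r r', r + Tconf ≤ r' → r' ≤ T → ∀ i, ActiveSince Δ (2 * Δ) E r' i →
    ∃ t B, r < 4 * Δ * t ∧ HonestProposal Δ prop E t B ∧
      B.Prefix ((E r').state i).available

/-- `B` is fast confirmed by `i` at slot `t`. -/
def FastConfirmed (Δ : ℕ) (E : ℕ → Config n Body) (t : ℕ) (i : Fin n) (B : Block n Body) : Prop :=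
  i ∈ (E (4 * Δ * t + 2 * Δ)).active ∧
  B.Prefix ((E (4 * Δ * t + 2 * Δ)).state i).chain ∧
  FastQuorum ((E (4 * Δ * t + 2 * Δ)).state i).buffer t B

/-- Reorg resilience of fast confirmations. -/
def FastReorgResilient (Δ T : ℕ) (E : ℕ → Config n Body) : Prop :=
  ∀ t i B, 4 * Δ * t + 2 * Δ ≤ T → FastConfirmed Δ E t i B →
    CanonicalFrom Δ T E (4 * Δ * (t + 1) + Δ) B

/-- Liveness of fast confirmations. -/
def FastLive (Δ T : ℕ) (prop : ℕ → Fin n) (E : ℕ → Config n Body) : Prop :=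
  ∀ t B, 4 * Δ * t + 2 * Δ ≤ T → HonestProposal Δ prop E t B →
    2 * n ≤ 3 * (activeAt Δ E t).card →
    ∀ i ∈ (E (4 * Δ * t + 2 * Δ)).active, FastConfirmed Δ E t i B

end Properties

/-! ### Probability -/

section Probability

open MeasureTheory

/-- The randomness of an execution: the coins of the adversary, and independently of them
independent proposers for all slots, each uniformly distributed among the `n` validators. -/
def randomness (n : ℕ) [NeZero n] (C : Type) [MeasurableSpace C] (coins : PMF C) :
    Measure (C × (ℕ → Fin n)) :=
  coins.toMeasure.prod
    (Measure.infinitePi (fun _ : ℕ => (PMF.uniformOfFintype (Fin n)).toMeasure))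

/-- `Q κ T σ prop` holds with overwhelming probability in the security parameter `κ`, for every time
horizon `T` polynomial in `κ`: the probability of failure is at most a negligible function of `κ`,
uniformly over all randomized adversaries. -/
def Overwhelming {n : ℕ} [NeZero n] {Body : Type u}
    (Q : ℕ → ℕ → Adversary n Body → (ℕ → Fin n) → Prop) : Prop :=
  ∀ horizon : Polynomial ℕ, ∃ ν : ℕ → ℝ,
    Asymptotics.SuperpolynomialDecay Filter.atTop (fun κ : ℕ => (κ : ℝ)) ν ∧
    ∀ (κ : ℕ) (C : Type) [MeasurableSpace C] [DiscreteMeasurableSpace C] (coins : PMF C)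
      (σ : C → Adversary n Body),
      (randomness n C coins).real {ω | ¬ Q κ (horizon.eval κ) (σ ω.1) ω.2} ≤ ν κ

end Probability

/-- The protocol with the justification-respecting fork choice HFC. -/
def hfcProtocol {n : ℕ} {Body : Type u} (Δ η : ℕ) (tb : TieBreak (Block n Body))
    (tc : TieBreak (Checkpoint n Body)) (κ : ℕ) : Protocol n Body :=
  ⟨Δ, κ, hfc tb tc η, tc⟩

/-- The same protocol with the plain RLMD-GHOST fork choice. -/
def rlmdProtocol {n : ℕ} {Body : Type u} (Δ η : ℕ) (tb : TieBreak (Block n Body))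
    (tc : TieBreak (Checkpoint n Body)) (κ : ℕ) : Protocol n Body :=
  ⟨Δ, κ, rlmdGhost tb η, tc⟩

end

end SSF

/-!
The theorem holds because both fork choices make the same decisions, and because RLMD-GHOST is
stable under them.

*Propagation* (`agreed_of_supported`). Suppose that all validators active at the voting round of
slot `t` vote for descendants of a block `X`. Their votes are in the view of every validator that
evaluates the fork choice of slot `t + 1`, and `η`-sleepiness says exactly that they outnumber the
unexpired votes of all other validators; a validator that is corrupted after it has voted for `X`
either still counts for `X` or is discarded as an equivocator. So RLMD-GHOST selects a descendant
of `X` in slot `t + 1`. In the same way a fast confirmation quorum decides the next slot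
(`agreed_of_fastQuorum`), since fewer than `n/3` of its members equivocate. By view-merge, all
voters of a slot vote for an honest proposal of this slot (`supported_of_honestProposal`).

*Agreement* (`followsRlmd_of_pivots`). Suppose that every window of `κ` slots contains an honest
proposal, a pivot. By strong induction on the slot, each justified block of a view on which a fork
choice is evaluated is a prefix of the block that RLMD-GHOST selects, so that discarding the
blocks that conflict with it changes nothing (`hfc_eq_rlmdGhost`). Indeed fewer than half of the
validators are corrupted, so that a supermajority link contains an honest vote; its target is
either a block justified earlier or an available chain. The latter is fast confirmed, or `κ`-deep
and hence a prefix of a pivot; in both cases it has won every later fork choice. The executions of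
the two protocols are therefore equal round by round, and the remaining properties follow by
propagation from the honest proposals, the fast confirmations and the pivots.

*Pivots* (`overwhelming_of_pivots`). The set of validators active at the start of a slot does not
depend on the proposer of that slot (`active_congr`), and is not empty in compliant executions. So
the proposer belongs to it with conditional probability at least `1/n`, and a window of `⌊κ/n⌋`
slots without an active proposer has probability at most `(1 - 1/n) ^ ⌊κ/n⌋`. The adversary may
still corrupt an active proposer before the voting round of its slot, but it cannot do so `n`
times; hence `n` such windows contain an honest proposal (`pivots_of_active_proposers`). A union
bound over the polynomially many windows finishes the proof.
-/

namespace SSF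

open scoped Classical

universe u

variable {n : ℕ} {Body : Type u}

/-! ### The prefix order on blocks -/

namespace Block

variable {A B C : Block n Body} {prop : ℕ → Fin n}

theorem Prefix.refl (B : Block n Body) : B.Prefix B := by
  cases B <;> simp [Prefix, chain]

theorem prefix_mk_iff {p : Block n Body} {b : Body} {s : ℕ} {a : Fin n} :
    A.Prefix (mk p b s a) ↔ A = mk p b s a ∨ A.Prefix p := by
  simp [Prefix, chain]

theorem prefix_genesis_iff : A.Prefix genesis ↔ A = genesis := by
  simp [Prefix, chain]

theorem genesis_prefix (B : Block n Body) : genesis.Prefix B := by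
  induction B with
  | genesis => exact Prefix.refl _
  | mk p b s a ih => exact prefix_mk_iff.2 (Or.inr ih)

theorem Prefix.trans (h₁ : A.Prefix B) (h₂ : B.Prefix C) : A.Prefix C := by
  induction C with
  | genesis => rw [prefix_genesis_iff] at h₂; rwa [h₂] at h₁
  | mk p b s a ih =>
    rcases prefix_mk_iff.1 h₂ with rfl | h
    · exact h₁
    · exact prefix_mk_iff.2 (Or.inr (ih h))

theorem Prefix.height_lt_or_eq (h : A.Prefix B) : A.height < B.height ∨ A = B := by
  induction B with
  | genesis => exact Or.inr (prefix_genesis_iff.1 h)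
  | mk p b s a ih =>
    rcases prefix_mk_iff.1 h with rfl | h
    · exact Or.inr rfl
    · refine Or.inl ?_
      rcases ih h with h | rfl
      · exact Nat.lt_succ_of_lt h
      · exact Nat.lt_succ_self _

theorem Prefix.eq_of_height_le (h : A.Prefix B) (hB : B.height ≤ A.height) : A = B :=
  h.height_lt_or_eq.resolve_left (by omega)

theorem prefix_total (h₁ : A.Prefix C) (h₂ : B.Prefix C) : A.Prefix B ∨ B.Prefix A := by
  induction C with
  | genesis =>
    rw [prefix_genesis_iff] at h₁ h₂
    subst h₁ h₂
    exact Or.inl (Prefix.refl _)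
  | mk p b s a ih =>
    rcases prefix_mk_iff.1 h₁ with rfl | h₁'
    · exact Or.inr h₂
    · rcases prefix_mk_iff.1 h₂ with rfl | h₂'
      · exact Or.inl h₁
      · exact ih h₁' h₂'

theorem prefix_of_height_le (h₁ : A.Prefix C) (h₂ : B.Prefix C) (h : A.height ≤ B.height) :
    A.Prefix B := by
  rcases prefix_total h₁ h₂ with h' | h'
  · exact h'
  · rw [h'.eq_of_height_le h]; exact Prefix.refl _

theorem IsChildOf.prefix {c b : Block n Body} (h : c.IsChildOf b) : b.Prefix c := by
  obtain ⟨body, s, a, rfl⟩ := h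
  exact prefix_mk_iff.2 (Or.inr (Prefix.refl _))

theorem IsChildOf.height_eq {c b : Block n Body} (h : c.IsChildOf b) :
    c.height = b.height + 1 := by
  obtain ⟨body, s, a, rfl⟩ := h
  rfl

theorem exists_child_prefix (h : A.Prefix B) (hne : A ≠ B) :
    ∃ c : Block n Body, c.IsChildOf A ∧ c.Prefix B := by
  induction B with
  | genesis => exact absurd (prefix_genesis_iff.1 h) hne
  | mk p b s a ih =>
    have hp := (prefix_mk_iff.1 h).resolve_left hne
    by_cases hAp : A = p
    · subst hAp
      exact ⟨_, ⟨b, s, a, rfl⟩, Prefix.refl _⟩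
    · obtain ⟨c, hc, hcp⟩ := ih hp hAp
      exact ⟨c, hc, prefix_mk_iff.2 (Or.inr hcp)⟩

theorem Valid.of_prefix (hB : B.Valid prop) (h : A.Prefix B) : A.Valid prop := by
  induction B with
  | genesis => rw [prefix_genesis_iff.1 h]; trivial
  | mk p b s a ih =>
    rcases prefix_mk_iff.1 h with rfl | h
    · exact hB
    · exact ih hB.1 h

theorem Valid.slot_le (hB : B.Valid prop) (h : A.Prefix B) : A.slot ≤ B.slot := by
  induction B with
  | genesis => rw [prefix_genesis_iff.1 h]
  | mk p b s a ih =>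
    rcases prefix_mk_iff.1 h with rfl | h
    · exact le_rfl
    · rcases hB.2.2 with rfl | hs
      · rw [prefix_genesis_iff.1 h]; exact Nat.zero_le _
      · exact (ih hB.1 h).trans hs.le

theorem highest_prefix (P : Block n Body → Prop) (B : Block n Body) :
    (B.highest P).Prefix B := by
  induction B with
  | genesis => exact Prefix.refl _
  | mk p b s a ih =>
    unfold highest
    split_ifs
    · exact Prefix.refl _
    · exact prefix_mk_iff.2 (Or.inr ih)

theorem highest_spec (P : Block n Body → Prop) (B : Block n Body) :
    B.highest P = genesis ∨ P (B.highest P) := by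
  induction B with
  | genesis => exact Or.inl rfl
  | mk p b s a ih =>
    unfold highest
    split_ifs with h
    · exact Or.inr h
    · exact ih

theorem prefix_highest {P : Block n Body → Prop} (h : A.Prefix B) (hA : P A) :
    A.Prefix (B.highest P) := by
  induction B with
  | genesis => exact h
  | mk p b s a ih =>
    unfold highest
    split_ifs with hP
    · exact h
    · rcases prefix_mk_iff.1 h with rfl | h
      · exact absurd hA hP
      · exact ih h

end Block

open Block

/-! ### GHOST -/

theorem mem_tree {V : View n Body} {A : Block n Body} :
    A ∈ tree V ↔ ∃ B, Item.block B ∈ V ∧ A.Prefix B := by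
  simp only [tree, Finset.mem_biUnion]
  constructor
  · rintro ⟨x, hx, hA⟩
    cases x with
    | block B => exact ⟨B, hx, by simpa [Block.Prefix] using hA⟩
    | headVote B t v => simp at hA
    | ffgVote C D v => simp at hA
  · rintro ⟨B, hB, hA⟩
    exact ⟨_, hB, by simpa [Block.Prefix] using hA⟩

theorem mem_tree_of_prefix {V : View n Body} {A B : Block n Body} (hB : B ∈ tree V)
    (h : A.Prefix B) : A ∈ tree V := by
  obtain ⟨C, hC, hBC⟩ := mem_tree.1 hB
  exact mem_tree.2 ⟨C, hC, h.trans hBC⟩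

theorem mem_children {V : View n Body} {b c : Block n Body} :
    c ∈ children V b ↔ c ∈ tree V ∧ c.IsChildOf b := by
  simp [children]

theorem ghostStep_mem (tb : TieBreak (Block n Body)) {V : View n Body} {b : Block n Body}
    (h : (children V b).Nonempty) : ghostStep tb V b ∈ heaviestChildren V b := by
  unfold ghostStep
  rw [if_pos h]
  apply tb.pick_mem
  obtain ⟨c, hc, hmax⟩ := Finset.exists_max_image _ (weight V) h
  exact ⟨c, Finset.mem_filter.2 ⟨hc, hmax⟩⟩

theorem ghostStep_mem_children (tb : TieBreak (Block n Body)) {V : View n Body}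
    {b : Block n Body} (h : (children V b).Nonempty) : ghostStep tb V b ∈ children V b :=
  (Finset.mem_filter.1 (ghostStep_mem tb h)).1

theorem ghostStep_of_leaf (tb : TieBreak (Block n Body)) {V : View n Body}
    {b : Block n Body} (h : ¬ (children V b).Nonempty) : ghostStep tb V b = b := if_neg h

theorem not_nonempty_of_ghostStep_eq {tb : TieBreak (Block n Body)} {V : View n Body}
    {b : Block n Body} (h : ghostStep tb V b = b) : ¬ (children V b).Nonempty := by
  intro hne
  have := (mem_children.1 (ghostStep_mem_children tb hne)).2.height_eq
  rw [h] at this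
  omega

theorem prefix_ghostStep (tb : TieBreak (Block n Body)) (V : View n Body) (b : Block n Body) :
    b.Prefix (ghostStep tb V b) := by
  by_cases h : (children V b).Nonempty
  · exact (mem_children.1 (ghostStep_mem_children tb h)).2.prefix
  · rw [ghostStep_of_leaf tb h]; exact Prefix.refl _

theorem iterate_ghostStep_height (tb : TieBreak (Block n Body)) (V : View n Body) (k : ℕ) :
    ghostStep tb V ((ghostStep tb V)^[k] .genesis) = (ghostStep tb V)^[k] .genesis ∨
      ((ghostStep tb V)^[k] .genesis).height = k := by
  induction k with
  | zero => exact Or.inr rfl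
  | succ k ih =>
    rw [Function.iterate_succ_apply']
    rcases ih with h | h
    · left; rw [h, h]
    · by_cases hc : (children V ((ghostStep tb V)^[k] .genesis)).Nonempty
      · right
        rw [(mem_children.1 (ghostStep_mem_children tb hc)).2.height_eq, h]
      · left
        rw [ghostStep_of_leaf tb hc, ghostStep_of_leaf tb hc]

theorem ghostStep_ghost (tb : TieBreak (Block n Body)) (V : View n Body) :
    ghostStep tb V (ghost tb V) = ghost tb V := by
  rcases iterate_ghostStep_height tb V ((tree V).sup Block.height) with h | h
  · exact h
  · apply ghostStep_of_leaf
    rintro ⟨c, hc⟩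
    obtain ⟨hct, hcc⟩ := mem_children.1 hc
    have h₁ := Finset.le_sup (f := Block.height) hct
    have h₂ := hcc.height_eq
    unfold ghost at h₂
    omega

/-- The number of steps in the definition of GHOST is immaterial: every fixed point that the
iteration reaches is its result. -/
theorem ghost_eq_of_iterate {tb : TieBreak (Block n Body)} {V : View n Body} {b : Block n Body}
    (k : ℕ) (hb : ghostStep tb V b = b) (hk : (ghostStep tb V)^[k] .genesis = b) :
    ghost tb V = b := by
  have key : ∀ l m, l ≤ m → ghostStep tb V ((ghostStep tb V)^[l] .genesis) =
      (ghostStep tb V)^[l] .genesis →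
      (ghostStep tb V)^[m] .genesis = (ghostStep tb V)^[l] .genesis := by
    intro l m hlm hl
    obtain ⟨d, rfl⟩ := Nat.exists_eq_add_of_le hlm
    rw [Nat.add_comm, Function.iterate_add_apply]
    exact Function.iterate_fixed hl d
  rcases le_total k ((tree V).sup Block.height) with h | h
  · have := key _ _ h (by rw [hk, hb])
    rw [hk] at this
    exact this
  · have := key _ _ h (ghostStep_ghost tb V)
    rw [hk] at this
    exact this.symm

theorem iterate_ghostStep_mem_tree (tb : TieBreak (Block n Body)) (V : View n Body) (k : ℕ) :
    (ghostStep tb V)^[k] .genesis = .genesis ∨ (ghostStep tb V)^[k] .genesis ∈ tree V := by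
  induction k with
  | zero => exact Or.inl rfl
  | succ k ih =>
    rw [Function.iterate_succ_apply']
    by_cases hc : (children V ((ghostStep tb V)^[k] .genesis)).Nonempty
    · exact Or.inr (mem_children.1 (ghostStep_mem_children tb hc)).1
    · rw [ghostStep_of_leaf tb hc]; exact ih

theorem iterate_ghostStep_prefix (tb : TieBreak (Block n Body)) (V : View n Body) (k d : ℕ) :
    ((ghostStep tb V)^[k] .genesis).Prefix ((ghostStep tb V)^[d + k] .genesis) := by
  induction d with
  | zero => rw [Nat.zero_add]; exact Prefix.refl _
  | succ d ih =>
    rw [Nat.succ_add, Function.iterate_succ_apply']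
    exact ih.trans (prefix_ghostStep tb V _)

theorem iterate_ghostStep_prefix_ghost (tb : TieBreak (Block n Body)) (V : View n Body) (k : ℕ) :
    ((ghostStep tb V)^[k] .genesis).Prefix (ghost tb V) := by
  have h : (ghostStep tb V)^[k + (tree V).sup Block.height] .genesis = ghost tb V := by
    rw [Function.iterate_add_apply]
    exact Function.iterate_fixed (ghostStep_ghost tb V) k
  rw [← h, Nat.add_comm]
  exact iterate_ghostStep_prefix tb V k _

/-- GHOST passes through a block of the tree if each of its ancestors (and the block itself) is
strictly heavier than its siblings. -/
theorem prefix_ghost_of_dominant {tb : TieBreak (Block n Body)} {V : View n Body}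
    {X : Block n Body} (hX : X ∈ tree V)
    (hdom : ∀ b c d, c.Prefix X → c ∈ children V b → d ∈ children V b → d ≠ c →
      weight V d < weight V c) : X.Prefix (ghost tb V) := by
  have key : ∀ k, X.Prefix ((ghostStep tb V)^[k] .genesis) ∨
      (((ghostStep tb V)^[k] .genesis).Prefix X ∧
        ((ghostStep tb V)^[k] .genesis).height = k) := by
    intro k
    induction k with
    | zero => exact Or.inr ⟨genesis_prefix _, rfl⟩
    | succ k ih =>
      rw [Function.iterate_succ_apply']
      rcases ih with h | ⟨h, hk⟩
      · exact Or.inl (h.trans (prefix_ghostStep tb V _))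
      · generalize (ghostStep tb V)^[k] .genesis = b at h hk
        by_cases hbX : b = X
        · left; rw [← hbX]; exact prefix_ghostStep tb V _
        · right
          obtain ⟨c, hc, hcX⟩ := exists_child_prefix h hbX
          have hcm : c ∈ children V b := mem_children.2 ⟨mem_tree_of_prefix hX hcX, hc⟩
          have hm := Finset.mem_filter.1 (ghostStep_mem tb ⟨c, hcm⟩)
          have : ghostStep tb V b = c := by
            by_contra hne
            exact absurd (hm.2 c hcm) (not_le.2 (hdom b c _ hcX hcm hm.1 hne))
          rw [this]
          exact ⟨hcX, by rw [hc.height_eq, hk]⟩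
  rcases key ((tree V).sup Block.height) with h | ⟨h, hk⟩
  · exact h
  · have := Finset.le_sup (f := Block.height) hX
    have := h.eq_of_height_le (by omega)
    rw [← this]
    exact Prefix.refl _

theorem ghost_mem_tree (tb : TieBreak (Block n Body)) (V : View n Body) :
    ghost tb V = .genesis ∨ ghost tb V ∈ tree V :=
  iterate_ghostStep_mem_tree tb V _

/-- Discarding blocks that conflict with `J` does not change the result of GHOST if this result
extends `J`. -/
theorem ghost_eq_of_compatible {tb : TieBreak (Block n Body)} {V W : View n Body}
    {J : Block n Body} (hJ : J.Prefix (ghost tb V)) (hsub : tree W ⊆ tree V)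
    (hcompat : ∀ A ∈ tree W, J.Prefix A ∨ A.Prefix J)
    (hkeep : ∀ A ∈ tree V, J.Prefix A → A ∈ tree W)
    (hweight : ∀ A, weight W A = weight V A) : ghost tb W = ghost tb V := by
  -- on the way to `J` only the child towards `J` survives; from `J` on, nothing has changed
  have hstep : ∀ k, ghostStep tb W ((ghostStep tb V)^[k] .genesis) =
      ghostStep tb V ((ghostStep tb V)^[k] .genesis) := by
    intro k
    have hnext := iterate_ghostStep_prefix_ghost tb V (k + 1)
    rw [Function.iterate_succ_apply'] at hnext
    have hcur := iterate_ghostStep_prefix_ghost tb V k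
    have hfix : ghostStep tb V ((ghostStep tb V)^[k] .genesis) = (ghostStep tb V)^[k] .genesis →
        ghost tb V = (ghostStep tb V)^[k] .genesis := fun h => ghost_eq_of_iterate k h rfl
    generalize (ghostStep tb V)^[k] .genesis = b at hnext hcur hfix
    by_cases hJb : J.Prefix b
    · have hch : children W b = children V b := by
        ext c
        simp only [mem_children]
        exact ⟨fun h => ⟨hsub h.1, h.2⟩, fun h => ⟨hkeep c h.1 (hJb.trans h.2.prefix), h.2⟩⟩
      unfold ghostStep heaviestChildren
      simp only [hch, hweight]
    · have hbJ : b.Prefix J := (prefix_total hcur hJ).resolve_right hJb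
      have hlt : b.height < J.height := by
        rcases hbJ.height_lt_or_eq with h | h
        · exact h
        · exact absurd (h ▸ Prefix.refl _) hJb
      have hne : (children V b).Nonempty := by
        by_contra hleaf
        rw [hfix (ghostStep_of_leaf tb hleaf)] at hJ
        exact hJb hJ
      have hc := mem_children.1 (ghostStep_mem_children tb hne)
      have hcJ : (ghostStep tb V b).Prefix J :=
        prefix_of_height_le hnext hJ (by rw [hc.2.height_eq]; omega)
      have hJW : J ∈ tree W := by
        rcases ghost_mem_tree tb V with h | h
        · rw [h, prefix_genesis_iff] at hJ
          rw [hJ] at hlt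
          exact absurd hlt (Nat.not_lt_zero _)
        · exact mem_tree_of_prefix (hkeep _ h hJ) hJ
      have hneW : (children W b).Nonempty :=
        ⟨_, mem_children.2 ⟨mem_tree_of_prefix hJW hcJ, hc.2⟩⟩
      have hd := mem_children.1 (ghostStep_mem_children tb hneW)
      have hdJ : (ghostStep tb W b).Prefix J := by
        rcases hcompat _ hd.1 with h | h
        · have := h.eq_of_height_le (by rw [hd.2.height_eq]; omega)
          rw [← this]; exact Prefix.refl _
        · exact h
      exact (prefix_of_height_le hdJ hcJ (by rw [hc.2.height_eq, hd.2.height_eq])).eq_of_height_le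
        (by rw [hc.2.height_eq, hd.2.height_eq])
  have hiter : ∀ k, (ghostStep tb W)^[k] .genesis = (ghostStep tb V)^[k] .genesis := by
    intro k
    induction k with
    | zero => rfl
    | succ k ih => rw [Function.iterate_succ_apply', Function.iterate_succ_apply', ih, hstep]
  refine ghost_eq_of_iterate ((tree V).sup Block.height) ?_ (hiter _)
  have := hstep ((tree V).sup Block.height)
  exact this.trans (ghostStep_ghost tb V)

/-- If a new block is appended to the result of GHOST, then it becomes the result of GHOST. -/
theorem ghost_insert_child {tb : TieBreak (Block n Body)} {V W : View n Body} {B : Block n Body}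
    (hB : B.IsChildOf (ghost tb V)) (htree : ∀ A, A ∈ tree W ↔ A = B ∨ A ∈ tree V)
    (hfresh : ∀ A ∈ tree V, ¬ B.Prefix A) (hweight : ∀ A, weight W A = weight V A) :
    ghost tb W = B := by
  have hstep : ∀ b, b ≠ ghost tb V → ghostStep tb W b = ghostStep tb V b := by
    intro b hb
    have hch : children W b = children V b := by
      ext c
      simp only [mem_children, htree]
      constructor
      · rintro ⟨rfl | h, hc⟩
        · obtain ⟨_, _, _, h₁⟩ := hB
          obtain ⟨_, _, _, h₂⟩ := hc
          rw [h₁] at h₂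
          injection h₂ with h₃
          exact absurd h₃.symm hb
        · exact ⟨h, hc⟩
      · exact fun h => ⟨Or.inr h.1, h.2⟩
    unfold ghostStep heaviestChildren
    simp only [hch, hweight]
  have hex : ∃ k, (ghostStep tb V)^[k] .genesis = ghost tb V := ⟨_, rfl⟩
  have hmin := Nat.find_spec hex
  -- the iteration is unchanged up to its first visit of the old result, then it moves to `B`
  have hiter : ∀ k ≤ Nat.find hex,
      (ghostStep tb W)^[k] .genesis = (ghostStep tb V)^[k] .genesis := by
    intro k hk
    induction k with
    | zero => rfl
    | succ k ih =>
      rw [Function.iterate_succ_apply', Function.iterate_succ_apply', ih (by omega),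
        hstep _ (Nat.find_min hex (by omega))]
  have hleaf := not_nonempty_of_ghostStep_eq (ghostStep_ghost tb V)
  have hne : (children W (ghost tb V)).Nonempty :=
    ⟨B, mem_children.2 ⟨(htree B).2 (Or.inl rfl), hB⟩⟩
  have hlast : ghostStep tb W (ghost tb V) = B := by
    have h := mem_children.1 (ghostStep_mem_children tb hne)
    rcases (htree _).1 h.1 with h' | h'
    · exact h'
    · exact absurd ⟨_, mem_children.2 ⟨h', h.2⟩⟩ hleaf
  refine ghost_eq_of_iterate (Nat.find hex + 1) ?_ ?_
  · apply ghostStep_of_leaf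
    rintro ⟨c, hc⟩
    obtain ⟨hct, hcB⟩ := mem_children.1 hc
    rcases (htree c).1 hct with rfl | h
    · have := hcB.height_eq
      omega
    · exact hfresh c h hcB.prefix
  · rw [Function.iterate_succ_apply', hiter _ le_rfl, hmin, hlast]

/-! ### The fork choices -/

/-- The head votes that RLMD-GHOST takes into account, with everything in the view that is not a
head vote. -/
noncomputable abbrev rlmdView (η t : ℕ) (V : View n Body) : View n Body :=
  filLmd (filExp η t (filEq V))

theorem block_mem_rlmdView {η t : ℕ} {V : View n Body} {B : Block n Body} :
    Item.block B ∈ rlmdView η t V ↔ Item.block B ∈ V := by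
  simp [filLmd, filExp, filEq, filterHeadVotes]

theorem headVote_mem_filEq {V : View n Body} {B : Block n Body} {s : ℕ} {v : Fin n} :
    Item.headVote B s v ∈ filEq V ↔ Item.headVote B s v ∈ V ∧ ¬ Equivocates {x | x ∈ V} v := by
  simp [filEq, filterHeadVotes]

theorem headVote_mem_filExp {η t : ℕ} {V : View n Body} {B : Block n Body} {s : ℕ} {v : Fin n} :
    Item.headVote B s v ∈ filExp η t V ↔ Item.headVote B s v ∈ V ∧ t ≤ s + η ∧ s < t := by
  simp [filExp, filterHeadVotes]

theorem headVote_mem_filLmd {V : View n Body} {B : Block n Body} {s : ℕ} {v : Fin n} :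
    Item.headVote B s v ∈ filLmd V ↔ Item.headVote B s v ∈ V ∧
      ∀ (C : Block n Body) (s' : ℕ), Item.headVote C s' v ∈ V → s' ≤ s := by
  simp [filLmd, filterHeadVotes]

theorem headVote_mem_rlmdView {η t : ℕ} {V : View n Body} {B : Block n Body} {s : ℕ} {v : Fin n} :
    Item.headVote B s v ∈ rlmdView η t V ↔
      Item.headVote B s v ∈ V ∧ ¬ Equivocates {x | x ∈ V} v ∧ t ≤ s + η ∧ s < t ∧
      ∀ (C : Block n Body) (s' : ℕ), Item.headVote C s' v ∈ V → t ≤ s' + η → s' < t → s' ≤ s := by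
  simp only [rlmdView, headVote_mem_filLmd, headVote_mem_filExp, headVote_mem_filEq]
  constructor
  · rintro ⟨⟨⟨h₁, h₂⟩, h₃, h₄⟩, h₅⟩
    exact ⟨h₁, h₂, h₃, h₄, fun C s' hC h h' => h₅ C s' ⟨⟨hC, h₂⟩, h, h'⟩⟩
  · rintro ⟨h₁, h₂, h₃, h₄, h₅⟩
    exact ⟨⟨⟨h₁, h₂⟩, h₃, h₄⟩, fun C s' ⟨⟨hC, _⟩, h, h'⟩ => h₅ C s' hC h h'⟩

theorem mem_tree_rlmdView {η t : ℕ} {V : View n Body} {A : Block n Body} :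
    A ∈ tree (rlmdView η t V) ↔ A ∈ tree V := by
  simp only [mem_tree, block_mem_rlmdView]

/-- Weights depend only on the head votes of a view. -/
theorem weight_rlmdView_congr {η t : ℕ} {V W : View n Body}
    (h : ∀ B s v, Item.headVote B s v ∈ W ↔ Item.headVote B s v ∈ V) (A : Block n Body) :
    weight (rlmdView η t W) A = weight (rlmdView η t V) A := by
  have he : ∀ v, Equivocates {x | x ∈ W} v ↔ Equivocates {x | x ∈ V} v := by
    intro v; simp [Equivocates, h]
  unfold weight
  simp only [headVote_mem_rlmdView, h, he]

theorem rlmdGhost_mem_tree (tb : TieBreak (Block n Body)) (η : ℕ) (V : View n Body) (t : ℕ) :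
    rlmdGhost tb η V t = .genesis ∨ rlmdGhost tb η V t ∈ tree V := by
  have := ghost_mem_tree tb (rlmdView η t V)
  rwa [mem_tree_rlmdView] at this

theorem block_mem_filFFG {tc : TieBreak (Checkpoint n Body)} {V : View n Body} {B : Block n Body} :
    Item.block B ∈ filFFG tc V ↔ Item.block B ∈ V ∧
      ((latestJustified tc V).block.Prefix B ∨ B.Prefix (latestJustified tc V).block) := by
  simp [filFFG]

theorem headVote_mem_filFFG {tc : TieBreak (Checkpoint n Body)} {V : View n Body}
    {B : Block n Body} {s : ℕ} {v : Fin n} :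
    Item.headVote B s v ∈ filFFG tc V ↔ Item.headVote B s v ∈ V := by
  simp [filFFG]

theorem hfc_mem_tree (tb : TieBreak (Block n Body)) (tc : TieBreak (Checkpoint n Body)) (η : ℕ)
    (V : View n Body) (t : ℕ) : hfc tb tc η V t = .genesis ∨ hfc tb tc η V t ∈ tree V := by
  rcases rlmdGhost_mem_tree tb η (filFFG tc V) t with h | h
  · exact Or.inl h
  · obtain ⟨B, hB, h'⟩ := mem_tree.1 h
    exact Or.inr (mem_tree.2 ⟨B, (block_mem_filFFG.1 hB).1, h'⟩)

/-- The justification-respecting fork choice agrees with RLMD-GHOST as soon as RLMD-GHOST respects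
the latest justified block. -/
theorem hfc_eq_rlmdGhost {tb : TieBreak (Block n Body)} {tc : TieBreak (Checkpoint n Body)}
    {η : ℕ} {V : View n Body} {t : ℕ}
    (h : (latestJustified tc V).block.Prefix (rlmdGhost tb η V t)) :
    hfc tb tc η V t = rlmdGhost tb η V t := by
  refine ghost_eq_of_compatible h ?_ ?_ ?_ (weight_rlmdView_congr fun B s v => headVote_mem_filFFG)
  · intro A hA
    obtain ⟨B, hB, hAB⟩ := mem_tree.1 (mem_tree_rlmdView.1 hA)
    exact mem_tree_rlmdView.2 (mem_tree.2 ⟨B, (block_mem_filFFG.1 hB).1, hAB⟩)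
  · intro A hA
    obtain ⟨B, hB, hAB⟩ := mem_tree.1 (mem_tree_rlmdView.1 hA)
    rcases (block_mem_filFFG.1 hB).2 with hJ | hJ
    · exact prefix_total hJ hAB
    · exact Or.inr (hAB.trans hJ)
  · intro A hA hJ
    obtain ⟨B, hB, hAB⟩ := mem_tree.1 (mem_tree_rlmdView.1 hA)
    exact mem_tree_rlmdView.2
      (mem_tree.2 ⟨B, block_mem_filFFG.2 ⟨hB, Or.inl (hJ.trans hAB)⟩, hAB⟩)

/-- If the validators in `S` support `X`, all other support comes from the smaller set `O`, then
RLMD-GHOST selects a descendant of `X`. -/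
theorem prefix_rlmdGhost_of_majority {tb : TieBreak (Block n Body)} {η t : ℕ} {V : View n Body}
    {X : Block n Body} (S O : Finset (Fin n)) (hcard : O.card < S.card)
    (hS : ∀ v ∈ S, ∃ B s, X.Prefix B ∧ Item.headVote B s v ∈ rlmdView η t V)
    (hO : ∀ v B s, Item.headVote B s v ∈ rlmdView η t V → ¬ X.Prefix B → v ∈ O)
    (hX : X ∈ tree V) : X.Prefix (rlmdGhost tb η V t) := by
  refine prefix_ghost_of_dominant (mem_tree_rlmdView.2 hX) ?_
  intro b c d hcX hc hd hne
  have hc' := (mem_children.1 hc).2.height_eq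
  have hd' := (mem_children.1 hd).2.height_eq
  refine lt_of_le_of_lt (Finset.card_le_card ?_) (hcard.trans_le (Finset.card_le_card ?_))
  · intro v hv
    obtain ⟨B, s, hdB, hB⟩ := (Finset.mem_filter.1 hv).2
    refine hO v B s hB fun hXB => hne ?_
    exact (prefix_of_height_le hdB (hcX.trans hXB) (by omega)).eq_of_height_le (by omega)
  · intro v hv
    obtain ⟨B, s, hXB, hB⟩ := hS v hv
    exact Finset.mem_filter.2 ⟨Finset.mem_univ _, B, s, hcX.trans hXB, hB⟩

/-! ### Justification -/

theorem justified_mem {V : View n Body} {C : Checkpoint n Body} (h : Justified V C) :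
    C = genesisCheckpoint ∨ ∃ C', Justified V C' ∧ SupermajorityLink V C' C := by
  cases h with
  | genesis => exact Or.inl rfl
  | link C' D h₁ h₂ => exact Or.inr ⟨C', h₁, h₂⟩

theorem latestJustified_justified (tc : TieBreak (Checkpoint n Body)) (V : View n Body) :
    Justified V (latestJustified tc V) := by
  have hne : (justifiedCheckpoints V).Nonempty :=
    ⟨genesisCheckpoint, Finset.mem_filter.2 ⟨Finset.mem_insert_self _ _, Justified.genesis⟩⟩
  obtain ⟨c, hc, hmax⟩ := Finset.exists_max_image _ Checkpoint.slot hne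
  have := tc.pick_mem ((justifiedCheckpoints V).filter
    (fun C => ∀ D ∈ justifiedCheckpoints V, D.slot ≤ C.slot))
    ⟨c, Finset.mem_filter.2 ⟨hc, hmax⟩⟩
  exact (Finset.mem_filter.1 (Finset.mem_filter.1 this).1).2

/-- A block that extends the result of RLMD-GHOST and has no descendants in the view becomes
the result of RLMD-GHOST when it is added to the view. -/
theorem rlmdGhost_insert_child {tb : TieBreak (Block n Body)} {η t : ℕ} {V : View n Body}
    {B : Block n Body} (hB : B.IsChildOf (rlmdGhost tb η V t))
    (hgen : Item.block .genesis ∈ V) (hfresh : ∀ A ∈ tree V, ¬ B.Prefix A) :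
    rlmdGhost tb η (insert (Item.block B) V) t = B := by
  refine ghost_insert_child hB ?_ ?_ (weight_rlmdView_congr fun B s v => by simp)
  · intro A
    simp only [mem_tree_rlmdView]
    simp only [mem_tree, Finset.mem_insert]
    constructor
    · rintro ⟨C, hC | hC, hA⟩
      · injection hC with hC
        subst hC
        obtain ⟨b, s, a, h⟩ := hB
        rw [h] at hA
        rcases prefix_mk_iff.1 hA with hA | hA
        · left; rw [hA, h]
        · right
          rcases rlmdGhost_mem_tree tb η V t with h' | h'
          · rw [h'] at hA; exact ⟨_, hgen, hA⟩
          · exact mem_tree.1 (mem_tree_of_prefix h' hA)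
      · exact Or.inr ⟨C, hC, hA⟩
    · rintro (rfl | ⟨C, hC, hA⟩)
      · exact ⟨A, Or.inl rfl, Prefix.refl _⟩
      · exact ⟨C, Or.inr hC, hA⟩
  · intro A hA
    exact hfresh A (mem_tree_rlmdView.1 hA)

/-! ### Rounds and slots -/

theorem round_div {Δ t d : ℕ} (h : d < 4 * Δ) : (4 * Δ * t + d) / (4 * Δ) = t := by
  rw [Nat.mul_add_div (by omega), Nat.div_eq_of_lt h, Nat.add_zero]

theorem slot_mul_succ (Δ t : ℕ) : 4 * Δ * (t + 1) = 4 * Δ * t + 4 * Δ := Nat.mul_succ _ _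

/-- A slot is determined by a round that belongs to it. -/
theorem slot_unique {Δ s t r : ℕ} (h₁ : 4 * Δ * s ≤ r) (h₂ : r < 4 * Δ * s + 4 * Δ)
    (h₃ : 4 * Δ * t ≤ r) (h₄ : r < 4 * Δ * t + 4 * Δ) : s = t := by
  obtain ⟨d, rfl⟩ := Nat.exists_eq_add_of_le h₁
  obtain ⟨e, he⟩ := Nat.exists_eq_add_of_le h₃
  rw [← round_div (Δ := Δ) (t := s) (d := d) (by omega), he, round_div (by omega)]

theorem slot_le_of_round_le {Δ s t r : ℕ} (h₁ : 4 * Δ * s ≤ r) (h₂ : r < 4 * Δ * t + 4 * Δ) :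
    s ≤ t := by
  by_contra h
  have := Nat.mul_le_mul_left (4 * Δ) (show t + 1 ≤ s by omega)
  rw [slot_mul_succ] at this
  omega

theorem round_le_of_slot_lt {s t : ℕ} (Δ : ℕ) (h : s < t) : 4 * Δ * s + 4 * Δ ≤ 4 * Δ * t := by
  have := Nat.mul_le_mul_left (4 * Δ) (show s + 1 ≤ t by omega)
  rwa [slot_mul_succ] at this

/-! ### One round of an execution -/

/-- The configuration before round `r` of the execution. -/
noncomputable def before (P : Protocol n Body) (σ : Adversary n Body) (prop : ℕ → Fin n) (r : ℕ) :
    Config n Body :=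
  (history P σ prop r).headD initialConfig

/-- The state of validator `i` in round `r` after it has processed the messages that it receives,
and before it acts. -/
noncomputable def received (P : Protocol n Body) (σ : Adversary n Body) (prop : ℕ → Fin n) (r : ℕ)
    (i : Fin n) : LocalState n Body :=
  if i ∈ (run P σ prop r).awake then
    receive P.Δ prop r (i ∈ (before P σ prop r).active) ((run P σ prop r).delivered i)
      ((before P σ prop r).state i)
  else (before P σ prop r).state i

section Run

variable {P : Protocol n Body} {σ : Adversary n Body} {prop : ℕ → Fin n} {r : ℕ} {i : Fin n}

theorem before_zero : before P σ prop 0 = initialConfig := rfl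

theorem before_succ : before P σ prop (r + 1) = run P σ prop r := rfl

theorem corrupted_before : (before P σ prop r).corrupted ⊆ (run P σ prop r).corrupted :=
  Finset.subset_union_left

theorem corrupted_mono {q : ℕ} (h : q ≤ r) :
    (run P σ prop q).corrupted ⊆ (run P σ prop r).corrupted := by
  induction h with
  | refl => exact Finset.Subset.refl _
  | @step m _ ih => exact ih.trans (corrupted_before (r := m + 1))

theorem not_corrupted_of_awake (h : i ∈ (run P σ prop r).awake) :
    i ∉ (run P σ prop r).corrupted :=
  (Finset.mem_sdiff.1 h).2

theorem awake_of_active (h : i ∈ (run P σ prop r).active) : i ∈ (run P σ prop r).awake :=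
  (Finset.mem_filter.1 h).1

theorem not_corrupted_of_active (h : i ∈ (run P σ prop r).active) :
    i ∉ (run P σ prop r).corrupted :=
  not_corrupted_of_awake (awake_of_active h)

theorem active_before (h : i ∈ (run P σ prop r).active)
    (hr : ∀ t, r ≠ 4 * P.Δ * t + 3 * P.Δ) : i ∈ (before P σ prop r).active :=
  (Finset.mem_filter.1 h).2.resolve_right (hr _)

theorem run_active : (run P σ prop r).state i = ((if i ∈ (run P σ prop r).active then
    act P prop r (σ.body (history P σ prop r) i) i (received P σ prop r i)
    else (received P σ prop r i, ∅)) : LocalState n Body × Finset (Message n Body)).1 ∧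
    (run P σ prop r).sent i = ((if i ∈ (run P σ prop r).active then
    act P prop r (σ.body (history P σ prop r) i) i (received P σ prop r i)
    else (received P σ prop r i, ∅)) : LocalState n Body × Finset (Message n Body)).2 :=
  ⟨rfl, rfl⟩

theorem delivered_eq_empty (h : i ∉ (run P σ prop r).awake) :
    (run P σ prop r).delivered i = ∅ := if_neg h

/-- A validator that is active was active since the latest merge round. -/
theorem active_of_le {q : ℕ} (hqr : q ≤ r) (h : i ∈ (run P σ prop r).active)
    (hr : ∀ x, q < x → x ≤ r → ∀ t, x ≠ 4 * P.Δ * t + 3 * P.Δ) :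
    i ∈ (run P σ prop q).active := by
  induction r with
  | zero => rwa [Nat.le_zero.1 hqr]
  | succ r ih =>
    rcases hqr.eq_or_lt with rfl | hlt
    · exact h
    · refine ih (by omega) ?_ fun x hx hx' => hr x hx (by omega)
      exact active_before h (hr _ (by omega) le_rfl)

theorem received_chain : (received P σ prop r i).chain = ((before P σ prop r).state i).chain := by
  unfold received; split_ifs <;> rfl

theorem received_available :
    (received P σ prop r i).available = ((before P σ prop r).state i).available := by
  unfold received; split_ifs <;> rfl

theorem before_view_subset_received :
    ((before P σ prop r).state i).view ⊆ (received P σ prop r i).view := by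
  unfold received receive
  split_ifs
  · exact Finset.subset_union_left
  · exact Finset.Subset.refl _
  · exact Finset.Subset.refl _

theorem before_buffer_subset_received :
    ((before P σ prop r).state i).buffer ⊆ (received P σ prop r i).buffer := by
  unfold received receive
  split_ifs
  · exact Finset.subset_union_left
  · exact Finset.subset_union_left
  · exact Finset.Subset.refl _

/-- The five kinds of rounds of a validator: idle, proposing, voting, confirming and merging. -/
theorem run_cases (t d : ℕ) (hr : r = 4 * P.Δ * t + d) (hd : d < 4 * P.Δ) :
    ((run P σ prop r).state i = received P σ prop r i ∧ (run P σ prop r).sent i = ∅ ∧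
      (i ∈ (run P σ prop r).active →
        (d = 0 → i ≠ prop t) ∧ d ≠ P.Δ ∧ d ≠ 2 * P.Δ ∧ d ≠ 3 * P.Δ)) ∨
    (i ∈ (run P σ prop r).active ∧ d = 0 ∧ i = prop t ∧ ∃ body : Body,
      (run P σ prop r).state i = ⟨(received P σ prop r i).view ∪ (received P σ prop r i).buffer, ∅,
        .mk (P.forkChoice ((run P σ prop r).state i).view t) body t i,
        ((before P σ prop r).state i).available⟩ ∧
      (run P σ prop r).sent i = {.proposal ((run P σ prop r).state i).chain
        (insert (.block ((run P σ prop r).state i).chain) ((run P σ prop r).state i).view) t i}) ∨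
    (i ∈ (run P σ prop r).active ∧ d = P.Δ ∧
      (run P σ prop r).state i = { received P σ prop r i with
        chain := P.forkChoice ((run P σ prop r).state i).view t } ∧
      (run P σ prop r).sent i = {.item (.headVote ((run P σ prop r).state i).chain t i)}) ∨
    (i ∈ (run P σ prop r).active ∧ d = 2 * P.Δ ∧
      (run P σ prop r).state i = { received P σ prop r i with
        available := updatedAvailable P.κ t (received P σ prop r i) } ∧
      (run P σ prop r).sent i = {.item (.ffgVote
        (latestJustified P.tieCheckpoint ((run P σ prop r).state i).view)
        ⟨targetBlock (latestJustified P.tieCheckpoint ((run P σ prop r).state i).view).block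
          ((run P σ prop r).state i).available, t⟩ i)}) ∨
    (i ∈ (run P σ prop r).active ∧ d = 3 * P.Δ ∧
      (run P σ prop r).state i = merge (received P σ prop r i) ∧ (run P σ prop r).sent i = ∅) := by
  obtain ⟨h₁, h₂⟩ := run_active (P := P) (σ := σ) (prop := prop) (r := r) (i := i)
  have ht : r / (4 * P.Δ) = t := by rw [hr, round_div hd]
  by_cases hi : i ∈ (run P σ prop r).active
  · rw [if_pos hi] at h₁ h₂
    unfold act at h₁ h₂
    simp only [ht] at h₁ h₂
    have hc₀ : (r = 4 * P.Δ * t) ↔ d = 0 := by omega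
    have hc₁ : (r = 4 * P.Δ * t + P.Δ) ↔ d = P.Δ := by omega
    have hc₂ : (r = 4 * P.Δ * t + 2 * P.Δ) ↔ d = 2 * P.Δ := by omega
    have hc₃ : (r = 4 * P.Δ * t + 3 * P.Δ) ↔ d = 3 * P.Δ := by omega
    simp only [hc₀, hc₁, hc₂, hc₃] at h₁ h₂
    by_cases hd₀ : d = 0
    · rw [if_pos hd₀] at h₁ h₂
      by_cases hp : i = prop t
      · rw [if_pos hp] at h₁ h₂
        refine Or.inr (Or.inl ⟨hi, hd₀, hp, σ.body (history P σ prop r) i, ?_, ?_⟩)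
        · rw [h₁]; simp only [merge, received_available]
        · rw [h₂, h₁]
      · rw [if_neg hp] at h₁ h₂
        exact Or.inl ⟨h₁, h₂, fun _ => ⟨fun _ => hp, by omega, by omega, by omega⟩⟩
    · rw [if_neg hd₀] at h₁ h₂
      by_cases hd₁ : d = P.Δ
      · rw [if_pos hd₁] at h₁ h₂
        refine Or.inr (Or.inr (Or.inl ⟨hi, hd₁, ?_, ?_⟩))
        · rw [h₁]
        · rw [h₂, h₁]
      · rw [if_neg hd₁] at h₁ h₂
        by_cases hd₂ : d = 2 * P.Δ
        · rw [if_pos hd₂] at h₁ h₂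
          refine Or.inr (Or.inr (Or.inr (Or.inl ⟨hi, hd₂, ?_, ?_⟩)))
          · rw [h₁]
          · rw [h₂, h₁]
        · rw [if_neg hd₂] at h₁ h₂
          by_cases hd₃ : d = 3 * P.Δ
          · rw [if_pos hd₃] at h₁ h₂
            exact Or.inr (Or.inr (Or.inr (Or.inr ⟨hi, hd₃, h₁, h₂⟩)))
          · rw [if_neg hd₃] at h₁ h₂
            exact Or.inl ⟨h₁, h₂, fun _ => ⟨fun h => absurd h hd₀, hd₁, hd₂, hd₃⟩⟩
  · rw [if_neg hi] at h₁ h₂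
    exact Or.inl ⟨h₁, h₂, fun h => absurd h hi⟩

theorem received_view_subset (hΔ : 1 ≤ P.Δ) :
    (received P σ prop r i).view ⊆ ((run P σ prop r).state i).view := by
  rcases run_cases (σ := σ) (prop := prop) (i := i) _ _
    (Nat.div_add_mod r (4 * P.Δ)).symm (Nat.mod_lt _ (by omega)) with
    ⟨h, -⟩ | ⟨-, -, -, b, h, -⟩ | ⟨-, -, h, -⟩ | ⟨-, -, h, -⟩ |
    ⟨-, -, h, -⟩ <;> rw [h]
  · exact Finset.subset_union_left
  · exact Finset.subset_union_left

theorem held_run (hΔ : 1 ≤ P.Δ) :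
    ((run P σ prop r).state i).held = (received P σ prop r i).held := by
  rcases run_cases (σ := σ) (prop := prop) (i := i) _ _
    (Nat.div_add_mod r (4 * P.Δ)).symm (Nat.mod_lt _ (by omega)) with
    ⟨h, -⟩ | ⟨-, -, -, b, h, -⟩ | ⟨-, -, h, -⟩ | ⟨-, -, h, -⟩ |
    ⟨-, -, h, -⟩ <;> rw [h] <;> simp [LocalState.held, merge]

theorem view_mono (hΔ : 1 ≤ P.Δ) {q : ℕ} (h : q ≤ r) :
    ((run P σ prop q).state i).view ⊆ ((run P σ prop r).state i).view := by
  induction h with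
  | refl => exact Finset.Subset.refl _
  | @step m _ ih =>
    exact ih.trans ((before_view_subset_received (r := m + 1)).trans (received_view_subset hΔ))

theorem view_subset_held {L : LocalState n Body} : L.view ⊆ L.held := Finset.subset_union_left

theorem buffer_subset_held {L : LocalState n Body} : L.buffer ⊆ L.held := Finset.subset_union_right

/-- The ways in which the canonical chain of a validator changes. -/
theorem chain_cases (t d : ℕ) (hr : r = 4 * P.Δ * t + d) (hd : d < 4 * P.Δ) :
    (((run P σ prop r).state i).chain = ((before P σ prop r).state i).chain ∧
      (i ∈ (run P σ prop r).active → d ≠ P.Δ)) ∨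
    (i ∈ (run P σ prop r).active ∧ d = 0 ∧ i = prop t ∧ ∃ body : Body,
      ((run P σ prop r).state i).chain =
        .mk (P.forkChoice ((run P σ prop r).state i).view t) body t i) ∨
    (i ∈ (run P σ prop r).active ∧ d = P.Δ ∧
      ((run P σ prop r).state i).chain = P.forkChoice ((run P σ prop r).state i).view t) := by
  rcases run_cases (σ := σ) (prop := prop) (i := i) t d hr hd with ⟨h, -, h'⟩ |
    ⟨hi, h₁, h₂, b, h, -⟩ | ⟨hi, h₁, h, -⟩ | ⟨hi, h₁, h, -⟩ | ⟨hi, h₁, h, -⟩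
  · refine Or.inl ⟨by rw [h, received_chain], fun hi => (h' hi).2.1⟩
  · exact Or.inr (Or.inl ⟨hi, h₁, h₂, b, congrArg LocalState.chain h⟩)
  · exact Or.inr (Or.inr ⟨hi, h₁, congrArg LocalState.chain h⟩)
  · exact Or.inl ⟨by rw [h]; exact received_chain, fun _ => by omega⟩
  · exact Or.inl ⟨by rw [h]; exact received_chain, fun _ => by omega⟩

/-- The ways in which the available chain of a validator changes. -/
theorem available_cases (t d : ℕ) (hr : r = 4 * P.Δ * t + d) (hd : d < 4 * P.Δ) :
    (((run P σ prop r).state i).available = ((before P σ prop r).state i).available ∧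
      (i ∈ (run P σ prop r).active → d ≠ 2 * P.Δ)) ∨
    (i ∈ (run P σ prop r).active ∧ d = 2 * P.Δ ∧
      ((run P σ prop r).state i).available = updatedAvailable P.κ t
        { (run P σ prop r).state i with
          available := ((before P σ prop r).state i).available }) := by
  rcases run_cases (σ := σ) (prop := prop) (i := i) t d hr hd with ⟨h, -, h'⟩ |
    ⟨hi, h₁, h₂, b, h, -⟩ | ⟨hi, h₁, h, -⟩ | ⟨hi, h₁, h, -⟩ | ⟨hi, h₁, h, -⟩
  · refine Or.inl ⟨by rw [h, received_available], fun hi => (h' hi).2.2.1⟩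
  · exact Or.inl ⟨by rw [h], fun _ => by omega⟩
  · exact Or.inl ⟨by rw [h]; exact received_available, fun _ => by omega⟩
  · refine Or.inr ⟨hi, h₁, ?_⟩
    have : { (run P σ prop r).state i with
        available := ((before P σ prop r).state i).available } = received P σ prop r i := by
      rw [h, ← received_available]
    rw [this, h]
  · exact Or.inl ⟨by rw [h]; exact received_available, fun _ => by omega⟩

/-- What a validator sends: a proposal at the start of a slot, a head vote at the voting round and
an FFG vote at the confirmation round, each time as an active validator. -/
theorem sent_cases (hΔ : 1 ≤ P.Δ) {m : Message n Body} (hm : m ∈ (run P σ prop r).sent i) :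
    i ∈ (run P σ prop r).active ∧ ∃ t,
    ((r = 4 * P.Δ * t ∧ i = prop t ∧ (∃ body : Body, ((run P σ prop r).state i).chain =
        .mk (P.forkChoice ((run P σ prop r).state i).view t) body t i) ∧
      m = .proposal ((run P σ prop r).state i).chain
        (insert (.block ((run P σ prop r).state i).chain) ((run P σ prop r).state i).view) t i) ∨
    (r = 4 * P.Δ * t + P.Δ ∧
      ((run P σ prop r).state i).chain = P.forkChoice ((run P σ prop r).state i).view t ∧
      m = .item (.headVote ((run P σ prop r).state i).chain t i)) ∨
    (r = 4 * P.Δ * t + 2 * P.Δ ∧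
      m = .item (.ffgVote
        (latestJustified P.tieCheckpoint ((run P σ prop r).state i).view)
        ⟨targetBlock (latestJustified P.tieCheckpoint ((run P σ prop r).state i).view).block
          ((run P σ prop r).state i).available, t⟩ i))) := by
  have hr := (Nat.div_add_mod r (4 * P.Δ)).symm
  rcases run_cases (σ := σ) (prop := prop) (i := i) _ _
    (Nat.div_add_mod r (4 * P.Δ)).symm (Nat.mod_lt _ (by omega)) with
    ⟨-, h, -⟩ | ⟨hi, hd, hp, b, h', h⟩ | ⟨hi, hd, h', h⟩ |
    ⟨hi, hd, -, h⟩ | ⟨-, -, -, h⟩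
  · rw [h] at hm; simp at hm
  · refine ⟨hi, r / (4 * P.Δ), Or.inl ⟨by omega, hp, ⟨b, congrArg LocalState.chain h'⟩, ?_⟩⟩
    rw [h] at hm; exact Finset.mem_singleton.1 hm
  · refine ⟨hi, r / (4 * P.Δ), Or.inr (Or.inl ⟨by omega, congrArg LocalState.chain h', ?_⟩)⟩
    rw [h] at hm; exact Finset.mem_singleton.1 hm
  · refine ⟨hi, r / (4 * P.Δ), Or.inr (Or.inr ⟨by omega, ?_⟩)⟩
    rw [h] at hm; exact Finset.mem_singleton.1 hm
  · rw [h] at hm; simp at hm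

end Run

/-! ### Acceptable items and signed objects -/

section Items

variable {prop : ℕ → Fin n} {x y : Item n Body} {m : Message n Body} {s t r Δ : ℕ}

theorem Item.self_mem_parts (x : Item n Body) : x ∈ x.parts := by
  cases x <;> simp [Item.parts]

theorem Item.parts_subset_of_mem (h : y ∈ x.parts) : y.parts ⊆ x.parts := by
  cases x with
  | block B => simp only [Item.parts, Finset.mem_singleton] at h; subst h; simp [Item.parts]
  | headVote B t v =>
    simp only [Item.parts, Finset.mem_insert, Finset.mem_singleton] at h
    rcases h with rfl | rfl <;> simp [Item.parts]
  | ffgVote C D v =>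
    simp only [Item.parts, Finset.mem_insert, Finset.mem_singleton] at h
    rcases h with rfl | rfl | rfl <;> simp [Item.parts]

theorem Item.Acceptable.of_mem_parts (hx : x.Acceptable prop t) (h : y ∈ x.parts) :
    y.Acceptable prop t := by
  cases x with
  | block B => simp only [Item.parts, Finset.mem_singleton] at h; subst h; exact hx
  | headVote B s v =>
    simp only [Item.parts, Finset.mem_insert, Finset.mem_singleton] at h
    rcases h with rfl | rfl
    · exact hx
    · exact ⟨hx.1, hx.2.1⟩
  | ffgVote C D v =>
    simp only [Item.parts, Finset.mem_insert, Finset.mem_singleton] at h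
    rcases h with rfl | rfl | rfl
    · exact hx
    · exact ⟨hx.1.1, hx.1.2.1⟩
    · exact ⟨hx.2.1, hx.2.2.1⟩

theorem Item.Acceptable.mono (hx : x.Acceptable prop s) (h : s ≤ t) : x.Acceptable prop t := by
  cases x with
  | block B => exact ⟨hx.1, hx.2.trans h⟩
  | headVote B s v => exact ⟨hx.1, hx.2.1.trans h, hx.2.2.trans h⟩
  | ffgVote C D v =>
    exact ⟨⟨hx.1.1, hx.1.2.1.trans h, hx.1.2.2.trans h⟩,
      ⟨hx.2.1, hx.2.2.1.trans h, hx.2.2.2.trans h⟩⟩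

theorem Item.signed_subset_of_mem_parts (h : y ∈ x.parts) : y.signed ⊆ x.signed := by
  cases x with
  | block B =>
    simp only [Item.parts, Finset.mem_singleton] at h; subst h; exact Set.Subset.refl _
  | headVote B s v =>
    simp only [Item.parts, Finset.mem_insert, Finset.mem_singleton] at h
    rcases h with rfl | rfl
    · exact Set.Subset.refl _
    · exact Set.subset_union_right
  | ffgVote C D v =>
    simp only [Item.parts, Finset.mem_insert, Finset.mem_singleton] at h
    rcases h with rfl | rfl | rfl
    · exact Set.Subset.refl _
    · exact fun z hz => Or.inl (Or.inr hz)
    · exact fun z hz => Or.inr hz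

theorem Item.Acceptable.slot_le_of_signed {A : Block n Body} (hx : x.Acceptable prop t)
    (h : Message.item (.block A) ∈ x.signed) : A.slot ≤ t := by
  have key : ∀ B : Block n Body, B.Valid prop → B.slot ≤ t →
      Message.item (.block A) ∈ B.signed → A.slot ≤ t := by
    rintro B hB hs ⟨A', hA', -, h⟩
    injection h with h
    injection h with h
    subst h
    exact (hB.slot_le hA').trans hs
  cases x with
  | block B => exact key B hx.1 hx.2 h
  | headVote B s v =>
    rcases h with h | h
    · simp at h
    · exact key B hx.1 hx.2.1 h
  | ffgVote C D v =>
    rcases h with (h | h) | h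
    · simp at h
    · exact key _ hx.1.1 hx.1.2.1 h
    · exact key _ hx.2.1 hx.2.2.1 h

/-- A vote is contained in an item only if it is that item. -/
theorem Item.eq_of_vote_mem_signed (hx : ∀ B, x ≠ .block B) (h : Message.item x ∈ y.signed) :
    y = x := by
  have key : ∀ B : Block n Body, Message.item x ∉ B.signed := by
    rintro B ⟨A, -, -, h⟩
    injection h with h
    exact hx _ h
  cases y with
  | block B => exact absurd h (key B)
  | headVote B s v =>
    rcases h with h | h
    · injection h with h; exact h.symm
    · exact absurd h (key B)
  | ffgVote C D v =>
    rcases h with (h | h) | h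
    · injection h with h; exact h.symm
    · exact absurd h (key _)
    · exact absurd h (key _)

theorem Item.vote_mem_signed (hx : ∀ B, x ≠ .block B) : Message.item x ∈ x.signed := by
  cases x with
  | block B => exact absurd rfl (hx B)
  | headVote B s v => exact Or.inl rfl
  | ffgVote C D v => exact Or.inl (Or.inl rfl)

/-- What a message puts into a buffer is acceptable, and comes with its signatures. -/
theorem toBuffer_spec (h : x ∈ toBuffer prop t m) :
    x.Acceptable prop t ∧ x.signed ⊆ m.signed ∧ x.parts ⊆ toBuffer prop t m := by
  cases m with
  | item y =>
    unfold toBuffer at h ⊢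
    dsimp only at h ⊢
    split_ifs at h ⊢ with hy
    · exact ⟨hy.of_mem_parts h, Item.signed_subset_of_mem_parts h, Item.parts_subset_of_mem h⟩
    · simp at h
  | proposal B V s v =>
    unfold toBuffer at h ⊢
    dsimp only at h ⊢
    split_ifs at h ⊢ with hy
    · rw [Finset.mem_singleton] at h
      subst h
      exact ⟨hy.2.2, fun z hz => Or.inl (Or.inr hz), by simp [Item.parts]⟩
    · simp at h

/-- What a proposal puts into a view is acceptable, and comes with its signatures. -/
theorem toView_spec (h : x ∈ toView Δ prop r m) :
    x.Acceptable prop (r / (4 * Δ)) ∧ x.signed ⊆ m.signed ∧ x.parts ⊆ toView Δ prop r m := by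
  cases m with
  | item y => simp [toView] at h
  | proposal B V s v =>
    unfold toView at h ⊢
    dsimp only at h ⊢
    split_ifs at h ⊢ with hy
    · obtain ⟨y, hy, hxy⟩ := Finset.mem_biUnion.1 h
      obtain ⟨hyV, hya⟩ := Finset.mem_filter.1 hy
      refine ⟨hya.of_mem_parts hxy, fun z hz => Or.inr (Set.mem_iUnion₂.2 ⟨y, hyV, ?_⟩), ?_⟩
      · exact Item.signed_subset_of_mem_parts hxy hz
      · exact (Item.parts_subset_of_mem hxy).trans (Finset.subset_biUnion_of_mem Item.parts hy)
    · simp at h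

end Items

/-! ### Invariants of executions -/

section Invariants

variable {P : Protocol n Body} {σ : Adversary n Body} {prop : ℕ → Fin n} {r : ℕ} {i : Fin n}
  {x y : Item n Body}

theorem mem_received_view (h : x ∈ (received P σ prop r i).view) :
    x ∈ ((before P σ prop r).state i).view ∨ i ∈ (before P σ prop r).active ∧
      ∃ m ∈ (run P σ prop r).delivered i, x ∈ toView P.Δ prop r m := by
  unfold received receive at h
  split_ifs at h with h₁ h₂
  · rcases Finset.mem_union.1 h with h | h
    · exact Or.inl h
    · exact Or.inr ⟨h₂, Finset.mem_biUnion.1 h⟩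
  · exact Or.inl h
  · exact Or.inl h

theorem mem_received_buffer (h : x ∈ (received P σ prop r i).buffer) :
    x ∈ ((before P σ prop r).state i).buffer ∨
      ∃ m ∈ (run P σ prop r).delivered i, x ∈ toBuffer prop (r / (4 * P.Δ)) m := by
  unfold received receive at h
  split_ifs at h with h₁
  · rcases Finset.mem_union.1 h with h | h
    · exact Or.inl h
    · exact Or.inr (Finset.mem_biUnion.1 h)
  · rcases Finset.mem_union.1 h with h | h
    · exact Or.inl h
    · exact Or.inr (Finset.mem_biUnion.1 h)
  · exact Or.inl h

theorem toView_subset_received {m : Message n Body} (hm : m ∈ (run P σ prop r).delivered i)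
    (hi : i ∈ (before P σ prop r).active) :
    toView P.Δ prop r m ⊆ (received P σ prop r i).view := by
  have : i ∈ (run P σ prop r).awake := by
    by_contra h
    rw [delivered_eq_empty h] at hm
    simp at hm
  unfold received receive
  rw [if_pos this]
  simp only [if_pos hi]
  exact (Finset.subset_biUnion_of_mem _ hm).trans Finset.subset_union_right

/-- Everything that a validator holds was accepted from a message, except for the genesis block. -/
theorem held_origin (hΔ : 1 ≤ P.Δ) (h : x ∈ ((run P σ prop r).state i).held) :
    x = .block .genesis ∨ ∃ q ≤ r, ∃ m ∈ (run P σ prop q).delivered i,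
      x.Acceptable prop (q / (4 * P.Δ)) ∧ x.signed ⊆ m.signed := by
  have step : ∀ r, x ∈ ((run P σ prop r).state i).held →
      x ∈ ((before P σ prop r).state i).held ∨ ∃ m ∈ (run P σ prop r).delivered i,
        x.Acceptable prop (r / (4 * P.Δ)) ∧ x.signed ⊆ m.signed := by
    intro r h
    rw [held_run hΔ] at h
    rcases Finset.mem_union.1 h with h | h
    · rcases mem_received_view h with h | ⟨-, m, hm, h⟩
      · exact Or.inl (Finset.mem_union_left _ h)
      · exact Or.inr ⟨m, hm, (toView_spec h).1, (toView_spec h).2.1⟩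
    · rcases mem_received_buffer h with h | ⟨m, hm, h⟩
      · exact Or.inl (Finset.mem_union_right _ h)
      · exact Or.inr ⟨m, hm, (toBuffer_spec h).1, (toBuffer_spec h).2.1⟩
  induction r with
  | zero =>
    rcases step 0 h with h | ⟨m, hm, h⟩
    · left
      simpa [before_zero, initialConfig, LocalState.held] using h
    · exact Or.inr ⟨0, le_rfl, m, hm, h⟩
  | succ r ih =>
    rcases step (r + 1) h with h | ⟨m, hm, h⟩
    · rcases ih h with h | ⟨q, hq, h⟩
      · exact Or.inl h
      · exact Or.inr ⟨q, by omega, h⟩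
    · exact Or.inr ⟨r + 1, le_rfl, m, hm, h⟩

theorem held_acceptable (hΔ : 1 ≤ P.Δ) (h : x ∈ ((run P σ prop r).state i).held) :
    x.Acceptable prop (r / (4 * P.Δ)) := by
  rcases held_origin hΔ h with rfl | ⟨q, hq, m, -, h, -⟩
  · exact ⟨trivial, Nat.zero_le _⟩
  · exact h.mono (Nat.div_le_div_right hq)

theorem genesis_mem_view (hΔ : 1 ≤ P.Δ) :
    Item.block .genesis ∈ ((run P σ prop r).state i).view := by
  refine view_mono hΔ (Nat.zero_le r) (received_view_subset hΔ (before_view_subset_received ?_))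
  simp [before_zero, initialConfig]

/-- Views and buffers contain, with every vote, the blocks that it refers to. -/
theorem parts_subset (hΔ : 1 ≤ P.Δ) :
    (∀ x ∈ ((run P σ prop r).state i).view, x.parts ⊆ ((run P σ prop r).state i).view) ∧
    (∀ x ∈ ((run P σ prop r).state i).buffer, x.parts ⊆ ((run P σ prop r).state i).buffer) := by
  have step : ∀ r,
      ((∀ x ∈ ((before P σ prop r).state i).view,
          x.parts ⊆ ((before P σ prop r).state i).view) ∧
        (∀ x ∈ ((before P σ prop r).state i).buffer,
          x.parts ⊆ ((before P σ prop r).state i).buffer)) →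
      ((∀ x ∈ ((run P σ prop r).state i).view, x.parts ⊆ ((run P σ prop r).state i).view) ∧
        (∀ x ∈ ((run P σ prop r).state i).buffer,
          x.parts ⊆ ((run P σ prop r).state i).buffer)) := by
    rintro r ⟨hv, hb⟩
    have hv' : ∀ x ∈ (received P σ prop r i).view, x.parts ⊆ (received P σ prop r i).view := by
      intro x hx
      rcases mem_received_view hx with h | ⟨hi, m, hm, h⟩
      · exact (hv x h).trans before_view_subset_received
      · exact (toView_spec h).2.2.trans (toView_subset_received hm hi)
    have hb' : ∀ x ∈ (received P σ prop r i).buffer,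
        x.parts ⊆ (received P σ prop r i).buffer := by
      intro x hx
      rcases mem_received_buffer hx with h | ⟨m, hm, h⟩
      · exact (hb x h).trans before_buffer_subset_received
      · have haw : i ∈ (run P σ prop r).awake := by
          by_contra h
          rw [delivered_eq_empty h] at hm
          simp at hm
        refine (toBuffer_spec h).2.2.trans ?_
        unfold received receive
        rw [if_pos haw]
        exact (Finset.subset_biUnion_of_mem _ hm).trans Finset.subset_union_right
    have hm' : ∀ x ∈ (received P σ prop r i).view ∪ (received P σ prop r i).buffer,
        x.parts ⊆ (received P σ prop r i).view ∪ (received P σ prop r i).buffer := by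
      intro x hx
      rcases Finset.mem_union.1 hx with h | h
      · exact (hv' x h).trans Finset.subset_union_left
      · exact (hb' x h).trans Finset.subset_union_right
    rcases run_cases (σ := σ) (prop := prop) (i := i) _ _
      (Nat.div_add_mod r (4 * P.Δ)).symm (Nat.mod_lt _ (by omega)) with ⟨h, -⟩ |
      ⟨-, -, -, b, h, -⟩ | ⟨-, -, h, -⟩ | ⟨-, -, h, -⟩ | ⟨-, -, h, -⟩ <;> rw [h]
    · exact ⟨hv', hb'⟩
    · exact ⟨hm', by simp⟩
    · exact ⟨hv', hb'⟩
    · exact ⟨hv', hb'⟩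
    · exact ⟨hm', by simp [merge]⟩
  induction r with
  | zero => exact step 0 (by simp [before_zero, initialConfig, Item.parts])
  | succ r ih => exact step (r + 1) ih

theorem block_mem_view_of_headVote (hΔ : 1 ≤ P.Δ) {B : Block n Body} {s : ℕ} {v : Fin n}
    (h : Item.headVote B s v ∈ ((run P σ prop r).state i).view) :
    Item.block B ∈ ((run P σ prop r).state i).view :=
  (parts_subset hΔ).1 _ h (by simp [Item.parts])

theorem exists_ffgVote_of_link [NeZero n] {V : View n Body} {C D : Checkpoint n Body}
    (h : SupermajorityLink V C D) : ∃ v, Item.ffgVote C D v ∈ V := by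
  have h := h.2.2.2.2
  have : 0 < n := Nat.pos_of_neZero n
  by_contra hne
  push Not at hne
  simp [hne] at h
  omega

/-- Justified blocks of an honest view are acceptable. -/
theorem justified_block_valid [NeZero n] (hΔ : 1 ≤ P.Δ) {C : Checkpoint n Body}
    (h : Justified ((run P σ prop r).state i).view C) :
    C.block.Valid prop ∧ C.block.slot ≤ r / (4 * P.Δ) := by
  rcases justified_mem h with rfl | ⟨C', -, h⟩
  · exact ⟨trivial, Nat.zero_le _⟩
  · obtain ⟨v, hv⟩ := exists_ffgVote_of_link h
    have := (held_acceptable hΔ (view_subset_held hv)).2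
    exact ⟨this.1, this.2.1⟩

theorem valid_of_mem_tree (hΔ : 1 ≤ P.Δ) {A : Block n Body}
    (h : A ∈ tree ((run P σ prop r).state i).view) :
    A.Valid prop ∧ A.slot ≤ r / (4 * P.Δ) := by
  obtain ⟨B, hB, hA⟩ := mem_tree.1 h
  have := held_acceptable hΔ (view_subset_held hB)
  exact ⟨this.1.of_prefix hA, (this.1.slot_le hA).trans this.2⟩

theorem updatedAvailable_cases (κ t : ℕ) (L : LocalState n Body) :
    updatedAvailable κ t L = L.available ∨ updatedAvailable κ t L = fastBlock L t ∨
      updatedAvailable κ t L = L.chain.deepPrefix κ t := by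
  unfold updatedAvailable
  split_ifs <;> simp

theorem targetBlock_cases (J A : Block n Body) : targetBlock J A = J ∨ targetBlock J A = A := by
  unfold targetBlock
  split_ifs <;> simp

/-- The fork choice of a protocol selects a block of the view. -/
def SelectsFromView (P : Protocol n Body) : Prop :=
  ∀ V t, P.forkChoice V t = .genesis ∨ P.forkChoice V t ∈ tree V

/-- The chains of validators contain no blocks from future slots. -/
theorem chain_slot_le (hΔ : 1 ≤ P.Δ) (hF : SelectsFromView P) :
    (∀ A : Block n Body, A.Prefix ((run P σ prop r).state i).chain → A.slot ≤ r / (4 * P.Δ)) ∧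
    (∀ A : Block n Body, A.Prefix ((run P σ prop r).state i).available →
      A.slot ≤ r / (4 * P.Δ)) := by
  have hFC : ∀ r t (A : Block n Body),
      A.Prefix (P.forkChoice ((run P σ prop r).state i).view t) → A.slot ≤ r / (4 * P.Δ) := by
    intro r t A hA
    rcases hF ((run P σ prop r).state i).view t with h | h
    · rw [h, prefix_genesis_iff] at hA
      rw [hA]; exact Nat.zero_le _
    · exact (valid_of_mem_tree hΔ (mem_tree_of_prefix h hA)).2
  have step : ∀ r,
      (∀ A : Block n Body, A.Prefix ((before P σ prop r).state i).chain →
        A.slot ≤ r / (4 * P.Δ)) →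
      (∀ A : Block n Body, A.Prefix ((before P σ prop r).state i).available →
        A.slot ≤ r / (4 * P.Δ)) →
      (∀ A : Block n Body, A.Prefix ((run P σ prop r).state i).chain → A.slot ≤ r / (4 * P.Δ)) ∧
      (∀ A : Block n Body, A.Prefix ((run P σ prop r).state i).available →
        A.slot ≤ r / (4 * P.Δ)) := by
    intro r hc ha
    have hc' : ∀ A : Block n Body, A.Prefix ((run P σ prop r).state i).chain →
        A.slot ≤ r / (4 * P.Δ) := by
      intro A hA
      rcases chain_cases (σ := σ) (prop := prop) (i := i) _ _
        (Nat.div_add_mod r (4 * P.Δ)).symm (Nat.mod_lt _ (by omega)) with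
        ⟨h, -⟩ | ⟨-, -, -, b, h⟩ | ⟨-, -, h⟩
      · exact hc A (h ▸ hA)
      · rw [h] at hA
        rcases prefix_mk_iff.1 hA with rfl | hA
        · exact le_rfl
        · exact hFC _ _ _ hA
      · rw [h] at hA; exact hFC _ _ _ hA
    refine ⟨hc', fun A hA => ?_⟩
    rcases available_cases (σ := σ) (prop := prop) (i := i) _ _
      (Nat.div_add_mod r (4 * P.Δ)).symm (Nat.mod_lt _ (by omega)) with ⟨h, -⟩ | ⟨-, -, h⟩
    · exact ha A (h ▸ hA)
    · rw [h] at hA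
      rcases updatedAvailable_cases P.κ (r / (4 * P.Δ)) { (run P σ prop r).state i with
          available := ((before P σ prop r).state i).available } with h' | h' | h'
      · rw [h'] at hA; exact ha A hA
      · rw [h'] at hA; exact hc' A (hA.trans (highest_prefix _ _))
      · rw [h'] at hA; exact hc' A (hA.trans (highest_prefix _ _))
  have hinit : ∀ A : Block n Body, A.Prefix .genesis → A.slot ≤ 0 := by
    intro A hA
    rw [prefix_genesis_iff.1 hA]; exact le_rfl
  induction r with
  | zero =>
    refine step 0 ?_ ?_ <;>
    · intro A hA
      exact (hinit A hA).trans (Nat.zero_le _)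
  | succ r ih =>
    have hle : r / (4 * P.Δ) ≤ (r + 1) / (4 * P.Δ) := Nat.div_le_div_right (Nat.le_succ r)
    exact step (r + 1) (fun A hA => (ih.1 A hA).trans hle) fun A hA => (ih.2 A hA).trans hle

/-- Honest validators do not send blocks from future slots. -/
theorem sent_slot_le [NeZero n] (hΔ : 1 ≤ P.Δ) (hF : SelectsFromView P) {m : Message n Body}
    {A : Block n Body} (hm : m ∈ (run P σ prop r).sent i)
    (hA : Message.item (.block A) ∈ m.signed) : A.slot ≤ r / (4 * P.Δ) := by
  obtain ⟨hc, ha⟩ := chain_slot_le (σ := σ) (prop := prop) (r := r) (i := i) hΔ hF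
  have key : ∀ B : Block n Body, (∀ A : Block n Body, A.Prefix B → A.slot ≤ r / (4 * P.Δ)) →
      Message.item (.block A) ∈ B.signed → A.slot ≤ r / (4 * P.Δ) := by
    rintro B hB ⟨A', hA', -, h⟩
    injection h with h
    injection h with h
    subst h
    exact hB _ hA'
  obtain ⟨-, t, ⟨-, -, -, rfl⟩ | ⟨-, -, rfl⟩ | ⟨-, rfl⟩⟩ := sent_cases hΔ hm
  · rcases hA with (hA | hA) | hA
    · simp at hA
    · exact key _ hc hA
    · obtain ⟨y, hy, hyA⟩ := Set.mem_iUnion₂.1 hA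
      rcases Finset.mem_insert.1 hy with rfl | hy
      · exact key _ hc hyA
      · exact (held_acceptable hΔ (view_subset_held hy)).slot_le_of_signed hyA
  · rcases hA with hA | hA
    · simp at hA
    · exact key _ hc hA
  · have hJ := justified_block_valid hΔ
      (latestJustified_justified P.tieCheckpoint ((run P σ prop r).state i).view)
    have hJ' : ∀ A : Block n Body, A.Prefix (latestJustified P.tieCheckpoint
        ((run P σ prop r).state i).view).block → A.slot ≤ r / (4 * P.Δ) :=
      fun A hA => (hJ.1.slot_le hA).trans hJ.2
    rcases hA with (hA | hA) | hA
    · simp at hA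
    · exact key _ hJ' hA
    · refine key _ ?_ hA
      dsimp only
      rcases targetBlock_cases (latestJustified P.tieCheckpoint
        ((run P σ prop r).state i).view).block ((run P σ prop r).state i).available with h | h
      · rw [h]; exact hJ'
      · rw [h]; exact ha

/-- Votes of a validator that is not corrupted were sent by it. -/
theorem vote_sent (hΔ : 1 ≤ P.Δ) (hU : Unforgeable (run P σ prop)) {v : Fin n}
    (hx : x ∈ ((run P σ prop r).state i).held) (hvote : ∀ B, x ≠ .block B)
    (hs : (Message.item x).signer = some v) (hv : v ∉ (run P σ prop r).corrupted) :
    ∃ r' < r, Message.item x ∈ (run P σ prop r').sent v := by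
  induction r using Nat.strong_induction_on generalizing i with
  | _ r ih =>
  rcases held_origin hΔ hx with rfl | ⟨q, hq, m, hm, -, hsub⟩
  · exact absurd rfl (hvote _)
  · have hvq : v ∉ (run P σ prop q).corrupted := fun h => hv (corrupted_mono hq h)
    obtain ⟨r', hr', m', hm', hxm'⟩ :=
      (hU q i m hm _ (hsub (Item.vote_mem_signed hvote)) v hs).resolve_left hvq
    have hvr' : v ∉ (run P σ prop r').corrupted :=
      fun h => hvq (corrupted_mono hr'.le h)
    obtain ⟨-, t, ⟨-, -, -, rfl⟩ | ⟨-, -, rfl⟩ | ⟨-, rfl⟩⟩ := sent_cases hΔ hm'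
    · rcases hxm' with (hA | ⟨A, -, -, hA⟩) | hA
      · simp at hA
      · injection hA with hA
        exact absurd hA (hvote _)
      · obtain ⟨y, hy, hyx⟩ := Set.mem_iUnion₂.1 hA
        rw [Item.eq_of_vote_mem_signed hvote hyx] at hy
        rcases Finset.mem_insert.1 hy with hy | hy
        · exact absurd hy (hvote _)
        · obtain ⟨r'', h'', hs''⟩ := ih r' (by omega) (view_subset_held hy) hvr'
          exact ⟨r'', by omega, hs''⟩
    · rw [← Item.eq_of_vote_mem_signed (y := .headVote _ _ _) hvote hxm']
      exact ⟨r', by omega, hm'⟩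
    · rw [← Item.eq_of_vote_mem_signed (y := .ffgVote _ _ _) hvote hxm']
      exact ⟨r', by omega, hm'⟩

/-- A head vote of a validator that is not corrupted is for its canonical chain at the voting
round. -/
theorem headVote_sent (hΔ : 1 ≤ P.Δ) (hU : Unforgeable (run P σ prop)) {v : Fin n}
    {B : Block n Body} {s : ℕ} (hx : Item.headVote B s v ∈ ((run P σ prop r).state i).held)
    (hv : v ∉ (run P σ prop r).corrupted) :
    4 * P.Δ * s + P.Δ < r ∧ v ∈ (run P σ prop (4 * P.Δ * s + P.Δ)).active ∧
      B = ((run P σ prop (4 * P.Δ * s + P.Δ)).state v).chain := by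
  obtain ⟨r', hr', hm⟩ := vote_sent hΔ hU hx (by simp) rfl hv
  obtain ⟨hact, t, ⟨-, -, -, h⟩ | ⟨hr, -, h⟩ | ⟨-, h⟩⟩ := sent_cases hΔ hm
  · simp at h
  · simp only [Message.item.injEq, Item.headVote.injEq] at h
    obtain ⟨rfl, rfl, -⟩ := h
    subst hr
    exact ⟨hr', hact, rfl⟩
  · simp at h

/-- The target of an FFG vote of a validator that is not corrupted. -/
theorem ffgVote_sent (hΔ : 1 ≤ P.Δ) (hU : Unforgeable (run P σ prop)) {v : Fin n}
    {C D : Checkpoint n Body} (hx : Item.ffgVote C D v ∈ ((run P σ prop r).state i).held)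
    (hv : v ∉ (run P σ prop r).corrupted) :
    4 * P.Δ * D.slot + 2 * P.Δ < r ∧ v ∈ (run P σ prop (4 * P.Δ * D.slot + 2 * P.Δ)).active ∧
      (D.block = (latestJustified P.tieCheckpoint
          ((run P σ prop (4 * P.Δ * D.slot + 2 * P.Δ)).state v).view).block ∨
        D.block = ((run P σ prop (4 * P.Δ * D.slot + 2 * P.Δ)).state v).available) := by
  obtain ⟨r', hr', hm⟩ := vote_sent hΔ hU hx (by simp) rfl hv
  obtain ⟨hact, t, ⟨-, -, -, h⟩ | ⟨hr, -, h⟩ | ⟨hr, h⟩⟩ := sent_cases hΔ hm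
  · simp at h
  · simp at h
  · simp only [Message.item.injEq, Item.ffgVote.injEq] at h
    obtain ⟨-, rfl, -⟩ := h
    subst hr
    exact ⟨hr', hact, targetBlock_cases _ _⟩

/-- An honest proposer holds no block from its own slot when it proposes: such a block would bear
its signature, and it is accepted only from the start of the slot on. -/
theorem slot_lt_of_held_by_proposer [NeZero n] (hΔ : 1 ≤ P.Δ) (hF : SelectsFromView P)
    (hU : Unforgeable (run P σ prop)) {t : ℕ} {A B : Block n Body}
    (hp : prop t ∉ (run P σ prop (4 * P.Δ * t)).corrupted)
    (hB : Item.block B ∈ ((run P σ prop (4 * P.Δ * t)).state i).held)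
    (hA : A.Prefix B) (hne : A ≠ .genesis) : A.slot < t := by
  have hval := held_acceptable hΔ hB
  have hdiv : 4 * P.Δ * t / (4 * P.Δ) = t := round_div (d := 0) (by omega)
  rw [hdiv] at hval
  refine lt_of_le_of_ne ((hval.1.slot_le hA).trans hval.2) fun hslot => ?_
  rcases held_origin hΔ hB with h | ⟨q, hq, m, hm, -, hsub⟩
  · injection h with h
    rw [h] at hA
    exact hne (prefix_genesis_iff.1 hA)
  · have hs : (Message.item (.block A)).signer = some (prop t) := by
      have := hval.1.of_prefix hA
      cases A with
      | genesis => exact absurd rfl hne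
      | mk p b s a =>
        have hs : s = t := hslot
        subst hs
        exact congrArg some this.2.1
    obtain ⟨r', hr', m', hm', hA'⟩ :=
      (hU q i m hm _ (hsub ⟨A, hA, hne, rfl⟩) _ hs).resolve_left fun h => hp (corrupted_mono hq h)
    have h₁ := sent_slot_le hΔ hF hm' hA'
    have h₂ : r' / (4 * P.Δ) < t := by
      rw [Nat.div_lt_iff_lt_mul (by omega), Nat.mul_comm]
      omega
    omega

end Invariants

/-! ### Fork-choice decisions and the views on which they are based -/

/-- Validator `i` evaluates the fork choice of slot `t` at round `r`: as the proposer at round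
`4Δt`, or as a voter at round `4Δt + Δ`. -/
def Decides (P : Protocol n Body) (σ : Adversary n Body) (prop : ℕ → Fin n) (t r : ℕ)
    (i : Fin n) : Prop :=
  i ∈ (run P σ prop r).active ∧
    ((r = 4 * P.Δ * t ∧ i = prop t) ∨ r = 4 * P.Δ * t + P.Δ)

/-- All validators that vote in slot `t` vote for descendants of `X`. -/
def Supported (P : Protocol n Body) (σ : Adversary n Body) (prop : ℕ → Fin n) (t : ℕ)
    (X : Block n Body) : Prop :=
  ∀ i ∈ (run P σ prop (4 * P.Δ * t + P.Δ)).active,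
    X.Prefix ((run P σ prop (4 * P.Δ * t + P.Δ)).state i).chain

/-- On the view of every fork-choice decision of slot `t`, RLMD-GHOST selects a descendant of
`X`. -/
def Agreed (tb : TieBreak (Block n Body)) (η : ℕ) (P : Protocol n Body) (σ : Adversary n Body)
    (prop : ℕ → Fin n) (t : ℕ) (X : Block n Body) : Prop :=
  ∀ r i, Decides P σ prop t r i → X.Prefix (rlmdGhost tb η ((run P σ prop r).state i).view t)

/-- On the view of every fork-choice decision of slot `t`, the fork choice of the protocol is that
of RLMD-GHOST. -/
def FollowsRlmd (tb : TieBreak (Block n Body)) (η : ℕ) (P : Protocol n Body)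
    (σ : Adversary n Body) (prop : ℕ → Fin n) (t : ℕ) : Prop :=
  ∀ r i, Decides P σ prop t r i →
    P.forkChoice ((run P σ prop r).state i).view t =
      rlmdGhost tb η ((run P σ prop r).state i).view t

section Decisions

variable {P : Protocol n Body} {σ : Adversary n Body} {prop : ℕ → Fin n} {r t η : ℕ} {i : Fin n}
  {x : Item n Body} {X : Block n Body} {tb : TieBreak (Block n Body)}

theorem Decides.le (h : Decides P σ prop t r i) : r ≤ 4 * P.Δ * t + P.Δ := by
  rcases h.2 with h | h <;> omega

theorem Decides.ge (h : Decides P σ prop t r i) : 4 * P.Δ * t ≤ r := by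
  rcases h.2 with h | h <;> omega

/-- No round strictly between two consecutive merge rounds is a merge round. -/
theorem ne_merge_round {Δ t r : ℕ} (h₁ : 4 * Δ * t + 3 * Δ < r)
    (h₂ : r < 4 * Δ * (t + 1) + 3 * Δ) (u : ℕ) : r ≠ 4 * Δ * u + 3 * Δ := by
  rintro rfl
  rcases Nat.lt_or_ge t u with h | h
  · have := round_le_of_slot_lt Δ h
    rw [slot_mul_succ] at h₂
    omega
  · have := Nat.mul_le_mul_left (4 * Δ) h
    omega

theorem ne_merge_round_of_lt {Δ t r : ℕ} (h₁ : 4 * Δ * t ≤ r) (h₂ : r < 4 * Δ * t + 3 * Δ)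
    (u : ℕ) : r ≠ 4 * Δ * u + 3 * Δ := by
  rintro rfl
  have : u = t := slot_unique (Δ := Δ) (r := 4 * Δ * u + 3 * Δ) (by omega) (by omega) h₁ (by omega)
  subst this
  omega

theorem active_of_le_of_slot {q : ℕ} (hi : i ∈ (run P σ prop r).active) (hqr : q ≤ r)
    (h₁ : 4 * P.Δ * t ≤ q) (h₂ : r < 4 * P.Δ * t + 3 * P.Δ) : i ∈ (run P σ prop q).active :=
  active_of_le hqr hi fun _ hx hx' => ne_merge_round_of_lt (t := t) (by omega) (by omega)

theorem active_at_merge (hi : i ∈ (run P σ prop r).active)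
    (h₁ : 4 * P.Δ * t + 3 * P.Δ ≤ r) (h₂ : r < 4 * P.Δ * (t + 1) + 3 * P.Δ) :
    i ∈ (run P σ prop (4 * P.Δ * t + 3 * P.Δ)).active :=
  active_of_le h₁ hi fun _ hx hx' => ne_merge_round (t := t) (by omega) (by omega)

theorem state_view_eq_received {d : ℕ} (hr : r = 4 * P.Δ * t + d) (hd : d < 3 * P.Δ)
    (h₀ : d = 0 → i ≠ prop t) :
    ((run P σ prop r).state i).view = (received P σ prop r i).view := by
  rcases run_cases (σ := σ) (prop := prop) (i := i) t d hr (by omega) with ⟨h, -⟩ |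
    ⟨-, h₁, h₂, b, h, -⟩ | ⟨-, -, h, -⟩ | ⟨-, -, h, -⟩ | ⟨-, h₁, h, -⟩
  · rw [h]
  · exact absurd h₂ (h₀ h₁)
  · rw [h]
  · rw [h]
  · omega

/-- Proposals take effect only during the first rounds of their slot, so that views do not change
between the voting round and the merge round, and after the merge round. -/
theorem view_eq_before {d : ℕ} (hr : r = 4 * P.Δ * t + d) (h₁ : P.Δ < d) (h₂ : d < 4 * P.Δ)
    (h₃ : d ≠ 3 * P.Δ) :
    ((run P σ prop r).state i).view = ((before P σ prop r).state i).view := by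
  have hrec : (received P σ prop r i).view = ((before P σ prop r).state i).view := by
    refine Finset.Subset.antisymm (fun x hx => ?_) before_view_subset_received
    rcases mem_received_view hx with h | ⟨-, m, -, h⟩
    · exact h
    · exfalso
      cases m with
      | item y => simp [toView] at h
      | proposal B V s v =>
        unfold toView at h
        dsimp only at h
        split_ifs at h with hc
        · have : s = t := slot_unique (Δ := P.Δ) (r := r) hc.2.1 (by omega) (by omega) (by omega)
          subst this
          omega
        · simp at h
  rw [← hrec]
  rcases run_cases (σ := σ) (prop := prop) (i := i) t d hr (by omega) with ⟨h, -⟩ |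
    ⟨-, h₁, h₂, b, h, -⟩ | ⟨-, -, h, -⟩ | ⟨-, -, h, -⟩ | ⟨-, h₁, h, -⟩
  · rw [h]
  · omega
  · rw [h]
  · rw [h]
  · omega

theorem view_at_confirmation :
    ((run P σ prop (4 * P.Δ * t + 2 * P.Δ)).state i).view =
      ((run P σ prop (4 * P.Δ * t + P.Δ)).state i).view := by
  have key : ∀ e ≤ P.Δ, ((run P σ prop (4 * P.Δ * t + P.Δ + e)).state i).view =
      ((run P σ prop (4 * P.Δ * t + P.Δ)).state i).view := by
    intro e he
    induction e with
    | zero => rfl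
    | succ e ih =>
      rw [← ih (by omega)]
      exact view_eq_before (t := t) (d := P.Δ + (e + 1)) (by omega) (by omega) (by omega) (by omega)
  have := key P.Δ le_rfl
  rwa [show 4 * P.Δ * t + P.Δ + P.Δ = 4 * P.Δ * t + 2 * P.Δ by omega] at this

theorem view_after_merge {e : ℕ} (he : e < P.Δ) :
    ((run P σ prop (4 * P.Δ * t + 3 * P.Δ + e)).state i).view =
      ((run P σ prop (4 * P.Δ * t + 3 * P.Δ)).state i).view := by
  induction e with
  | zero => rfl
  | succ e ih =>
    rw [← ih (by omega)]
    exact view_eq_before (t := t) (d := 3 * P.Δ + (e + 1)) (by omega) (by omega) (by omega)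
      (by omega)

theorem view_eq_held_of_merge (hΔ : 1 ≤ P.Δ)
    (hi : i ∈ (run P σ prop (4 * P.Δ * t + 3 * P.Δ)).active) :
    ((run P σ prop (4 * P.Δ * t + 3 * P.Δ)).state i).view =
      ((run P σ prop (4 * P.Δ * t + 3 * P.Δ)).state i).held := by
  rw [held_run hΔ]
  rcases run_cases (P := P) (σ := σ) (prop := prop) (i := i) t (3 * P.Δ) rfl (by omega) with
    ⟨-, -, h⟩ | ⟨-, h₁, -⟩ | ⟨-, h, -⟩ | ⟨-, h, -⟩ | ⟨-, -, h, -⟩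
  · exact absurd rfl (h hi).2.2.2
  · omega
  · omega
  · omega
  · rw [h]; rfl

theorem view_eq_held_of_proposer (hΔ : 1 ≤ P.Δ)
    (hi : prop t ∈ (run P σ prop (4 * P.Δ * t)).active) :
    ((run P σ prop (4 * P.Δ * t)).state (prop t)).view =
      ((run P σ prop (4 * P.Δ * t)).state (prop t)).held := by
  rcases run_cases (P := P) (σ := σ) (prop := prop) (r := 4 * P.Δ * t) (i := prop t) t 0 rfl
    (by omega) with ⟨-, -, h⟩ | ⟨-, -, -, b, h, -⟩ | ⟨-, h, -⟩ | ⟨-, h, -⟩ | ⟨-, h, -⟩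
  · exact absurd rfl ((h hi).1 rfl)
  · rw [h]; simp [LocalState.held]
  · omega
  · omega
  · omega

theorem sends_headVote (hΔ : 1 ≤ P.Δ)
    (hi : i ∈ (run P σ prop (4 * P.Δ * t + P.Δ)).active) :
    ((run P σ prop (4 * P.Δ * t + P.Δ)).state i).chain =
        P.forkChoice ((run P σ prop (4 * P.Δ * t + P.Δ)).state i).view t ∧
      Message.item (.headVote ((run P σ prop (4 * P.Δ * t + P.Δ)).state i).chain t i) ∈
        (run P σ prop (4 * P.Δ * t + P.Δ)).sent i := by
  rcases run_cases (P := P) (σ := σ) (prop := prop) (i := i) t P.Δ rfl (by omega) with ⟨-, -, h⟩ |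
    ⟨-, h₁, -⟩ | ⟨-, -, h, h'⟩ | ⟨-, h, -⟩ | ⟨-, h, -⟩
  · exact absurd rfl (h hi).2.1
  · omega
  · exact ⟨congrArg LocalState.chain h, by rw [h']; exact Finset.mem_singleton_self _⟩
  · omega
  · omega

/-- Deciders of a slot have in their view whatever was sent, or held by an awake validator, up to
the confirmation round of the slot before. -/
theorem mem_view_of_early (hΔ : 1 ≤ P.Δ) (hS : Synchronous P.Δ 0 (run P σ prop))
    (hd : Decides P σ prop (t + 1) r i) {q : ℕ} {j : Fin n} (hq : q ≤ 4 * P.Δ * t + 2 * P.Δ)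
    (hx : Message.item x ∈ (run P σ prop q).sent j ∨
      (j ∈ (run P σ prop q).awake ∧ x ∈ ((run P σ prop q).state j).held)) :
    x ∈ ((run P σ prop r).state i).view := by
  have h₁ := hd.le
  have h₂ := hd.ge
  have hs := slot_mul_succ P.Δ t
  have hi := active_at_merge (t := t) hd.1 (by omega) (by omega)
  refine view_mono hΔ (q := 4 * P.Δ * t + 3 * P.Δ) (by omega) ?_
  rw [view_eq_held_of_merge hΔ hi]
  exact hS.1 q j x hx _ (by simp; omega) i (awake_of_active hi)

/-- No honest view contains an equivocation of a validator that is not corrupted. -/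
theorem not_equivocates (hΔ : 1 ≤ P.Δ) (hU : Unforgeable (run P σ prop)) {v : Fin n}
    (hv : v ∉ (run P σ prop r).corrupted) :
    ¬ Equivocates {x | x ∈ ((run P σ prop r).state i).view} v := by
  rintro ⟨s, B, C, hne, hB, hC⟩
  refine hne ?_
  rw [(headVote_sent hΔ hU (view_subset_held hB) hv).2.2,
    (headVote_sent hΔ hU (view_subset_held hC) hv).2.2]

theorem mem_tree_of_headVote (hΔ : 1 ≤ P.Δ) {B : Block n Body} {s : ℕ} {v : Fin n}
    (h : Item.headVote B s v ∈ ((run P σ prop r).state i).view) (hX : X.Prefix B) :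
    X ∈ tree ((run P σ prop r).state i).view :=
  mem_tree.2 ⟨B, block_mem_view_of_headVote hΔ h, hX⟩

/-- The central propagation step: a block that is supported by all voters of a slot wins the fork
choice of the next slot, since by sleepiness these voters outnumber the other validators whose votes
have not expired. -/
theorem agreed_of_supported (hΔ : 1 ≤ P.Δ) (hη : 1 ≤ η) (hC : Compliant P.Δ η 0 (run P σ prop))
    (hX : Supported P σ prop t X) : Agreed tb η P σ prop (t + 1) X := by
  intro r i hd
  have hsl := hC.sleepy (t + 1) (by positivity)
  rw [Nat.add_sub_cancel] at hsl
  have hle := hd.le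
  set V := ((run P σ prop r).state i).view with hV
  set H := activeAt P.Δ (run P σ prop) t with hH
  set A := corruptedAt P.Δ (run P σ prop) (t + 1) with hA
  set R := recentlyActive P.Δ η (run P σ prop) (t + 1) with hR
  have hcorr : ∀ v, v ∉ A → v ∉ (run P σ prop r).corrupted :=
    fun v hv h => hv (corrupted_mono hle h)
  have hvote : ∀ v ∈ H, Item.headVote
      ((run P σ prop (4 * P.Δ * t + P.Δ)).state v).chain t v ∈ V := fun v hv =>
    mem_view_of_early hΔ hC.synchronous hd (by omega) (Or.inl (sends_headVote hΔ hv).2)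
  -- voters that have since been corrupted are removed from both sides of the sleepiness inequality
  have hcard : ((A ∪ (R \ H)) \ H).card < (H \ A).card := by
    have e₁ := Finset.card_sdiff_add_card_inter (A ∪ (R \ H)) H
    have e₂ := Finset.card_sdiff_add_card_inter H A
    have e₃ : (H ∩ A).card ≤ ((A ∪ (R \ H)) ∩ H).card := by
      refine Finset.card_le_card fun v hv => ?_
      rw [Finset.mem_inter] at hv ⊢
      exact ⟨Finset.mem_union_left _ hv.2, hv.1⟩
    omega
  have hkept : ∀ v ∈ H \ A, Item.headVote
      ((run P σ prop (4 * P.Δ * t + P.Δ)).state v).chain t v ∈ rlmdView η (t + 1) V := by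
    intro v hv
    rw [Finset.mem_sdiff] at hv
    exact headVote_mem_rlmdView.2 ⟨hvote v hv.1,
      not_equivocates hΔ hC.unforgeable (hcorr v hv.2), by omega, by omega,
      fun C s' _ _ h => by omega⟩
  refine prefix_rlmdGhost_of_majority (H \ A) ((A ∪ (R \ H)) \ H) hcard ?_ ?_ ?_
  · intro v hv
    exact ⟨_, t, hX v (Finset.mem_sdiff.1 hv).1, hkept v hv⟩
  · intro v B s hB hXB
    obtain ⟨hBV, hne, hs₁, hs₂, hlate⟩ := headVote_mem_rlmdView.1 hB
    -- a validator of `H` whose latest vote is not for `X` has two votes of slot `t`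
    have hvH : v ∉ H := by
      intro hvH
      have hst : s = t := le_antisymm (by omega) (hlate _ t (hvote v hvH) (by omega) (by omega))
      subst hst
      by_cases hBe : B = ((run P σ prop (4 * P.Δ * s + P.Δ)).state v).chain
      · exact hXB (hBe ▸ hX v hvH)
      · exact hne ⟨s, _, _, hBe, hBV, hvote v hvH⟩
    refine Finset.mem_sdiff.2 ⟨?_, hvH⟩
    by_cases hvA : v ∈ A
    · exact Finset.mem_union_left _ hvA
    · obtain ⟨-, hact, -⟩ := headVote_sent hΔ hC.unforgeable (view_subset_held hBV) (hcorr v hvA)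
      refine Finset.mem_union_right _ (Finset.mem_sdiff.2 ⟨?_, hvH⟩)
      have hst : s ≠ t := by
        rintro rfl
        exact hvH hact
      exact Finset.mem_filter.2 ⟨Finset.mem_univ _, s, hs₁, by omega, hact⟩
  · obtain ⟨v, hv⟩ := Finset.card_pos.1 (by omega : 0 < (H \ A).card)
    rw [Finset.mem_sdiff] at hv
    exact mem_tree_of_headVote hΔ (hvote v hv.1) (hX v hv.1)

/-- A fast confirmed block wins the fork choice of the next slot, since its quorum exceeds the other
validators by more than the number of equivocators. -/
theorem agreed_of_fastQuorum [NeZero n] (hΔ : 1 ≤ P.Δ) (hη : 1 ≤ η)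
    (hC : Compliant P.Δ η 0 (run P σ prop)) {j : Fin n}
    (hj : j ∈ (run P σ prop (4 * P.Δ * t + 2 * P.Δ)).active)
    (hq : FastQuorum ((run P σ prop (4 * P.Δ * t + 2 * P.Δ)).state j).buffer t X) :
    Agreed tb η P σ prop (t + 1) X := by
  intro r i hd
  set V := ((run P σ prop r).state i).view with hV
  set Q := Finset.univ.filter (fun v : Fin n => ∃ B' : Block n Body, X.Prefix B' ∧
    Item.headVote B' t v ∈ ((run P σ prop (4 * P.Δ * t + 2 * P.Δ)).state j).buffer) with hQ
  set Z := Finset.univ.filter (fun v : Fin n => Equivocates {x | x ∈ V} v) with hZ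
  have hq' : 2 * n ≤ 3 * Q.card := hq
  have hZcard : 3 * Z.card < n := by
    refine lt_of_le_of_lt (Nat.mul_le_mul_left 3 (Finset.card_le_card ?_)) hC.fewEquivocators
    intro v hv
    obtain ⟨s, B, C, hne, hB, hC⟩ := (Finset.mem_filter.1 hv).2
    exact Finset.mem_filter.2 ⟨Finset.mem_univ _, s, B, C, hne,
      ⟨r, i, view_subset_held hB⟩, ⟨r, i, view_subset_held hC⟩⟩
  have hvote : ∀ v ∈ Q, ∃ B, X.Prefix B ∧ Item.headVote B t v ∈ V := by
    intro v hv
    obtain ⟨B, hXB, hB⟩ := (Finset.mem_filter.1 hv).2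
    exact ⟨B, hXB, mem_view_of_early hΔ hC.synchronous hd le_rfl
      (Or.inr ⟨awake_of_active hj, buffer_subset_held hB⟩)⟩
  have hS : Q.card ≤ (Q \ Z).card + Z.card := by
    have e₁ := Finset.card_sdiff_add_card_inter Q Z
    have e₂ := Finset.card_le_card (Finset.inter_subset_right (s₁ := Q) (s₂ := Z))
    omega
  have hO : (Finset.univ \ (Q ∪ Z)).card + Q.card ≤ n := by
    have e₁ := Finset.card_sdiff_add_card_eq_card (Finset.subset_univ (Q ∪ Z))
    have e₂ := Finset.card_le_card (Finset.subset_union_left (s₁ := Q) (s₂ := Z))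
    rw [Finset.card_univ, Fintype.card_fin] at e₁
    omega
  refine prefix_rlmdGhost_of_majority (Q \ Z) (Finset.univ \ (Q ∪ Z)) (by omega) ?_ ?_ ?_
  · intro v hv
    rw [Finset.mem_sdiff] at hv
    obtain ⟨B, hXB, hB⟩ := hvote v hv.1
    exact ⟨B, t, hXB, headVote_mem_rlmdView.2 ⟨hB,
      fun h => hv.2 (Finset.mem_filter.2 ⟨Finset.mem_univ _, h⟩), by omega, by omega,
      fun C s' _ _ h => by omega⟩⟩
  · intro v B s hB hXB
    obtain ⟨hBV, hne, hs₁, hs₂, hlate⟩ := headVote_mem_rlmdView.1 hB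
    refine Finset.mem_sdiff.2 ⟨Finset.mem_univ _, fun hv => ?_⟩
    rcases Finset.mem_union.1 hv with hv | hv
    · obtain ⟨B', hXB', hB'⟩ := hvote v hv
      have hst : s = t := le_antisymm (by omega) (hlate _ t hB' (by omega) (by omega))
      subst hst
      by_cases hBe : B = B'
      · exact hXB (hBe ▸ hXB')
      · exact hne ⟨s, _, _, hBe, hBV, hB'⟩
    · exact hne (Finset.mem_filter.1 hv).2
  · have : 0 < n := Nat.pos_of_neZero n
    obtain ⟨v, hv⟩ := Finset.card_pos.1 (by omega : 0 < Q.card)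
    obtain ⟨B, hXB, hB⟩ := hvote v hv
    exact mem_tree_of_headVote hΔ hB hXB

/-! ### Corrupted validators and supermajority links -/

/-- In compliant executions fewer than half of the validators are ever corrupted. -/
theorem corrupted_minority (hΔ : 1 ≤ P.Δ) (hC : Compliant P.Δ η 0 (run P σ prop)) (t : ℕ) :
    2 * (run P σ prop (4 * P.Δ * t + P.Δ)).corrupted.card < n := by
  have hsl := hC.sleepy (t + 1) (by positivity)
  rw [Nat.add_sub_cancel] at hsl
  unfold activeAt corruptedAt at hsl
  have hle : (run P σ prop (4 * P.Δ * t + P.Δ)).corrupted ⊆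
      (run P σ prop (4 * P.Δ * (t + 1) + P.Δ)).corrupted :=
    corrupted_mono (by rw [slot_mul_succ]; omega)
  have h₁ := Finset.card_le_card (hle.trans (Finset.subset_union_left (s₂ := recentlyActive P.Δ η
    (run P σ prop) (t + 1) \ (run P σ prop (4 * P.Δ * t + P.Δ)).active)))
  have hdisj : Disjoint (run P σ prop (4 * P.Δ * t + P.Δ)).corrupted
      (run P σ prop (4 * P.Δ * t + P.Δ)).active :=
    Finset.disjoint_right.2 fun v hv => not_corrupted_of_active hv
  have h₂ := Finset.card_le_univ ((run P σ prop (4 * P.Δ * t + P.Δ)).corrupted ∪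
      (run P σ prop (4 * P.Δ * t + P.Δ)).active)
  rw [Finset.card_union_of_disjoint hdisj, Fintype.card_fin] at h₂
  omega

theorem active_nonempty (hC : Compliant P.Δ η 0 (run P σ prop)) (hΔ : 1 ≤ P.Δ) (t : ℕ) :
    (run P σ prop (4 * P.Δ * t + P.Δ)).active.Nonempty := by
  have hsl := hC.sleepy (t + 1) (by positivity)
  rw [Nat.add_sub_cancel] at hsl
  exact Finset.card_pos.1 (by unfold activeAt at hsl; omega)

/-- One of the votes of a supermajority link is honest. -/
theorem exists_honest_ffgVote [NeZero n] (hΔ : 1 ≤ P.Δ) (hC : Compliant P.Δ η 0 (run P σ prop))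
    (hr : r ≤ 4 * P.Δ * t + P.Δ) {C D : Checkpoint n Body}
    (h : SupermajorityLink ((run P σ prop r).state i).view C D) :
    ∃ v, 4 * P.Δ * D.slot + 2 * P.Δ < r ∧
      v ∈ (run P σ prop (4 * P.Δ * D.slot + 2 * P.Δ)).active ∧
      (D.block = (latestJustified P.tieCheckpoint
          ((run P σ prop (4 * P.Δ * D.slot + 2 * P.Δ)).state v).view).block ∨
        D.block = ((run P σ prop (4 * P.Δ * D.slot + 2 * P.Δ)).state v).available) := by
  have h₁ := h.2.2.2.2
  have h₂ := corrupted_minority hΔ hC t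
  obtain ⟨v, hv, hvc⟩ := Finset.exists_mem_notMem_of_card_lt_card
    (show (run P σ prop (4 * P.Δ * t + P.Δ)).corrupted.card <
      (Finset.univ.filter fun v : Fin n =>
        Item.ffgVote C D v ∈ ((run P σ prop r).state i).view).card by omega)
  exact ⟨v, ffgVote_sent hΔ hC.unforgeable (view_subset_held (Finset.mem_filter.1 hv).2)
    fun h => hvc (corrupted_mono hr h)⟩

/-! ### Honest proposals -/

theorem Message.eq_of_proposal_mem_signed {B : Block n Body} {V : View n Body} {s : ℕ} {v : Fin n}
    {m : Message n Body} (h : Message.proposal B V s v ∈ m.signed) : m = .proposal B V s v := by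
  have key : ∀ A : Block n Body, Message.proposal B V s v ∉ A.signed := by
    rintro A ⟨A', -, -, h⟩
    simp at h
  have key' : ∀ x : Item n Body, Message.proposal B V s v ∉ x.signed := by
    intro x hx
    cases x with
    | block A => exact key _ hx
    | headVote A s v =>
      rcases hx with hx | hx
      · simp at hx
      · exact key _ hx
    | ffgVote C D v =>
      rcases hx with (hx | hx) | hx
      · simp at hx
      · exact key _ hx
      · exact key _ hx
  cases m with
  | item x => exact absurd h (key' x)
  | proposal B' V' s' v' =>
    rcases h with (h | h) | h
    · exact h.symm
    · exact absurd h (key _)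
    · obtain ⟨x, -, hx⟩ := Set.mem_iUnion₂.1 h
      exact absurd hx (key' x)

/-- An honest proposal consists of a fresh valid block on top of the fork choice of the proposer,
and of the view of the proposer. -/
theorem HonestProposal.spec [NeZero n] (hΔ : 1 ≤ P.Δ) (hF : SelectsFromView P)
    (hU : Unforgeable (run P σ prop)) {B : Block n Body}
    (h : HonestProposal P.Δ prop (run P σ prop) t B) :
    B.IsChildOf (P.forkChoice ((run P σ prop (4 * P.Δ * t)).state (prop t)).view t) ∧
    B.Valid prop ∧ B.slot = t ∧ B ≠ .genesis ∧
    (∀ A ∈ tree ((run P σ prop (4 * P.Δ * t)).state (prop t)).view, ¬ B.Prefix A) ∧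
    Message.proposal B (insert (.block B) ((run P σ prop (4 * P.Δ * t)).state (prop t)).view) t
      (prop t) ∈ (run P σ prop (4 * P.Δ * t)).sent (prop t) ∧
    (∀ r W, r < 4 * P.Δ * t + 4 * P.Δ → ∀ B',
      Message.proposal B' W t (prop t) ∈ (run P σ prop r).sent (prop t) →
      B' = B ∧ W = insert (.block B) ((run P σ prop (4 * P.Δ * t)).state (prop t)).view) := by
  obtain ⟨hact, ⟨V, hV⟩, hcor⟩ := h
  have hlt : ∀ A B' : Block n Body,
      Item.block B' ∈ ((run P σ prop (4 * P.Δ * t)).state (prop t)).view → A.Prefix B' →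
      A ≠ .genesis → A.slot < t := fun A B' hB' hA hne =>
    slot_lt_of_held_by_proposer hΔ hF hU (not_corrupted_of_active hact) (view_subset_held hB') hA
      hne
  obtain ⟨-, t', ⟨ht, -, ⟨b, hb⟩, hm⟩ | ⟨-, -, hm⟩ | ⟨-, hm⟩⟩ := sent_cases hΔ hV
  · simp only [Message.proposal.injEq] at hm
    obtain ⟨hB, rfl, rfl, -⟩ := hm
    rw [← hB] at hb hV
    have hval : B.Valid prop := by
      rw [hb]
      rcases hF ((run P σ prop (4 * P.Δ * t)).state (prop t)).view t with h | h
      · rw [h]; exact ⟨trivial, rfl, Or.inl rfl⟩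
      · refine ⟨(valid_of_mem_tree hΔ h).1, rfl, ?_⟩
        obtain ⟨B', hB', hA⟩ := mem_tree.1 h
        by_cases hg : P.forkChoice ((run P σ prop (4 * P.Δ * t)).state (prop t)).view t = .genesis
        · exact Or.inl hg
        · exact Or.inr (hlt _ _ hB' hA hg)
    have hslot : B.slot = t := by rw [hb]; rfl
    have hne : B ≠ .genesis := by rw [hb]; simp
    refine ⟨⟨b, t, prop t, hb⟩, hval, hslot, hne, ?_, hV, ?_⟩
    · intro A hA hBA
      obtain ⟨B', hB', hA⟩ := mem_tree.1 hA
      exact absurd hslot (hlt _ _ hB' (hBA.trans hA) hne).ne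
    · intro r W hr B' hm
      obtain ⟨-, t', ⟨ht, -, -, hm⟩ | ⟨-, -, hm⟩ | ⟨-, hm⟩⟩ := sent_cases hΔ hm
      · simp only [Message.proposal.injEq] at hm
        obtain ⟨hB', hW, rfl, -⟩ := hm
        subst ht
        rw [← hB] at hB' hW
        exact ⟨hB', hW⟩
      · simp at hm
      · simp at hm
  · simp at hm
  · simp at hm

/-- View-merge: at the voting round, the view of every voter is the one proposed by the honest
proposer. -/
theorem view_eq_of_honestProposal [NeZero n] (hΔ : 1 ≤ P.Δ) (hF : SelectsFromView P)
    (hU : Unforgeable (run P σ prop)) (hS : Synchronous P.Δ 0 (run P σ prop)) {B : Block n Body}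
    (h : HonestProposal P.Δ prop (run P σ prop) t B)
    (hi : i ∈ (run P σ prop (4 * P.Δ * t + P.Δ)).active) :
    ((run P σ prop (4 * P.Δ * t + P.Δ)).state i).view =
      insert (.block B) ((run P σ prop (4 * P.Δ * t)).state (prop t)).view := by
  obtain ⟨-, hval, hslot, -, -, hsent, huniq⟩ := h.spec hΔ hF hU
  obtain ⟨hact, -, hcor⟩ := h
  have hp := view_eq_held_of_proposer hΔ hact
  have hgen := genesis_mem_view (P := P) (σ := σ) (prop := prop) (r := 4 * P.Δ * t)
    (i := prop t) hΔ
  have hclosed := (parts_subset (P := P) (σ := σ) (prop := prop) (r := 4 * P.Δ * t)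
    (i := prop t) hΔ).1
  have hacc : ∀ x ∈ ((run P σ prop (4 * P.Δ * t)).state (prop t)).view, x.Acceptable prop t := by
    intro x hx
    have := held_acceptable hΔ (view_subset_held hx)
    rwa [show 4 * P.Δ * t / (4 * P.Δ) = t from round_div (d := 0) (by omega)] at this
  set V := ((run P σ prop (4 * P.Δ * t)).state (prop t)).view with hV
  have hactive : ∀ q, 4 * P.Δ * t ≤ q → q ≤ 4 * P.Δ * t + P.Δ → i ∈ (run P σ prop q).active :=
    fun q h₁ h₂ => active_of_le_of_slot (t := t) hi h₂ h₁ (by omega)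
  -- what `i` receives from proposals of the slot is part of the honest proposal
  have hrec : ∀ q, 4 * P.Δ * t ≤ q → q ≤ 4 * P.Δ * t + P.Δ →
      ∀ m ∈ (run P σ prop q).delivered i, toView P.Δ prop q m ⊆ insert (.block B) V := by
    intro q h₁ h₂ m hm x hx
    cases m with
    | item y => simp [toView] at hx
    | proposal B' W s v =>
      unfold toView at hx
      dsimp only at hx
      split_ifs at hx with hc
      · have hst : s = t :=
          slot_unique (Δ := P.Δ) (r := q) hc.2.1 (by omega) (by omega) (by omega)
        subst hst
        have hv : v = prop s := hc.1.1
        subst hv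
        obtain ⟨r', hr', m', hm', hc'⟩ := (hU q i _ hm _ (Or.inl (Or.inl rfl)) (prop s)
          rfl).resolve_left fun h => hcor (corrupted_mono h₂ h)
        rw [Message.eq_of_proposal_mem_signed hc'] at hm'
        obtain ⟨-, rfl⟩ := huniq r' W (by omega) B' hm'
        obtain ⟨y, hy, hxy⟩ := Finset.mem_biUnion.1 hx
        rcases Finset.mem_insert.1 (Finset.mem_filter.1 hy).1 with rfl | hy
        · simp only [Item.parts, Finset.mem_singleton] at hxy
          rw [hxy]; exact Finset.mem_insert_self _ _
        · exact Finset.mem_insert_of_mem (hclosed y hy hxy)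
      · simp at hx
  -- before the slot, `i` has nothing in its view that the proposer does not hold
  have hbefore : ((before P σ prop (4 * P.Δ * t)).state i).view ⊆ V := by
    cases t with
    | zero =>
      intro x hx
      have : x = .block .genesis := by simpa [before_zero, initialConfig] using hx
      rw [this]; exact hgen
    | succ u =>
      intro x hx
      have hs := slot_mul_succ P.Δ u
      rw [show 4 * P.Δ * (u + 1) = 4 * P.Δ * u + 3 * P.Δ + (P.Δ - 1) + 1 by omega, before_succ,
        view_after_merge (by omega)] at hx
      rw [hp]
      refine hS.1 (4 * P.Δ * u + 3 * P.Δ) i x (Or.inr ⟨?_, view_subset_held hx⟩) _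
        (by simp; omega) _ (awake_of_active hact)
      exact awake_of_active (active_at_merge (t := u) hi (by omega) (by omega))
  have hstep : ∀ q, 4 * P.Δ * t ≤ q → q ≤ 4 * P.Δ * t + P.Δ →
      ((before P σ prop q).state i).view ⊆ insert (.block B) V →
      (q = 4 * P.Δ * t → i ≠ prop t) →
      ((run P σ prop q).state i).view ⊆ insert (.block B) V := by
    intro q h₁ h₂ hb hne
    rw [state_view_eq_received (t := t) (d := q - 4 * P.Δ * t) (by omega) (by omega)
      fun h => hne (by omega)]
    intro x hx
    rcases mem_received_view hx with h | ⟨-, m, hm, h⟩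
    · exact hb h
    · exact hrec q h₁ h₂ m hm h
  have hsub : ∀ e ≤ P.Δ,
      ((run P σ prop (4 * P.Δ * t + e)).state i).view ⊆ insert (.block B) V := by
    intro e he
    induction e with
    | zero =>
      by_cases hip : i = prop t
      · rw [hip]; exact Finset.subset_insert _ _
      · exact hstep _ le_rfl (by omega) (hbefore.trans (Finset.subset_insert _ _)) fun _ => hip
    | succ e ih =>
      refine hstep _ (by omega) (by omega) ?_ fun h => by omega
      rw [← Nat.add_assoc, before_succ]
      exact ih (by omega)
  refine Finset.Subset.antisymm (hsub _ le_rfl) ?_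
  obtain ⟨q, hq, hq', hdel⟩ := hS.2 (4 * P.Δ * t) (prop t) B _ t (prop t) (Or.inl hsent)
    (4 * P.Δ * t + P.Δ) (by simp) i (awake_of_active hi)
  have hq₀ := hactive q hq' hq
  have hqb : i ∈ (before P σ prop q).active :=
    active_before hq₀ (ne_merge_round_of_lt (t := t) hq' (by omega))
  refine Finset.Subset.trans ?_ (((toView_subset_received hdel hqb).trans
    (received_view_subset hΔ)).trans (view_mono hΔ hq))
  have hdiv : q / (4 * P.Δ) = t := by
    obtain ⟨d, rfl⟩ := Nat.exists_eq_add_of_le hq'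
    exact round_div (by omega)
  have hBacc : (Item.block B).Acceptable prop t := ⟨hval, hslot.le⟩
  intro x hx
  unfold toView
  dsimp only
  rw [hdiv, if_pos ⟨⟨rfl, le_rfl, hBacc⟩, hq', hq⟩]
  refine Finset.mem_biUnion.2 ⟨x, Finset.mem_filter.2 ⟨hx, ?_⟩, x.self_mem_parts⟩
  rcases Finset.mem_insert.1 hx with rfl | hx
  · exact hBacc
  · exact hacc x hx

/-- If the fork choice of a slot is that of RLMD-GHOST, then all its voters vote for an honest
proposal of the slot. -/
theorem supported_of_honestProposal [NeZero n] (hΔ : 1 ≤ P.Δ) (hF : SelectsFromView P)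
    (hC : Compliant P.Δ η 0 (run P σ prop)) (hfol : FollowsRlmd tb η P σ prop t)
    {B : Block n Body} (h : HonestProposal P.Δ prop (run P σ prop) t B) :
    Supported P σ prop t B := by
  intro i hi
  obtain ⟨hchild, -, -, -, hfresh, -, -⟩ := h.spec hΔ hF hC.unforgeable
  rw [hfol _ _ ⟨h.1, Or.inl ⟨rfl, rfl⟩⟩] at hchild
  rw [(sends_headVote hΔ hi).1, hfol _ _ ⟨hi, Or.inr rfl⟩,
    view_eq_of_honestProposal hΔ hF hC.unforgeable hC.synchronous h hi,
    rlmdGhost_insert_child hchild (genesis_mem_view hΔ) hfresh]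
  exact Prefix.refl _

end Decisions

/-! ### Agreement of the two fork choices -/

/-- Every window of `κ` consecutive slots before slot `N` contains an honest proposal. -/
def Pivots (P : Protocol n Body) (σ : Adversary n Body) (prop : ℕ → Fin n) (N : ℕ) : Prop :=
  ∀ a, a + P.κ ≤ N → ∃ q B, a ≤ q ∧ q < a + P.κ ∧ HonestProposal P.Δ prop (run P σ prop) q B

section Agreement

variable {P : Protocol n Body} {σ : Adversary n Body} {prop : ℕ → Fin n} {r s t η N : ℕ}
  {i : Fin n} {X Y : Block n Body} {tb : TieBreak (Block n Body)}

theorem Agreed.of_prefix (h : Agreed tb η P σ prop t Y) (hXY : X.Prefix Y) :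
    Agreed tb η P σ prop t X := fun r i hd => hXY.trans (h r i hd)

theorem agreed_genesis : Agreed tb η P σ prop t .genesis := fun _ _ _ => genesis_prefix _

theorem supported_of_agreed (hΔ : 1 ≤ P.Δ) (hfol : FollowsRlmd tb η P σ prop t)
    (h : Agreed tb η P σ prop t X) : Supported P σ prop t X := by
  intro i hi
  rw [(sends_headVote hΔ hi).1, hfol _ _ ⟨hi, Or.inr rfl⟩]
  exact h _ _ ⟨hi, Or.inr rfl⟩

theorem Supported.mono (hΔ : 1 ≤ P.Δ) (hη : 1 ≤ η) (hC : Compliant P.Δ η 0 (run P σ prop))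
    (hfol : ∀ u ≤ t, FollowsRlmd tb η P σ prop u) (h : Supported P σ prop s X) (hst : s ≤ t) :
    Supported P σ prop t X := by
  induction hst with
  | refl => exact h
  | @step m _ ih =>
    exact supported_of_agreed hΔ (hfol _ le_rfl) (agreed_of_supported hΔ hη hC
      (ih fun u hu => hfol u (by omega)))

theorem Agreed.mono (hΔ : 1 ≤ P.Δ) (hη : 1 ≤ η) (hC : Compliant P.Δ η 0 (run P σ prop))
    (hfol : ∀ u < t, FollowsRlmd tb η P σ prop u) (h : Agreed tb η P σ prop s X) (hst : s ≤ t) :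
    Agreed tb η P σ prop t X := by
  rcases hst.eq_or_lt with rfl | hst
  · exact h
  · obtain ⟨u, rfl⟩ := Nat.exists_eq_add_one.2 (Nat.zero_lt_of_lt hst)
    exact agreed_of_supported hΔ hη hC ((supported_of_agreed hΔ (hfol s hst) h).mono hΔ hη hC
      (fun v hv => hfol v (by omega)) (by omega))

theorem chain_at_confirmation :
    ((run P σ prop (4 * P.Δ * t + 2 * P.Δ)).state i).chain =
      ((run P σ prop (4 * P.Δ * t + P.Δ)).state i).chain := by
  have key : ∀ e ≤ P.Δ, ((run P σ prop (4 * P.Δ * t + P.Δ + e)).state i).chain =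
      ((run P σ prop (4 * P.Δ * t + P.Δ)).state i).chain := by
    intro e he
    induction e with
    | zero => rfl
    | succ e ih =>
      rw [← ih (by omega)]
      rcases chain_cases (P := P) (σ := σ) (prop := prop) (i := i) t (P.Δ + (e + 1))
        (r := 4 * P.Δ * t + P.Δ + (e + 1)) (by omega) (by omega) with ⟨h, -⟩ | ⟨-, h, -⟩ | ⟨-, h, -⟩
      · exact h
      · omega
      · omega
  have := key P.Δ le_rfl
  rwa [show 4 * P.Δ * t + P.Δ + P.Δ = 4 * P.Δ * t + 2 * P.Δ by omega] at this

/-- The available chain of a validator was set in the latest confirmation round that changed it. -/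
theorem available_origin (hΔ : 1 ≤ P.Δ) (r : ℕ) (i : Fin n) :
    ((run P σ prop r).state i).available = .genesis ∨
    ∃ s, 4 * P.Δ * s + 2 * P.Δ ≤ r ∧ i ∈ (run P σ prop (4 * P.Δ * s + 2 * P.Δ)).active ∧
      (((run P σ prop r).state i).available =
          fastBlock ((run P σ prop (4 * P.Δ * s + 2 * P.Δ)).state i) s ∨
        ((run P σ prop r).state i).available =
          ((run P σ prop (4 * P.Δ * s + 2 * P.Δ)).state i).chain.deepPrefix P.κ s) := by
  have step : ∀ r, ((run P σ prop r).state i).available =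
        ((before P σ prop r).state i).available ∨
      ∃ s, 4 * P.Δ * s + 2 * P.Δ ≤ r ∧ i ∈ (run P σ prop (4 * P.Δ * s + 2 * P.Δ)).active ∧
        (((run P σ prop r).state i).available =
            fastBlock ((run P σ prop (4 * P.Δ * s + 2 * P.Δ)).state i) s ∨
          ((run P σ prop r).state i).available =
            ((run P σ prop (4 * P.Δ * s + 2 * P.Δ)).state i).chain.deepPrefix P.κ s) := by
    intro r
    have hr := (Nat.div_add_mod r (4 * P.Δ)).symm
    rcases available_cases (σ := σ) (prop := prop) (i := i) _ _ hr (Nat.mod_lt _ (by omega)) with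
      ⟨h, -⟩ | ⟨hi, hd, h⟩
    · exact Or.inl h
    · rcases updatedAvailable_cases P.κ (r / (4 * P.Δ)) { (run P σ prop r).state i with
          available := ((before P σ prop r).state i).available } with h' | h'
      · exact Or.inl (h.trans h')
      · refine Or.inr ⟨r / (4 * P.Δ), by omega, ?_⟩
        rw [show 4 * P.Δ * (r / (4 * P.Δ)) + 2 * P.Δ = r by omega, h]
        exact ⟨hi, h'⟩
  induction r with
  | zero =>
    rcases step 0 with h | h
    · exact Or.inl h
    · exact Or.inr h
  | succ r ih =>
    rcases step (r + 1) with h | h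
    · rw [before_succ] at h
      rw [h]
      rcases ih with h | ⟨s, hs, h⟩
      · exact Or.inl h
      · exact Or.inr ⟨s, by omega, h⟩
    · exact Or.inr h

/-- A block that a validator confirms wins the fork choice of the next slot: if it is fast
confirmed, because of its quorum, and if it is `κ`-deep, because it precedes an honest proposal.
-/
theorem agreed_of_confirmed [NeZero n] (hΔ : 1 ≤ P.Δ) (hη : 1 ≤ η) (hF : SelectsFromView P)
    (hC : Compliant P.Δ η 0 (run P σ prop)) (hfol : ∀ u ≤ s, FollowsRlmd tb η P σ prop u)
    (hpiv : Pivots P σ prop N) (hs : s < N)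
    (hi : i ∈ (run P σ prop (4 * P.Δ * s + 2 * P.Δ)).active)
    (hX : X = fastBlock ((run P σ prop (4 * P.Δ * s + 2 * P.Δ)).state i) s ∨
      X = ((run P σ prop (4 * P.Δ * s + 2 * P.Δ)).state i).chain.deepPrefix P.κ s) :
    Agreed tb η P σ prop (s + 1) X := by
  have hi' : i ∈ (run P σ prop (4 * P.Δ * s + P.Δ)).active :=
    active_of_le_of_slot (t := s) hi (by omega) (by omega) (by omega)
  rcases hX with rfl | rfl
  · rcases highest_spec (FastQuorum ((run P σ prop (4 * P.Δ * s + 2 * P.Δ)).state i).buffer s)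
      ((run P σ prop (4 * P.Δ * s + 2 * P.Δ)).state i).chain with h | h
    · unfold fastBlock
      rw [h]; exact agreed_genesis
    · exact agreed_of_fastQuorum hΔ hη hC hi h
  · rw [chain_at_confirmation]
    rcases highest_spec (fun A : Block n Body => A.slot + P.κ ≤ s)
      ((run P σ prop (4 * P.Δ * s + P.Δ)).state i).chain with h | h
    · unfold deepPrefix
      rw [h]; exact agreed_genesis
    · set D := ((run P σ prop (4 * P.Δ * s + P.Δ)).state i).chain.deepPrefix P.κ s with hD
      have hDslot : D.slot + P.κ ≤ s := h
      have hDchain : D.Prefix ((run P σ prop (4 * P.Δ * s + P.Δ)).state i).chain :=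
        highest_prefix _ _
      obtain ⟨q, B, hq₁, hq₂, hB⟩ := hpiv (s + 1 - P.κ) (by omega)
      obtain ⟨-, hval, hslot, -⟩ := hB.spec hΔ hF hC.unforgeable
      have hsup := (supported_of_honestProposal hΔ hF hC (hfol q (by omega)) hB).mono hΔ hη hC hfol
        (show q ≤ s by omega)
      refine (agreed_of_supported hΔ hη hC hsup).of_prefix ?_
      rcases prefix_total hDchain (hsup i hi') with h | h
      · exact h
      · have hDval : D.Valid prop := by
          have hch := (sends_headVote hΔ hi').1
          rcases hF ((run P σ prop (4 * P.Δ * s + P.Δ)).state i).view s with h' | h'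
          · rw [hch, h', prefix_genesis_iff] at hDchain
            rw [hDchain]; trivial
          · rw [hch] at hDchain
            exact (valid_of_mem_tree hΔ h').1.of_prefix hDchain
        have := hDval.slot_le h
        omega

/-- In a compliant execution with the justification-respecting fork choice in which honest
proposals are frequent, every justified block of a view on which a fork-choice decision is based
is a prefix of the block that RLMD-GHOST selects. Hence both fork choices make the same decision.
-/
theorem followsRlmd_of_pivots [NeZero n] (hΔ : 1 ≤ P.Δ) (hη : 1 ≤ η)
    (hP : P.forkChoice = hfc tb P.tieCheckpoint η)
    (hC : Compliant P.Δ η 0 (run P σ prop)) (hpiv : Pivots P σ prop N) (ht : t ≤ N) :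
    FollowsRlmd tb η P σ prop t := by
  have hF : SelectsFromView P := fun V t => by rw [hP]; exact hfc_mem_tree _ _ _ _ _
  induction t using Nat.strong_induction_on with
  | _ t ih =>
  have hfol : ∀ u < t, FollowsRlmd tb η P σ prop u := fun u hu => ih u hu (by omega)
  -- the targets of honest FFG votes from earlier slots win the fork choice
  have key : ∀ s < t, ∀ v ∈ (run P σ prop (4 * P.Δ * s + 2 * P.Δ)).active,
      Agreed tb η P σ prop t (latestJustified P.tieCheckpoint
          ((run P σ prop (4 * P.Δ * s + 2 * P.Δ)).state v).view).block ∧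
      Agreed tb η P σ prop t ((run P σ prop (4 * P.Δ * s + 2 * P.Δ)).state v).available := by
    intro s hs
    induction s using Nat.strong_induction_on with
    | _ s ihs =>
    intro v hv
    constructor
    · rw [view_at_confirmation]
      rcases justified_mem (latestJustified_justified P.tieCheckpoint
        ((run P σ prop (4 * P.Δ * s + P.Δ)).state v).view) with h | ⟨C, -, h⟩
      · rw [h]; exact agreed_genesis
      · obtain ⟨w, hw, hact, h'⟩ := exists_honest_ffgVote hΔ hC le_rfl h
        have hlt : (latestJustified P.tieCheckpoint
            ((run P σ prop (4 * P.Δ * s + P.Δ)).state v).view).slot < s := by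
          by_contra hge
          have := Nat.mul_le_mul_left (4 * P.Δ) (not_lt.1 hge)
          omega
        have := ihs _ hlt (hlt.trans hs) w hact
        rcases h' with h' | h'
        · rw [h']; exact this.1
        · rw [h']; exact this.2
    · rcases available_origin (P := P) (σ := σ) (prop := prop) hΔ (4 * P.Δ * s + 2 * P.Δ) v with
        h | ⟨s', hs', hact, h⟩
      · rw [h]; exact agreed_genesis
      · have hle : s' ≤ s := slot_le_of_round_le (Δ := P.Δ) (r := 4 * P.Δ * s + 2 * P.Δ)
          (by omega) (by omega)
        exact (agreed_of_confirmed hΔ hη hF hC (fun u hu => hfol u (by omega)) hpiv (by omega)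
          hact h).mono hΔ hη hC hfol (by omega)
  intro r i hd
  rw [hP]
  apply hfc_eq_rlmdGhost
  rcases justified_mem (latestJustified_justified P.tieCheckpoint
    ((run P σ prop r).state i).view) with h | ⟨C, -, h⟩
  · rw [h]; exact genesis_prefix _
  · have hle := hd.le
    obtain ⟨w, hw, hact, h'⟩ := exists_honest_ffgVote hΔ hC hle h
    have hlt : (latestJustified P.tieCheckpoint ((run P σ prop r).state i).view).slot < t := by
      by_contra hge
      have := Nat.mul_le_mul_left (4 * P.Δ) (not_lt.1 hge)
      omega
    have := key _ hlt w hact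
    rcases h' with h' | h'
    · rw [h']; exact this.1 r i hd
    · rw [h']; exact this.2 r i hd

/-! ### Properties of executions that follow RLMD-GHOST -/

/-- The canonical chain of a validator that voted in the latest voting round is its head vote, or
the block that it has proposed since. -/
theorem canonicalFrom_of_supported {T : ℕ} (hΔ : 1 ≤ P.Δ) (hη : 1 ≤ η)
    (hC : Compliant P.Δ η 0 (run P σ prop)) (hfol : ∀ u ≤ T + 1, FollowsRlmd tb η P σ prop u)
    (hX : Supported P σ prop t X) :
    CanonicalFrom P.Δ T (run P σ prop) (4 * P.Δ * t + P.Δ) X := by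
  rintro r hr hrT i ⟨-, s, hs₁, hs₂, hi⟩
  rw [slot_mul_succ] at hs₂
  have hts : t ≤ s := by
    by_contra h
    have := round_le_of_slot_lt P.Δ (not_le.1 h)
    omega
  have hsT : s ≤ T := by
    have := Nat.le_mul_of_pos_left s (show 0 < 4 * P.Δ by omega)
    omega
  have hsup := hX.mono hΔ hη hC (fun u hu => hfol u (by omega)) hts
  have hagr := agreed_of_supported (tb := tb) hΔ hη hC hsup
  have key : ∀ e < 4 * P.Δ,
      X.Prefix ((run P σ prop (4 * P.Δ * s + P.Δ + e)).state i).chain := by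
    intro e he
    induction e with
    | zero => exact hsup i hi
    | succ e ih =>
      have ih := ih (by omega)
      rcases Nat.lt_or_ge (P.Δ + (e + 1)) (4 * P.Δ) with hlt | hge
      · rcases chain_cases (P := P) (σ := σ) (prop := prop) (i := i) s (P.Δ + (e + 1))
          (r := 4 * P.Δ * s + P.Δ + (e + 1)) (by omega) hlt with ⟨h, -⟩ | ⟨-, h, -⟩ | ⟨-, h, -⟩
        · rw [h]; exact ih
        · omega
        · omega
      · have hsl := slot_mul_succ P.Δ s
        rcases chain_cases (P := P) (σ := σ) (prop := prop) (i := i) (s + 1)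
          (P.Δ + (e + 1) - 4 * P.Δ) (r := 4 * P.Δ * s + P.Δ + (e + 1)) (by omega) (by omega) with
          ⟨h, -⟩ | ⟨hact, h₀, hp, b, h⟩ | ⟨-, h, -⟩
        · rw [h]; exact ih
        · have hd : Decides P σ prop (s + 1) (4 * P.Δ * s + P.Δ + (e + 1)) i :=
            ⟨hact, Or.inl ⟨by omega, hp⟩⟩
          rw [h, hfol (s + 1) (by omega) _ _ hd]
          exact prefix_mk_iff.2 (Or.inr (hagr _ _ hd))
        · omega
  have := key (r - (4 * P.Δ * s + P.Δ)) (by omega)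
  rwa [show 4 * P.Δ * s + P.Δ + (r - (4 * P.Δ * s + P.Δ)) = r by omega] at this

theorem reorgResilient_of_followsRlmd [NeZero n] {T : ℕ} (hΔ : 1 ≤ P.Δ) (hη : 1 ≤ η)
    (hF : SelectsFromView P) (hC : Compliant P.Δ η 0 (run P σ prop))
    (hfol : ∀ u ≤ T + 1, FollowsRlmd tb η P σ prop u) :
    ReorgResilient P.Δ T prop (run P σ prop) := by
  intro t B hB r hr hrT
  have := Nat.le_mul_of_pos_left t (show 0 < 4 * P.Δ by omega)
  exact canonicalFrom_of_supported hΔ hη hC hfol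
    (supported_of_honestProposal hΔ hF hC (hfol t (by omega)) hB) r hr hrT

theorem fastReorgResilient_of_followsRlmd [NeZero n] {T : ℕ} (hΔ : 1 ≤ P.Δ) (hη : 1 ≤ η)
    (hC : Compliant P.Δ η 0 (run P σ prop))
    (hfol : ∀ u ≤ T + 1, FollowsRlmd tb η P σ prop u) :
    FastReorgResilient P.Δ T (run P σ prop) := by
  rintro t i B ht ⟨hi, -, hq⟩
  have := Nat.le_mul_of_pos_left t (show 0 < 4 * P.Δ by omega)
  exact canonicalFrom_of_supported hΔ hη hC hfol (supported_of_agreed hΔ (hfol (t + 1) (by omega))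
    (agreed_of_fastQuorum hΔ hη hC hi hq))

theorem fastLive_of_followsRlmd [NeZero n] {T : ℕ} (hΔ : 1 ≤ P.Δ)
    (hF : SelectsFromView P) (hC : Compliant P.Δ η 0 (run P σ prop))
    (hfol : ∀ u ≤ T + 1, FollowsRlmd tb η P σ prop u) :
    FastLive P.Δ T prop (run P σ prop) := by
  intro t B ht hB hcard i hi
  have := Nat.le_mul_of_pos_left t (show 0 < 4 * P.Δ by omega)
  have hsup := supported_of_honestProposal hΔ hF hC (hfol t (by omega)) hB
  have hi' : i ∈ (run P σ prop (4 * P.Δ * t + P.Δ)).active :=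
    active_of_le_of_slot (t := t) hi (by omega) (by omega) (by omega)
  refine ⟨hi, ?_, hcard.trans (Nat.mul_le_mul_left 3 (Finset.card_le_card fun v hv => ?_))⟩
  · rw [chain_at_confirmation]; exact hsup i hi'
  · have hheld := hC.synchronous.1 _ v _ (Or.inl (sends_headVote hΔ hv).2)
      (4 * P.Δ * t + 2 * P.Δ) (by simp; omega) i (awake_of_active hi)
    refine Finset.mem_filter.2 ⟨Finset.mem_univ _, _, hsup v hv, ?_⟩
    rcases Finset.mem_union.1 hheld with h | h
    -- the vote cannot be in the view, which does not change after the round in which it was sent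
    · rw [view_at_confirmation] at h
      have := (headVote_sent hΔ hC.unforgeable (view_subset_held h)
        (not_corrupted_of_active hv)).1
      omega
    · exact h

/-- All available chains up to the horizon are prefixes of what a single voter selects after the
horizon. -/
theorem safe_of_followsRlmd [NeZero n] {T : ℕ} (hΔ : 1 ≤ P.Δ) (hη : 1 ≤ η)
    (hF : SelectsFromView P) (hC : Compliant P.Δ η 0 (run P σ prop))
    (hfol : ∀ u ≤ T + 1, FollowsRlmd tb η P σ prop u) (hpiv : Pivots P σ prop (T + 1)) :
    Safe T (run P σ prop) := by
  have hconf : ∀ r ≤ T, ∀ i, Agreed tb η P σ prop (T + 1) ((run P σ prop r).state i).available := by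
    intro r hr i
    rcases available_origin (P := P) (σ := σ) (prop := prop) hΔ r i with h | ⟨s, hs, hact, h⟩
    · rw [h]; exact agreed_genesis
    · have := Nat.le_mul_of_pos_left s (show 0 < 4 * P.Δ by omega)
      exact (agreed_of_confirmed hΔ hη hF hC (fun u hu => hfol u (by omega)) hpiv (by omega)
        hact h).mono hΔ hη hC (fun u hu => hfol u (by omega)) (by omega)
  intro r hr r' hr' i _ j _
  obtain ⟨v, hv⟩ := active_nonempty hC hΔ (T + 1)
  exact prefix_total (hconf r hr i _ v ⟨hv, Or.inr rfl⟩) (hconf r' hr' j _ v ⟨hv, Or.inr rfl⟩)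

theorem deepPrefix_prefix_updatedAvailable (κ t : ℕ) (L : LocalState n Body) :
    (L.chain.deepPrefix κ t).Prefix (updatedAvailable κ t L) := by
  unfold updatedAvailable
  split_ifs with h₁ h₂
  · exact h₁.2
  · exact prefix_of_height_le (highest_prefix _ _) (highest_prefix _ _) h₂.le
  · exact Prefix.refl _

/-- A confirmation round of slot `s` confirms the pivot from the window `(s - 2κ, s - κ]`. The
confirmation time is that of `2κ` slots, and of two more slots for rounding. -/
theorem live_of_followsRlmd [NeZero n] {T : ℕ} (hΔ : 1 ≤ P.Δ) (hη : 1 ≤ η)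
    (hF : SelectsFromView P) (hC : Compliant P.Δ η 0 (run P σ prop))
    (hfol : ∀ u ≤ T + 1, FollowsRlmd tb η P σ prop u) (hpiv : Pivots P σ prop (T + 1)) :
    Live P.Δ (8 * P.Δ * P.κ + 8 * P.Δ) T prop (run P σ prop) := by
  rintro r r' hrr' hT i ⟨-, s, hs₁, hs₂, hi⟩
  rw [slot_mul_succ] at hs₂
  have hκs : 2 * P.κ ≤ s := by
    refine slot_le_of_round_le (Δ := P.Δ) (r := 4 * P.Δ * s) ?_ (by omega)
    have : 4 * P.Δ * (2 * P.κ) = 8 * P.Δ * P.κ := by ring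
    omega
  obtain ⟨u, rfl⟩ := Nat.exists_eq_add_of_le hκs
  have hsT := Nat.le_mul_of_pos_left (2 * P.κ + u) (show 0 < 4 * P.Δ by omega)
  obtain ⟨q, B, hq₁, hq₂, hB⟩ := hpiv (u + 1) (by omega)
  obtain ⟨-, hval, hslot, -⟩ := hB.spec hΔ hF hC.unforgeable
  refine ⟨q, B, ?_, hB, ?_⟩
  · have h₁ := Nat.mul_le_mul_left (4 * P.Δ) hq₁
    have h₂ : 4 * P.Δ * (2 * P.κ + u) = 8 * P.Δ * P.κ + 4 * P.Δ * u := by ring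
    rw [slot_mul_succ] at h₁
    omega
  · have hsup := (supported_of_honestProposal hΔ hF hC (hfol q (by omega)) hB).mono hΔ hη hC
      (t := 2 * P.κ + u) (fun v hv => hfol v (by omega)) (by omega)
    have hqs : B.slot + P.κ ≤ 2 * P.κ + u := by omega
    generalize 2 * P.κ + u = s at *
    have hi' : i ∈ (run P σ prop (4 * P.Δ * s + P.Δ)).active :=
      active_of_le_of_slot (t := s) hi (by omega) (by omega) (by omega)
    have hdeep : B.Prefix
        (((run P σ prop (4 * P.Δ * s + 2 * P.Δ)).state i).chain.deepPrefix P.κ s) := by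
      rw [chain_at_confirmation]
      exact prefix_highest (hsup i hi') hqs
    have key : ∀ e < 4 * P.Δ,
        B.Prefix ((run P σ prop (4 * P.Δ * s + 2 * P.Δ + e)).state i).available := by
      intro e he
      induction e with
      | zero =>
        rcases available_cases (P := P) (σ := σ) (prop := prop) (i := i) s (2 * P.Δ)
          (r := 4 * P.Δ * s + 2 * P.Δ) rfl (by omega) with ⟨-, h⟩ | ⟨-, -, h⟩
        · exact absurd rfl (h hi)
        · rw [Nat.add_zero, h]
          exact hdeep.trans (deepPrefix_prefix_updatedAvailable _ _ _)
      | succ e ih =>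
        have hsl := slot_mul_succ P.Δ s
        have : ((run P σ prop (4 * P.Δ * s + 2 * P.Δ + (e + 1))).state i).available =
            ((run P σ prop (4 * P.Δ * s + 2 * P.Δ + e)).state i).available := by
          rcases Nat.lt_or_ge (2 * P.Δ + (e + 1)) (4 * P.Δ) with hlt | hge
          · rcases available_cases (P := P) (σ := σ) (prop := prop) (i := i) s (2 * P.Δ + (e + 1))
              (r := 4 * P.Δ * s + 2 * P.Δ + (e + 1)) (by omega) hlt with ⟨h, -⟩ | ⟨-, h, -⟩
            · exact h
            · omega
          · rcases available_cases (P := P) (σ := σ) (prop := prop) (i := i) (s + 1)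
              (2 * P.Δ + (e + 1) - 4 * P.Δ) (r := 4 * P.Δ * s + 2 * P.Δ + (e + 1)) (by omega)
              (by omega) with ⟨h, -⟩ | ⟨-, h, -⟩
            · exact h
            · omega
        rw [this]
        exact ih (by omega)
    have := key (r' - (4 * P.Δ * s + 2 * P.Δ)) (by omega)
    rwa [show 4 * P.Δ * s + 2 * P.Δ + (r' - (4 * P.Δ * s + 2 * P.Δ)) = r' by omega] at this

/-- Two protocols that differ only in their fork choices have the same executions, as long as the
fork choices agree on the views on which they are evaluated. -/
theorem history_eq_of_followsRlmd {T : ℕ} (hΔ : 1 ≤ P.Δ)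
    (hfol : ∀ u ≤ T + 1, FollowsRlmd tb η P σ prop u) (hr : r ≤ T + 1) :
    history { P with forkChoice := rlmdGhost tb η } σ prop r = history P σ prop r := by
  induction r with
  | zero => rfl
  | succ r ih =>
    have ih := ih (by omega)
    have hdiv : r / (4 * P.Δ) ≤ T + 1 := (Nat.div_le_self _ _).trans (by omega)
    have hact : ∀ i, i ∈ (run P σ prop r).active →
        act { P with forkChoice := rlmdGhost tb η } prop r (σ.body (history P σ prop r) i) i
          (received P σ prop r i) =
        act P prop r (σ.body (history P σ prop r) i) i (received P σ prop r i) := by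
      intro i hi
      have hmod := (Nat.div_add_mod r (4 * P.Δ)).symm
      have hcases := run_cases (σ := σ) (prop := prop) (i := i) _ _ hmod (Nat.mod_lt _ (by omega))
      unfold act
      dsimp only
      by_cases h₀ : r = 4 * P.Δ * (r / (4 * P.Δ))
      · rw [if_pos h₀, if_pos h₀]
        by_cases hp : i = prop (r / (4 * P.Δ))
        · have hfol := hfol _ hdiv r i ⟨hi, Or.inl ⟨h₀, hp⟩⟩
          have hview : ((run P σ prop r).state i).view = (merge (received P σ prop r i)).view := by
            rcases hcases with ⟨-, -, h⟩ | ⟨-, -, -, b, h, -⟩ | ⟨-, h, -⟩ | ⟨-, h, -⟩ | ⟨-, h, -⟩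
            · exact absurd hp ((h hi).1 (by omega))
            · rw [h]; rfl
            · omega
            · omega
            · omega
          rw [hview] at hfol
          rw [if_pos hp, if_pos hp, hfol]
        · rw [if_neg hp, if_neg hp]
      · rw [if_neg h₀, if_neg h₀]
        by_cases h₁ : r = 4 * P.Δ * (r / (4 * P.Δ)) + P.Δ
        · have hfol := hfol _ hdiv r i ⟨hi, Or.inr h₁⟩
          have hview : ((run P σ prop r).state i).view = (received P σ prop r i).view :=
            state_view_eq_received hmod (by omega) fun h => by omega
          rw [hview] at hfol
          rw [if_pos h₁, if_pos h₁, hfol]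
        · rw [if_neg h₁, if_neg h₁]
    have hnext : nextConfig { P with forkChoice := rlmdGhost tb η } σ prop r (history P σ prop r) =
        nextConfig P σ prop r (history P σ prop r) := by
      have hacted : (fun i => if i ∈ (run P σ prop r).active then
            act { P with forkChoice := rlmdGhost tb η } prop r (σ.body (history P σ prop r) i) i
              (received P σ prop r i) else (received P σ prop r i, ∅)) =
          (fun i => if i ∈ (run P σ prop r).active then
            act P prop r (σ.body (history P σ prop r) i) i (received P σ prop r i)
            else (received P σ prop r i, ∅)) := by
        funext i
        split_ifs with hi
        · exact hact i hi
        · rfl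
      exact congrArg (fun f : Fin n → LocalState n Body × Finset (Message n Body) =>
        { run P σ prop r with
          state := fun i => (f i).1
          sent := fun i => (f i).2 }) hacted
    unfold history
    rw [ih, hnext]

theorem sameOutputs_of_followsRlmd {T : ℕ} (hΔ : 1 ≤ P.Δ)
    (hfol : ∀ u ≤ T + 1, FollowsRlmd tb η P σ prop u) :
    SameOutputs T (run P σ prop) (run { P with forkChoice := rlmdGhost tb η } σ prop) := by
  intro r hr
  have h := history_eq_of_followsRlmd (r := r + 1) hΔ hfol (by omega)
  have : run { P with forkChoice := rlmdGhost tb η } σ prop r = run P σ prop r :=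
    (List.cons.inj h).1
  rw [this]
  exact ⟨rfl, rfl, rfl, fun _ => rfl⟩

/-! ### Honest proposals from active proposers -/

/-- In a compliant execution, fewer than `n` validators are ever corrupted. Hence one of `n` active
proposers escapes corruption until the voting round. -/
theorem pivots_of_active_proposers (hΔ : 1 ≤ P.Δ) (hC : Compliant P.Δ η 0 (run P σ prop)) {m : ℕ}
    (hm : n * m ≤ P.κ)
    (hwin : ∀ a, a + m ≤ N → ∃ t, a ≤ t ∧ t < a + m ∧
      ((run P σ prop (4 * P.Δ * t)).active.Nonempty →
        prop t ∈ (run P σ prop (4 * P.Δ * t)).active)) :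
    Pivots P σ prop N := by
  intro a ha
  have hle : ∀ j < n, j * m + m ≤ P.κ := fun j hj => by
    have := Nat.mul_le_mul_right m (show j + 1 ≤ n by omega)
    rw [Nat.succ_mul] at this
    omega
  have hex : ∀ j : Fin n, ∃ t, a + j * m ≤ t ∧ t < a + j * m + m ∧
      prop t ∈ (run P σ prop (4 * P.Δ * t)).active := by
    intro j
    have := hle j j.2
    obtain ⟨t, h₁, h₂, h₃⟩ := hwin (a + j * m) (by omega)
    obtain ⟨v, hv⟩ := active_nonempty hC hΔ t
    exact ⟨t, h₁, h₂, h₃ ⟨v, active_of_le_of_slot (t := t) hv (by omega) le_rfl (by omega)⟩⟩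
  choose q hq₁ hq₂ hq₃ using hex
  by_cases hgood : ∃ j, prop (q j) ∉ (run P σ prop (4 * P.Δ * q j + P.Δ)).corrupted
  · obtain ⟨j, hj⟩ := hgood
    have hsent : ∃ B V, Message.proposal B V (q j) (prop (q j)) ∈
        (run P σ prop (4 * P.Δ * q j)).sent (prop (q j)) := by
      rcases run_cases (P := P) (σ := σ) (prop := prop) (r := 4 * P.Δ * q j) (i := prop (q j))
        (q j) 0 rfl (by omega) with
        ⟨-, -, h⟩ | ⟨-, -, -, b, -, h⟩ | ⟨-, h, -⟩ | ⟨-, h, -⟩ | ⟨-, h, -⟩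
      · exact absurd rfl ((h (hq₃ j)).1 rfl)
      · exact ⟨_, _, by rw [h]; exact Finset.mem_singleton_self _⟩
      · omega
      · omega
      · omega
    obtain ⟨B, hB⟩ := hsent
    have := hle j j.2
    have := hq₁ j
    have := hq₂ j
    exact ⟨q j, B, by omega, by omega, hq₃ j, hB, hj⟩
  · push Not at hgood
    exfalso
    -- otherwise the `n` proposers are distinct, as each is corrupted only after it was active
    have hlt : ∀ j k : Fin n, j < k → prop (q j) ≠ prop (q k) := by
      intro j k hjk heq
      have hjm := Nat.mul_le_mul_right m (show (j : ℕ) + 1 ≤ k from hjk)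
      rw [Nat.succ_mul] at hjm
      have := hq₂ j
      have := hq₁ k
      have hround := round_le_of_slot_lt P.Δ (show q j < q k by omega)
      refine not_corrupted_of_active (hq₃ k) (corrupted_mono ?_ (heq ▸ hgood j))
      omega
    have hinj : Function.Injective fun j => prop (q j) := by
      intro j k h
      rcases lt_trichotomy j k with h' | h' | h'
      · exact absurd h (hlt j k h')
      · exact h'
      · exact absurd h.symm (hlt k j h')
    have hall : ∀ v, v ∈ (run P σ prop (4 * P.Δ * (a + P.κ) + P.Δ)).corrupted := by
      intro v
      obtain ⟨j, rfl⟩ := Finite.surjective_of_injective hinj v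
      refine corrupted_mono ?_ (hgood j)
      have := hle j j.2
      have := hq₂ j
      have := Nat.mul_le_mul_left (4 * P.Δ) (show q j ≤ a + P.κ by omega)
      omega
    have h := corrupted_minority hΔ hC (a + P.κ)
    rw [Finset.eq_univ_iff_forall.2 hall, Finset.card_univ, Fintype.card_fin] at h
    omega

end Agreement

/-! ### Executions do not depend on future proposers -/

section Causality

variable {prop prop' : ℕ → Fin n} {t : ℕ}

theorem Block.valid_congr (h : ∀ s ≤ t, prop s = prop' s) {B : Block n Body} (hB : B.slot ≤ t) :
    B.Valid prop ↔ B.Valid prop' := by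
  induction B with
  | genesis => exact Iff.rfl
  | mk p b s a ih =>
    have hs : s ≤ t := hB
    simp only [Block.Valid, h s hs]
    constructor
    · rintro ⟨hp, ha, hs'⟩
      refine ⟨(ih ?_).1 hp, ha, hs'⟩
      rcases hs' with rfl | hs'
      · exact Nat.zero_le _
      · omega
    · rintro ⟨hp, ha, hs'⟩
      refine ⟨(ih ?_).2 hp, ha, hs'⟩
      rcases hs' with rfl | hs'
      · exact Nat.zero_le _
      · omega

theorem Item.acceptable_congr (h : ∀ s ≤ t, prop s = prop' s) (x : Item n Body) :
    x.Acceptable prop t ↔ x.Acceptable prop' t := by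
  have key : ∀ B : Block n Body, (B.Valid prop ∧ B.slot ≤ t) ↔ (B.Valid prop' ∧ B.slot ≤ t) :=
    fun B => and_congr_left fun hB => Block.valid_congr h hB
  cases x with
  | block B => exact key B
  | headVote B s v => simp only [Item.Acceptable, ← and_assoc, key]
  | ffgVote C D v => simp only [Item.Acceptable, ← and_assoc, key]

theorem acceptableProposal_congr (h : ∀ s ≤ t, prop s = prop' s) (B : Block n Body) (s : ℕ)
    (v : Fin n) : AcceptableProposal prop t B s v ↔ AcceptableProposal prop' t B s v := by
  unfold AcceptableProposal
  rw [Item.acceptable_congr h]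
  constructor
  · rintro ⟨h₁, h₂, h₃⟩; exact ⟨h₁.trans (h s h₂), h₂, h₃⟩
  · rintro ⟨h₁, h₂, h₃⟩; exact ⟨h₁.trans (h s h₂).symm, h₂, h₃⟩

theorem nextConfig_congr (P : Protocol n Body) (σ : Adversary n Body) (r : ℕ)
    (l : List (Config n Body)) (h : ∀ s ≤ r / (4 * P.Δ), prop s = prop' s) :
    nextConfig P σ prop r l = nextConfig P σ prop' r l := by
  have hb : toBuffer (Body := Body) prop (r / (4 * P.Δ)) = toBuffer prop' (r / (4 * P.Δ)) := by
    funext m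
    cases m <;> simp only [toBuffer, Item.acceptable_congr h, acceptableProposal_congr h]
  have hv : toView (Body := Body) P.Δ prop r = toView P.Δ prop' r := by
    funext m
    cases m with
    | item x => rfl
    | proposal B V s v =>
      have : Item.Acceptable (Body := Body) prop (r / (4 * P.Δ)) =
          Item.Acceptable prop' (r / (4 * P.Δ)) :=
        funext fun x => propext (Item.acceptable_congr h x)
      simp only [toView, this, acceptableProposal_congr h]
  have hrec : receive (Body := Body) P.Δ prop r = receive P.Δ prop' r := by
    funext a M L
    unfold receive
    rw [hb, hv]
  have hact : act P prop r = act P prop' r := by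
    funext b i L
    unfold act
    simp only [h _ le_rfl]
  unfold nextConfig
  simp only [h _ le_rfl, hrec, hact]

/-- The active validators at the start of a slot are determined by the proposers of earlier slots.
-/
theorem active_congr (P : Protocol n Body) (σ : Adversary n Body) (hΔ : 1 ≤ P.Δ)
    (h : ∀ s < t, prop s = prop' s) :
    (run P σ prop (4 * P.Δ * t)).active = (run P σ prop' (4 * P.Δ * t)).active := by
  have hist : ∀ r ≤ 4 * P.Δ * t, history P σ prop r = history P σ prop' r := by
    intro r hr
    induction r with
    | zero => rfl
    | succ r ih =>
      unfold history
      rw [ih (by omega), nextConfig_congr]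
      intro s hs
      refine h s (hs.trans_lt ?_)
      rw [Nat.div_lt_iff_lt_mul (by omega), Nat.mul_comm]
      omega
  unfold run
  rw [hist _ le_rfl]
  rfl

end Causality

/-! ### Windows without active proposers are improbable -/

section Probability

open MeasureTheory Filter Topology
open scoped ENNReal

/-- The distribution of the proposers: independent and uniform. -/
noncomputable abbrev proposers (n : ℕ) [NeZero n] : Measure (ℕ → Fin n) :=
  Measure.infinitePi (fun _ : ℕ => (PMF.uniformOfFintype (Fin n)).toMeasure)

/-- The event `A` is determined by the proposers of the slots before `t`. -/
def DependsBefore (t : ℕ) (A : Set (ℕ → Fin n)) : Prop :=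
  ∀ ω ω' : ℕ → Fin n, (∀ s < t, ω s = ω' s) → ω ∈ A → ω' ∈ A

/-- The cylinder of the sequences that agree with `ω` before `t`. -/
def cylinder (t : ℕ) (ω : ℕ → Fin n) : Set (ℕ → Fin n) :=
  Set.pi (Finset.range t) fun s => {ω s}

theorem mem_cylinder {t : ℕ} {ω ω' : ℕ → Fin n} :
    ω' ∈ cylinder t ω ↔ ∀ s < t, ω' s = ω s := by
  simp [cylinder, Set.mem_pi]

theorem measurableSet_cylinder (t : ℕ) (ω : ℕ → Fin n) : MeasurableSet (cylinder t ω) :=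
  MeasurableSet.pi (Finset.range t).countable_toSet fun _ _ => MeasurableSet.of_discrete

theorem proposers_cylinder_inter [NeZero n] (t : ℕ) (ω : ℕ → Fin n) (v : Fin n) :
    proposers n (cylinder t ω ∩ {ω' | ω' t ≠ v}) =
      (1 - (n : ℝ≥0∞)⁻¹) * proposers n (cylinder t ω) := by
  have h₁ : cylinder t ω ∩ {ω' | ω' t ≠ v} =
      Set.pi (Finset.range (t + 1)) fun s => if s = t then {v}ᶜ else {ω s} := by
    ext ω'
    simp only [Set.mem_inter_iff, mem_cylinder, Set.mem_ofPred_eq, Set.mem_pi, Finset.coe_range,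
      Set.mem_Iio]
    constructor
    · rintro ⟨h, hv⟩ s hs
      split_ifs with hst
      · rw [hst]; exact hv
      · exact h s (by omega)
    · intro h
      refine ⟨fun s hs => ?_, ?_⟩
      · have := h s (by omega)
        rwa [if_neg (by omega)] at this
      · have := h t (by omega)
        rwa [if_pos rfl] at this
  have h₂ : (PMF.uniformOfFintype (Fin n)).toMeasure {v}ᶜ = 1 - (n : ℝ≥0∞)⁻¹ := by
    rw [prob_compl_eq_one_sub (MeasurableSet.of_discrete),
      PMF.toMeasure_apply_singleton _ _ MeasurableSet.of_discrete, PMF.uniformOfFintype_apply,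
      Fintype.card_fin]
  rw [h₁, proposers, Measure.infinitePi_pi _ fun _ _ => MeasurableSet.of_discrete,
    Finset.prod_range_succ, if_pos rfl, h₂, cylinder,
    Measure.infinitePi_pi _ fun _ _ => MeasurableSet.of_discrete, mul_comm]
  congr 1
  refine Finset.prod_congr rfl fun s hs => ?_
  rw [if_neg (Finset.mem_range.1 hs).ne]

/-- Whatever happened before slot `t`, the proposer of slot `t` misses a nonempty set chosen
beforehand with probability at most `1 - 1/n`. -/
theorem proposers_miss_le [NeZero n] {t : ℕ} {A : Set (ℕ → Fin n)} (hA : DependsBefore t A)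
    {U : (ℕ → Fin n) → Finset (Fin n)}
    (hU : ∀ ω ω' : ℕ → Fin n, (∀ s < t, ω s = ω' s) → U ω = U ω') :
    proposers n (A ∩ {ω | (U ω).Nonempty ∧ ω t ∉ U ω}) ≤
      (1 - (n : ℝ≥0∞)⁻¹) * proposers n A := by
  -- a prefix of length `t` is extended by an arbitrary value, on which nothing depends
  let ext : (Fin t → Fin n) → ℕ → Fin n := fun x s => if h : s < t then x ⟨s, h⟩ else 0
  have hext : ∀ ω : ℕ → Fin n, ω ∈ cylinder t (ext fun s => ω s) := by
    intro ω
    refine mem_cylinder.2 fun s hs => ?_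
    simp [ext, hs]
  let F : Finset (Fin t → Fin n) := Finset.univ.filter fun x => ext x ∈ A
  have hAF : A = ⋃ x ∈ F, cylinder t (ext x) := by
    ext ω
    simp only [Set.mem_iUnion]
    constructor
    · intro hω
      refine ⟨fun s => ω s, Finset.mem_filter.2 ⟨Finset.mem_univ _, ?_⟩, hext ω⟩
      exact hA ω _ (mem_cylinder.1 (hext ω)) hω
    · rintro ⟨x, hx, hω⟩
      exact hA _ ω (fun s hs => (mem_cylinder.1 hω s hs).symm) (Finset.mem_filter.1 hx).2
  have hdisj : Set.PairwiseDisjoint (F : Set (Fin t → Fin n)) fun x => cylinder t (ext x) := by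
    intro x _ y _ hxy
    refine Set.disjoint_left.2 fun ω hx hy => hxy ?_
    funext s
    have h₁ := mem_cylinder.1 hx s s.2
    have h₂ := mem_cylinder.1 hy s s.2
    rw [h₁] at h₂
    simpa [ext] using h₂
  have hsub : A ∩ {ω | (U ω).Nonempty ∧ ω t ∉ U ω} ⊆
      ⋃ x ∈ F, (cylinder t (ext x) ∩
        {ω | ω t ≠ if h : (U (ext x)).Nonempty then h.choose else 0}) := by
    rintro ω ⟨hω, hne, hmiss⟩
    rw [hAF] at hω
    simp only [Set.mem_iUnion] at hω ⊢
    obtain ⟨x, hx, hωx⟩ := hω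
    have hUx : U ω = U (ext x) := hU ω (ext x) (mem_cylinder.1 hωx)
    rw [hUx] at hne hmiss
    refine ⟨x, hx, hωx, ?_⟩
    rw [Set.mem_ofPred_eq, dif_pos hne]
    intro h
    rw [h] at hmiss
    exact hmiss hne.choose_spec
  calc proposers n (A ∩ {ω | (U ω).Nonempty ∧ ω t ∉ U ω})
      ≤ ∑ x ∈ F, proposers n (cylinder t (ext x) ∩
          {ω | ω t ≠ if h : (U (ext x)).Nonempty then h.choose else 0}) :=
        (measure_mono hsub).trans (measure_biUnion_finset_le _ _)
    _ = (1 - (n : ℝ≥0∞)⁻¹) * ∑ x ∈ F, proposers n (cylinder t (ext x)) := by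
        rw [Finset.mul_sum]
        exact Finset.sum_congr rfl fun x _ => proposers_cylinder_inter t _ _
    _ = (1 - (n : ℝ≥0∞)⁻¹) * proposers n A := by
        rw [← measure_biUnion_finset hdisj fun x _ => measurableSet_cylinder t _, ← hAF]

/-- The probability that the proposers of `m` consecutive slots all miss nonempty sets that are
determined by the proposers before them. -/
theorem proposers_miss_window_le [NeZero n] {U : ℕ → (ℕ → Fin n) → Finset (Fin n)}
    (hU : ∀ t, ∀ ω ω' : ℕ → Fin n, (∀ s < t, ω s = ω' s) → U t ω = U t ω') (a m : ℕ) :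
    proposers n {ω | ∀ t, a ≤ t → t < a + m → (U t ω).Nonempty ∧ ω t ∉ U t ω} ≤
      (1 - (n : ℝ≥0∞)⁻¹) ^ m := by
  induction m with
  | zero => rw [pow_zero]; exact prob_le_one
  | succ m ih =>
    have hdep : DependsBefore (a + m)
        {ω : ℕ → Fin n | ∀ t, a ≤ t → t < a + m → (U t ω).Nonempty ∧ ω t ∉ U t ω} := by
      intro ω ω' h hω t h₁ h₂
      rw [← hU t ω ω' fun s hs => h s (by omega), ← h t h₂]
      exact hω t h₁ h₂
    have hset : {ω : ℕ → Fin n | ∀ t, a ≤ t → t < a + (m + 1) →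
          (U t ω).Nonempty ∧ ω t ∉ U t ω} ⊆
        {ω | ∀ t, a ≤ t → t < a + m → (U t ω).Nonempty ∧ ω t ∉ U t ω} ∩
          {ω | (U (a + m) ω).Nonempty ∧ ω (a + m) ∉ U (a + m) ω} := fun ω hω =>
      ⟨fun t h₁ h₂ => hω t h₁ (by omega), hω (a + m) (by omega) (by omega)⟩
    rw [pow_succ']
    exact (measure_mono hset).trans ((proposers_miss_le hdep (hU (a + m))).trans
      (mul_le_mul_right ih _))

/-- A bound for every value of the coins of the adversary is a bound for the joint probability;
the events need not be measurable. -/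
theorem randomness_le [NeZero n] {C : Type} [MeasurableSpace C] [DiscreteMeasurableSpace C]
    (coins : PMF C) {S : Set (C × (ℕ → Fin n))} {ε : ℝ≥0∞}
    (h : ∀ c, proposers n {ω | (c, ω) ∈ S} ≤ ε) : randomness n C coins S ≤ ε := by
  -- the coins have countably many values, so that the measurable hulls of the slices can be united
  let S' : Set (C × (ℕ → Fin n)) := (coins.supportᶜ ×ˢ Set.univ) ∪
    ⋃ c ∈ coins.support, {c} ×ˢ toMeasurable (proposers n) {ω | (c, ω) ∈ S}
  have hsub : S ⊆ S' := by
    rintro ⟨c, ω⟩ hω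
    by_cases hc : c ∈ coins.support
    · exact Or.inr (Set.mem_iUnion₂.2 ⟨c, hc, rfl, subset_toMeasurable _ _ hω⟩)
    · exact Or.inl ⟨hc, trivial⟩
  have hmeas : MeasurableSet S' := by
    refine (MeasurableSet.of_discrete.prod MeasurableSet.univ).union
      (MeasurableSet.biUnion coins.support_countable fun c _ =>
        MeasurableSet.of_discrete.prod (measurableSet_toMeasurable _ _))
  have hslice : ∀ c ∈ coins.support, proposers n (Prod.mk c ⁻¹' S') ≤ ε := by
    intro c hc
    refine (measure_mono ?_).trans ((measure_toMeasurable _).le.trans (h c))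
    rintro ω (⟨hc', -⟩ | hω)
    · exact absurd hc hc'
    · obtain ⟨c', -, hcc', hω⟩ := Set.mem_iUnion₂.1 hω
      have : c = c' := hcc'
      subst this
      exact hω
  have hae : ∀ᵐ c ∂coins.toMeasure, proposers n (Prod.mk c ⁻¹' S') ≤ ε := by
    have hnull : coins.toMeasure coins.supportᶜ = 0 := by
      rw [PMF.toMeasure_apply_eq_zero_iff _ MeasurableSet.of_discrete]
      exact disjoint_compl_right
    refine measure_mono_null ?_ hnull
    intro c hc hcs
    exact hc (hslice c hcs)
  calc randomness n C coins S ≤ randomness n C coins S' := measure_mono hsub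
    _ = ∫⁻ c, proposers n (Prod.mk c ⁻¹' S') ∂coins.toMeasure := Measure.prod_apply hmeas
    _ ≤ ∫⁻ _, ε ∂coins.toMeasure := lintegral_mono_ae hae
    _ = ε := by simp

theorem superpolynomialDecay_pow_div {n : ℕ} (hn : 0 < n) {q : ℝ} (h₀ : 0 ≤ q) (h₁ : q < 1) :
    Asymptotics.SuperpolynomialDecay atTop (fun κ : ℕ => (κ : ℝ)) fun κ => q ^ (κ / n) := by
  intro k
  have hlim : Tendsto (fun κ : ℕ => (2 * n : ℝ) ^ k * (((κ / n : ℕ) : ℝ) ^ k * q ^ (κ / n)))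
      atTop (𝓝 0) := by
    have := (tendsto_pow_const_mul_const_pow_of_abs_lt_one k
      (by rwa [abs_of_nonneg h₀])).comp (Nat.tendsto_div_const_atTop hn.ne')
    simpa using this.const_mul ((2 * n : ℝ) ^ k)
  refine squeeze_zero' (Eventually.of_forall fun κ => by positivity) ?_ hlim
  filter_upwards [eventually_ge_atTop n] with κ hκ
  have hle : κ ≤ 2 * n * (κ / n) := by
    have h₁ := Nat.lt_mul_div_succ κ hn
    have h₂ : 1 ≤ κ / n := (Nat.one_le_div_iff hn).2 hκ
    have h₃ := Nat.mul_le_mul_left n h₂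
    rw [Nat.mul_succ] at h₁
    rw [Nat.mul_assoc]
    omega
  have hle' : (κ : ℝ) ≤ 2 * n * ((κ / n : ℕ) : ℝ) := by exact_mod_cast hle
  rw [← mul_assoc, ← mul_pow]
  exact mul_le_mul_of_nonneg_right (pow_le_pow_left₀ (Nat.cast_nonneg _) hle' k) (by positivity)

/-- A property of compliant executions in which every window of `κ` slots contains an honest
proposal holds with overwhelming probability. -/
theorem overwhelming_of_pivots [NeZero n] {Δ η : ℕ} (hΔ : 1 ≤ Δ) (P : ℕ → Protocol n Body)
    (hPΔ : ∀ κ, (P κ).Δ = Δ) (hPκ : ∀ κ, (P κ).κ = κ)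
    {Q : ℕ → ℕ → Adversary n Body → (ℕ → Fin n) → Prop}
    (h : ∀ κ T σ prop, Compliant Δ η 0 (run (P κ) σ prop) → Pivots (P κ) σ prop (T + 1) →
      Q κ T σ prop) :
    Overwhelming fun κ T σ prop => Compliant Δ η 0 (run (P κ) σ prop) → Q κ T σ prop := by
  intro horizon
  have hn : 0 < n := Nat.pos_of_neZero n
  have hq₀ : 0 ≤ 1 - (n : ℝ)⁻¹ := by
    rw [sub_nonneg]
    exact inv_le_one_of_one_le₀ (by exact_mod_cast hn)
  have hq₁ : 1 - (n : ℝ)⁻¹ < 1 := by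
    rw [sub_lt_self_iff]
    positivity
  -- windows of `κ / n` slots before slot `T + 1` start in one of the slots `0, …, T + 1`
  refine ⟨fun κ => (((horizon + 2).map (Nat.castRingHom ℝ)).eval (κ : ℝ)) *
    (1 - (n : ℝ)⁻¹) ^ (κ / n),
    (superpolynomialDecay_pow_div hn hq₀ hq₁).polynomial_mul _, ?_⟩
  intro κ C _ _ coins σ
  set T := horizon.eval κ with hT
  set m := κ / n with hm
  have hbound : randomness n C coins {ω | ¬ (Compliant Δ η 0 (run (P κ) (σ ω.1) ω.2) →
      Q κ T (σ ω.1) ω.2)} ≤ ((T + 2 : ℕ) : ℝ≥0∞) * (1 - (n : ℝ≥0∞)⁻¹) ^ m := by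
    refine randomness_le coins fun c => ?_
    let U : ℕ → (ℕ → Fin n) → Finset (Fin n) :=
      fun t ω => (run (P κ) (σ c) ω (4 * (P κ).Δ * t)).active
    have hsub : {ω | (c, ω) ∈ {ω : C × (ℕ → Fin n) |
          ¬ (Compliant Δ η 0 (run (P κ) (σ ω.1) ω.2) → Q κ T (σ ω.1) ω.2)}} ⊆
        ⋃ a ∈ Finset.range (T + 2),
          {ω | ∀ t, a ≤ t → t < a + m → (U t ω).Nonempty ∧ ω t ∉ U t ω} := by
      intro ω hω
      by_contra hgood
      refine hω fun hC => h κ T (σ c) ω hC ?_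
      refine pivots_of_active_proposers (η := η) (m := m) (by rw [hPΔ]; exact hΔ)
        (by rw [hPΔ]; exact hC) (by rw [hPκ]; exact Nat.mul_div_le κ n) ?_
      intro a ha
      by_contra hbad
      push Not at hbad
      have haT : a ≤ T + 1 := (Nat.le_add_right a m).trans ha
      exact hgood (Set.mem_iUnion₂.2 ⟨a, Finset.mem_range.2 (by omega), hbad⟩)
    have hU : ∀ t, ∀ ω ω' : ℕ → Fin n, (∀ s < t, ω s = ω' s) → U t ω = U t ω' :=
      fun t ω ω' h => active_congr (P κ) (σ c) (by rw [hPΔ]; exact hΔ) h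
    clear_value U
    calc proposers n _ ≤ ∑ a ∈ Finset.range (T + 2), proposers n
          {ω | ∀ t, a ≤ t → t < a + m → (U t ω).Nonempty ∧ ω t ∉ U t ω} :=
          (measure_mono hsub).trans (measure_biUnion_finset_le _ _)
      _ ≤ ∑ _a ∈ Finset.range (T + 2), (1 - (n : ℝ≥0∞)⁻¹) ^ m :=
          Finset.sum_le_sum fun a _ => proposers_miss_window_le hU a m
      _ = ((T + 2 : ℕ) : ℝ≥0∞) * (1 - (n : ℝ≥0∞)⁻¹) ^ m := by
          rw [Finset.sum_const, Finset.card_range, nsmul_eq_mul]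
  have hfin : ((T + 2 : ℕ) : ℝ≥0∞) * (1 - (n : ℝ≥0∞)⁻¹) ^ m ≠ ∞ :=
    ENNReal.mul_ne_top (ENNReal.natCast_ne_top _)
      (ENNReal.pow_ne_top (ENNReal.sub_ne_top ENNReal.one_ne_top))
  have hreal := ENNReal.toReal_mono hfin hbound
  have hinv : (n : ℝ≥0∞)⁻¹ ≤ 1 := by
    rw [ENNReal.inv_le_one]
    exact_mod_cast hn
  rw [ENNReal.toReal_mul, ENNReal.toReal_pow, ENNReal.toReal_sub_of_le hinv ENNReal.one_ne_top,
    ENNReal.toReal_natCast, ENNReal.toReal_inv, ENNReal.toReal_natCast, ENNReal.toReal_one] at hreal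
  have hev : ((horizon + 2).map (Nat.castRingHom ℝ)).eval (κ : ℝ) = ((T + 2 : ℕ) : ℝ) := by
    rw [Polynomial.eval_natCast_map]
    simp [hT]
  beta_reduce
  rw [hev]
  exact hreal

end Probability

end SSF

theorem mainTheorem1 {n : ℕ} [NeZero n] {Body : Type*} (Δ η : ℕ) (hΔ : 1 ≤ Δ) (hη : 1 ≤ η)
    (tb : SSF.TieBreak (SSF.Block n Body)) (tc : SSF.TieBreak (SSF.Checkpoint n Body)) :
    -- in compliant executions with HFC, the outputs are the same as with RLMD-GHOST
    SSF.Overwhelming (fun κ T (σ : SSF.Adversary n Body) prop =>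
      SSF.Compliant Δ η 0 (SSF.run (SSF.hfcProtocol Δ η tb tc κ) σ prop) →
      SSF.SameOutputs T (SSF.run (SSF.hfcProtocol Δ η tb tc κ) σ prop)
        (SSF.run (SSF.rlmdProtocol Δ η tb tc κ) σ prop)) ∧
    -- reorg resilience of the protocol with HFC
    SSF.Overwhelming (fun κ T (σ : SSF.Adversary n Body) prop =>
      SSF.Compliant Δ η 0 (SSF.run (SSF.hfcProtocol Δ η tb tc κ) σ prop) →
      SSF.ReorgResilient Δ T prop (SSF.run (SSF.hfcProtocol Δ η tb tc κ) σ prop)) ∧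
    -- dynamic availability of the protocol with HFC: safety, and liveness within time O(κ)
    (∃ Tconf : ℕ → ℕ,
      (fun κ => (Tconf κ : ℝ)) =O[Filter.atTop] (fun κ : ℕ => (κ : ℝ)) ∧
      SSF.Overwhelming (fun κ T (σ : SSF.Adversary n Body) prop =>
        SSF.Compliant Δ η 0 (SSF.run (SSF.hfcProtocol Δ η tb tc κ) σ prop) →
        SSF.Safe T (SSF.run (SSF.hfcProtocol Δ η tb tc κ) σ prop) ∧
        SSF.Live Δ (Tconf κ) T prop (SSF.run (SSF.hfcProtocol Δ η tb tc κ) σ prop))) ∧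
    -- reorg resilience and liveness of fast confirmations of the protocol with HFC
    SSF.Overwhelming (fun κ T (σ : SSF.Adversary n Body) prop =>
      SSF.Compliant Δ η 0 (SSF.run (SSF.hfcProtocol Δ η tb tc κ) σ prop) →
      SSF.FastReorgResilient Δ T (SSF.run (SSF.hfcProtocol Δ η tb tc κ) σ prop)) ∧
    SSF.Overwhelming (fun κ T (σ : SSF.Adversary n Body) prop =>
      SSF.Compliant Δ η 0 (SSF.run (SSF.hfcProtocol Δ η tb tc κ) σ prop) →
      SSF.FastLive Δ T prop (SSF.run (SSF.hfcProtocol Δ η tb tc κ) σ prop)) := by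
  have hF : ∀ κ, SSF.SelectsFromView (SSF.hfcProtocol Δ η tb tc κ) :=
    fun κ V t => SSF.hfc_mem_tree tb tc η V t
  have hfol : ∀ κ T (σ : SSF.Adversary n Body) prop,
      SSF.Compliant Δ η 0 (SSF.run (SSF.hfcProtocol Δ η tb tc κ) σ prop) →
      SSF.Pivots (SSF.hfcProtocol Δ η tb tc κ) σ prop (T + 1) →
      ∀ u ≤ T + 1, SSF.FollowsRlmd tb η (SSF.hfcProtocol Δ η tb tc κ) σ prop u :=
    fun κ T σ prop hC hpiv u hu => SSF.followsRlmd_of_pivots (tb := tb) hΔ hη rfl hC hpiv hu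
  refine ⟨?_, ?_, ⟨fun κ => 8 * Δ * κ + 8 * Δ, ?_, ?_⟩, ?_, ?_⟩
  · exact SSF.overwhelming_of_pivots hΔ (SSF.hfcProtocol Δ η tb tc) (fun _ => rfl) (fun _ => rfl)
      fun κ T σ prop hC hpiv => SSF.sameOutputs_of_followsRlmd hΔ (hfol κ T σ prop hC hpiv)
  · exact SSF.overwhelming_of_pivots hΔ (SSF.hfcProtocol Δ η tb tc) (fun _ => rfl) (fun _ => rfl)
      fun κ T σ prop hC hpiv =>
        SSF.reorgResilient_of_followsRlmd hΔ hη (hF κ) hC (hfol κ T σ prop hC hpiv)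
  · refine Asymptotics.IsBigO.of_bound (16 * Δ) ?_
    filter_upwards [Filter.eventually_ge_atTop 1] with κ hκ
    have h : 8 * Δ * κ + 8 * Δ ≤ 16 * Δ * κ := by
      have := Nat.mul_le_mul_left (8 * Δ) hκ
      have h' : 16 * Δ * κ = 8 * Δ * κ + 8 * Δ * κ := by ring
      omega
    rw [Real.norm_natCast, Real.norm_natCast]
    exact_mod_cast h
  · exact SSF.overwhelming_of_pivots hΔ (SSF.hfcProtocol Δ η tb tc) (fun _ => rfl) (fun _ => rfl)
      fun κ T σ prop hC hpiv =>
        ⟨SSF.safe_of_followsRlmd hΔ hη (hF κ) hC (hfol κ T σ prop hC hpiv) hpiv,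
          SSF.live_of_followsRlmd hΔ hη (hF κ) hC (hfol κ T σ prop hC hpiv) hpiv⟩
  · exact SSF.overwhelming_of_pivots hΔ (SSF.hfcProtocol Δ η tb tc) (fun _ => rfl) (fun _ => rfl)
      fun κ T σ prop hC hpiv =>
        SSF.fastReorgResilient_of_followsRlmd hΔ hη hC (hfol κ T σ prop hC hpiv)
  · exact SSF.overwhelming_of_pivots hΔ (SSF.hfcProtocol Δ η tb tc) (fun _ => rfl) (fun _ => rfl)
      fun κ T σ prop hC hpiv =>
        SSF.fastLive_of_followsRlmd hΔ (hF κ) hC (hfol κ T σ prop hC hpiv)
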